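/- All systems are finite-dimensional and logarithms are to base 2. Let $\mathcal N^{A'S\to B}$ be a quantum channel (completely positive and trace preserving) and $|\psi\rangle^{SS'}$ a pure state; the sender has access to $S'$ and to the input $A'$, and the receiver gets $B$. For $n$ uses of the channel, a code with parameters $(|R|,|\tilde A|,|\hat A|)$ and error $\varepsilon$ consists of an encoding channel $\mathcal E^{R'\tilde A S'^n\to A'^n\hat A}$ and a decoding channel $\mathcal D^{B^n\tilde B\to\bar B\hat B}$ with $\|\mathcal D(\mathcal N^{\otimes n}(\mathcal E(\Phi^{RR'}\otimes\Phi^{\tilde A\tilde B}\otimes(\psi^{SS'})^{\otimes n})))-\Phi^{R\bar B}\otimes\Phi^{\hat A\hat B}\|_1\le\varepsilon$, where $\Phi$ denotes maximally entangled states. A real number $Q$ is an achievable unassisted rate if there are codes for all $n$ with $|\tilde A|=|\hat A|=1$, errors $\varepsilon_n\to0$ and $\frac1n\log|R|\to Q$; the unassisted capacity is the supremum of the achievable unassisted rates. Let $\sigma^{AA'S}$ be a mixed state with $\sigma^S=\psi^S$, let $\mathcal N(\sigma)$ be the resulting state on $AB$, let $D$ be a system purifying $\sigma$, and let $E$ be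 the environment of an isometric extension of $\mathcal N$, so that $ABED$ is in a pure state. Let $I(X;Y)=H(X)+H(Y)-H(XY)$ be the mutual information and $I(A\rangle B)=H(B)-H(AB)$ the coherent information. Then: 1. (Entanglement cost.) If $I(A;B)_{\mathcal N(\sigma)}>I(A;S)_\sigma$, there are codes with vanishing error, $\frac1n\log|R|\to\frac12I(A;B)_{\mathcal N(\sigma)}-\frac12I(A;S)_\sigma$, $\frac1n\log|\tilde A|\to\frac12I(A;ED)_{\mathcal N(\sigma)}$ and $\frac1n\log|\hat A|\to\frac12I(A;S)_\sigma$; hence entanglement is consumed at the net rate $\frac12[I(A;ED)_{\mathcal N(\sigma)}-I(A;S)_\sigma]$. 2. (Unassisted rate.) Transmission rate minus net entanglement cost is $$\tfrac12I(A;B)_{\mathcal N(\sigma)}-\tfrac12I(A;S)_\sigma-\tfrac12[I(A;ED)_{\mathcal N(\sigma)}-I(A;S)_\sigma]=I(A\rangle B)_{\mathcal N(\sigma)}.$$ If the net entanglement cost $\frac12[I(A;ED)_{\mathcal N(\sigma)}-I(A;S)_\sigma]$ is nonnegative, then every $Q$ with $0\le Q\le I(A\rangle B)_{\mathcal N(\sigma)}$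 is an achievable unassisted rate (in particular $\frac12I(A\rangle B)_{\mathcal N(\sigma)}$ is, when it is nonnegative), and the unassisted capacity is at least $I(A\rangle B)_{\mathcal N(\sigma)}$. 3. For every such $\sigma$, whatever the sign of the net cost, every $Q$ with $0\le Q\le\min\{I(A\rangle B)_{\mathcal N(\sigma)},\ \frac12I(A;B)_{\mathcal N(\sigma)}-\frac12I(A;S)_\sigma\}$ is an achievable unassisted rate, and the unassisted capacity is at least this minimum. -/

import Mathlib

open Matrix Filter Topology
open scoped ComplexOrder

noncomputable section

namespace QSideInfo

/-! Finite-dimensional systems are finite index types (the standard basis of the system);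
operators are complex matrices and a composite system is a product of index types. -/

section States

variable {a b c : Type*} [Fintype a] [Fintype b] [Fintype c]

/-- A density operator. -/
def IsState (ρ : Matrix a a ℂ) : Prop := ρ.PosSemidef ∧ ρ.trace = 1

/-- A normalized ket. -/
def IsKet (v : a → ℂ) : Prop := ∑ i, ‖v i‖ ^ 2 = 1

/-- The rank-one operator `|v⟩⟨v|`. -/
def proj (v : a → ℂ) : Matrix a a ℂ := Matrix.of fun i j => v i * star (v j)

/-- Partial trace over the second factor. -/
def traceSnd (X : Matrix (a × b) (a × b) ℂ) : Matrix a a ℂ :=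
  Matrix.of fun i j => ∑ k, X (i, k) (j, k)

/-- Partial trace over the first factor. -/
def traceFst (X : Matrix (a × b) (a × b) ℂ) : Matrix b b ℂ :=
  Matrix.of fun i j => ∑ k, X (k, i) (k, j)

/-- Partial trace over the middle factor. -/
def traceMid (X : Matrix (a × b × c) (a × b × c) ℂ) : Matrix (a × c) (a × c) ℂ :=
  Matrix.of fun i j => ∑ k, X (i.1, k, i.2) (j.1, k, j.2)

/-- The maximally entangled ket `d^{-1/2} ∑ᵢ |i i⟩`. -/
def maxEnt (d : ℕ) (i j : Fin d) : ℂ := if i = j then ((1 / Real.sqrt d : ℝ) : ℂ) else 0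

variable [DecidableEq a]

/-- The trace norm `tr |M|`, as the sum of the square roots of the eigenvalues of `Mᴴ M`. -/
def traceNorm (M : Matrix a a ℂ) : ℝ :=
  ∑ i, Real.sqrt ((Matrix.isHermitian_conjTranspose_mul_self M).eigenvalues i)

open Classical in
/-- The von Neumann entropy `-∑ λ log₂ λ` over the eigenvalues `λ` of a Hermitian operator
(only ever used for density operators). -/
def entropy (ρ : Matrix a a ℂ) : ℝ :=
  if h : ρ.IsHermitian then ∑ i, Real.negMulLog (h.eigenvalues i) / Real.log 2 else 0

variable [DecidableEq b]

/-- `I(a;b)_ρ = H(a)_ρ + H(b)_ρ - H(ab)_ρ`. -/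
def mutualInfo (ρ : Matrix (a × b) (a × b) ℂ) : ℝ :=
  entropy (traceSnd ρ) + entropy (traceFst ρ) - entropy ρ

/-- The coherent information `I(a⟩b)_ρ = H(b)_ρ - H(ab)_ρ`. -/
def coherentInfo (ρ : Matrix (a × b) (a × b) ℂ) : ℝ :=
  entropy (traceFst ρ) - entropy ρ

end States

section Channels

variable {a b r e : Type*} [Fintype a] [Fintype b] [Fintype e]

/-- Completely positive trace-preserving maps, in operator-sum form. -/
def IsChannel [DecidableEq a] (Φ : Matrix a a ℂ →ₗ[ℂ] Matrix b b ℂ) : Prop :=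
  ∃ (k : ℕ) (K : Fin k → Matrix b a ℂ),
    ∑ i, (K i)ᴴ * K i = 1 ∧ ∀ X, Φ X = ∑ i, K i * X * (K i)ᴴ

/-- `U : a → b ⊗ e` is an isometry with `Φ(X) = tr_e (U X Uᴴ)`. -/
def IsIsometricExtension [DecidableEq a] (Φ : Matrix a a ℂ →ₗ[ℂ] Matrix b b ℂ)
    (U : Matrix (b × e) a ℂ) : Prop :=
  Uᴴ * U = 1 ∧ ∀ X, Φ X = traceSnd (U * X * Uᴴ)

/-- `(id_r ⊗ Φ)(X)`. -/
def applySnd (Φ : Matrix a a ℂ →ₗ[ℂ] Matrix b b ℂ) (X : Matrix (r × a) (r × a) ℂ) :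
    Matrix (r × b) (r × b) ℂ :=
  Matrix.of fun p q => Φ (Matrix.of fun x y => X (p.1, x) (q.1, y)) p.2 q.2

/-- The tensor power `Φ^{⊗ n}`, given by its matrix elements: the `(f, g)` entry of the image
of the matrix unit `|x⟩⟨y|` is `∏ᵢ ⟨fᵢ| Φ(|xᵢ⟩⟨yᵢ|) |gᵢ⟩`. -/
def tensorPower [DecidableEq a] (Φ : Matrix a a ℂ →ₗ[ℂ] Matrix b b ℂ) (n : ℕ) :
    Matrix (Fin n → a) (Fin n → a) ℂ →ₗ[ℂ] Matrix (Fin n → b) (Fin n → b) ℂ where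
  toFun X := Matrix.of fun f g =>
    ∑ x, ∑ y, (∏ i, Φ (Matrix.single (x i) (y i) 1) (f i) (g i)) * X x y
  map_add' X Y := by
    ext f g
    simp [mul_add, Finset.sum_add_distrib]
  map_smul' c X := by
    ext f g
    simp [Finset.mul_sum, mul_left_comm]

end Channels

section Codes

variable {A' S S' B : Type*}
  [Fintype A'] [DecidableEq A'] [Fintype S] [DecidableEq S]
  [Fintype S'] [DecidableEq S'] [Fintype B] [DecidableEq B]

/-- `Φ^{RR'} ⊗ Φ^{B̃Ã} ⊗ ψ^{⊗ n}`, arranged as `(R B̃ Sⁿ) ⊗ (R' Ã S'ⁿ)`; the second factor is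
what the encoder acts on. -/
def inputState (ψ : S × S' → ℂ) (n r t : ℕ) :
    Matrix ((Fin r × Fin t × (Fin n → S)) × (Fin r × Fin t × (Fin n → S')))
      ((Fin r × Fin t × (Fin n → S)) × (Fin r × Fin t × (Fin n → S'))) ℂ :=
  proj fun p => maxEnt r p.1.1 p.2.1 * maxEnt t p.1.2.1 p.2.2.1 *
    ∏ i, ψ (p.1.2.2 i, p.2.2.2 i)

/-- `Φ^{R B̄} ⊗ Φ^{Â B̂}`, arranged as `(R Â) ⊗ (B̄ B̂)`. -/
def targetState (r h : ℕ) :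
    Matrix ((Fin r × Fin h) × (Fin r × Fin h)) ((Fin r × Fin h) × (Fin r × Fin h)) ℂ :=
  proj fun p => maxEnt r p.1.1 p.2.1 * maxEnt h p.1.2 p.2.2

/-- The state after encoding, arranged as `(R Â B̃) ⊗ (A' S)ⁿ`; the second factor is the input of
the `n` channel instances. -/
def encodedState (ψ : S × S' → ℂ) (n r t h : ℕ)
    (enc : Matrix (Fin r × Fin t × (Fin n → S')) (Fin r × Fin t × (Fin n → S')) ℂ →ₗ[ℂ]
      Matrix ((Fin n → A') × Fin h) ((Fin n → A') × Fin h) ℂ) :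
    Matrix ((Fin r × Fin h × Fin t) × (Fin n → A' × S))
      ((Fin r × Fin h × Fin t) × (Fin n → A' × S)) ℂ :=
  let f : (Fin r × Fin h × Fin t) × (Fin n → A' × S) →
      (Fin r × Fin t × (Fin n → S)) × ((Fin n → A') × Fin h) :=
    fun p => ((p.1.1, p.1.2.2, fun i => (p.2 i).2), (fun i => (p.2 i).1, p.1.2.1))
  (applySnd enc (inputState ψ n r t)).submatrix f f

/-- The state after encoding and transmission, arranged as `(R Â) ⊗ (Bⁿ B̃)`; the second factor
is what the decoder acts on. -/
def receivedState (N : Matrix (A' × S) (A' × S) ℂ →ₗ[ℂ] Matrix B B ℂ)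
    (ψ : S × S' → ℂ) (n r t h : ℕ)
    (enc : Matrix (Fin r × Fin t × (Fin n → S')) (Fin r × Fin t × (Fin n → S')) ℂ →ₗ[ℂ]
      Matrix ((Fin n → A') × Fin h) ((Fin n → A') × Fin h) ℂ) :
    Matrix ((Fin r × Fin h) × ((Fin n → B) × Fin t))
      ((Fin r × Fin h) × ((Fin n → B) × Fin t)) ℂ :=
  let f : (Fin r × Fin h) × ((Fin n → B) × Fin t) → (Fin r × Fin h × Fin t) × (Fin n → B) :=
    fun p => ((p.1.1, p.1.2, p.2.2), p.2.1)
  (applySnd (tensorPower N n) (encodedState ψ n r t h enc)).submatrix f f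

/-- There is a code of block length `n` and error at most `ε` for the channel `N` with side
information `ψ` that transmits an `r`-dimensional system, consumes a maximally entangled pair of
local dimension `t` and returns one of local dimension `h`. -/
def HasCode (N : Matrix (A' × S) (A' × S) ℂ →ₗ[ℂ] Matrix B B ℂ) (ψ : S × S' → ℂ)
    (n r t h : ℕ) (ε : ℝ) : Prop :=
  0 < r ∧ 0 < t ∧ 0 < h ∧
  ∃ (enc : Matrix (Fin r × Fin t × (Fin n → S')) (Fin r × Fin t × (Fin n → S')) ℂ →ₗ[ℂ]
        Matrix ((Fin n → A') × Fin h) ((Fin n → A') × Fin h) ℂ)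
    (dec : Matrix ((Fin n → B) × Fin t) ((Fin n → B) × Fin t) ℂ →ₗ[ℂ]
        Matrix (Fin r × Fin h) (Fin r × Fin h) ℂ),
    IsChannel enc ∧ IsChannel dec ∧
    traceNorm (applySnd dec (receivedState N ψ n r t h enc) - targetState r h) ≤ ε

/-- `Q` is an achievable rate without preshared entanglement: there are codes of every block
length that neither consume nor return entanglement, with vanishing error and with
`(1/n) log₂ |R|` converging to `Q`. -/
def UnassistedAchievable (N : Matrix (A' × S) (A' × S) ℂ →ₗ[ℂ] Matrix B B ℂ)
    (ψ : S × S' → ℂ) (Q : ℝ) : Prop :=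
  ∃ (r : ℕ → ℕ) (ε : ℕ → ℝ),
    (∀ n, HasCode N ψ n (r n) 1 1 (ε n)) ∧
    Tendsto ε atTop (𝓝 0) ∧
    Tendsto (fun n => Real.logb 2 (r n) / n) atTop (𝓝 Q)

/-- The unassisted quantum capacity: the supremum of the achievable rates. -/
def unassistedCapacity (N : Matrix (A' × S) (A' × S) ℂ →ₗ[ℂ] Matrix B B ℂ)
    (ψ : S × S' → ℂ) : EReal :=
  ⨆ Q ∈ {Q : ℝ | UnassistedAchievable N ψ Q}, (Q : EReal)

/-- The protocol consumes entanglement at rate `cin`, transmits qubits at rate `Q` and returns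
entanglement at rate `cout`, with vanishing error. -/
def AchievableWithEntanglement (N : Matrix (A' × S) (A' × S) ℂ →ₗ[ℂ] Matrix B B ℂ)
    (ψ : S × S' → ℂ) (Q cin cout : ℝ) : Prop :=
  ∃ (r t h : ℕ → ℕ) (ε : ℕ → ℝ),
    (∀ n, HasCode N ψ n (r n) (t n) (h n) (ε n)) ∧
    Tendsto ε atTop (𝓝 0) ∧
    Tendsto (fun n => Real.logb 2 (r n) / n) atTop (𝓝 Q) ∧
    Tendsto (fun n => Real.logb 2 (t n) / n) atTop (𝓝 cin) ∧
    Tendsto (fun n => Real.logb 2 (h n) / n) atTop (𝓝 cout)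

/-- For a ket `v` on `A (A' S) D` and `U : A' S → B E`, the ket `(1 ⊗ U ⊗ 1) v` on
`A B E D`, as a ket on `B (A (E D))`. -/
def outputKet {A E D : Type*} (U : Matrix (B × E) (A' × S) ℂ)
    (v : (A × A' × S) × D → ℂ) : B × (A × (E × D)) → ℂ :=
  fun p => ∑ x : A' × S, U (p.1, p.2.2.1) x * v ((p.2.1, x), p.2.2.2)

end Codes

end QSideInfo

end
/-!
Take a purification of `σ` on `A A' S D`, tensor it `n` times and apply to `Aⁿ` a matrix of random
phases whose output system is cut into registers `R`, `B̃`, `Â`. For most phases the registers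
`R B̃` are decoupled from `Sⁿ` as soon as `log |R| + log |B̃| - log |Â|` stays below `n H(A|S)`, and
`R Â` is decoupled from the environment `Eⁿ Dⁿ` of the receiver as soon as
`log |R| + log |Â| - log |B̃|` stays below `n H(A|ED) = n I(A⟩B)`; the conditional entropies appear
on restricting to typical subspaces. A purification of a decoupled state is unique up to an isometry
on the purifying system (Uhlmann): the first decoupling yields the encoder, which turns `R' Ã S'ⁿ`
into a system purifying `R B̃ Sⁿ`, and the second yields the decoder. Solving the two inequalities
with equality gives the rates `½ I(A;B) - ½ I(A;S)`, `½ I(A;ED)` and `½ I(A;S)`; taking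
`|B̃| = 1` and discarding the returned entanglement gives the unassisted rates.
-/

noncomputable section

namespace QSideInfo

open scoped Matrix.Norms.Frobenius Kronecker BigOperators

section Frobenius

variable {X Y Z : Type*} [Fintype X] [Fintype Y]

theorem frobenius_norm_sq (M : Matrix X Y ℂ) : ‖M‖ ^ 2 = ∑ x, ∑ y, ‖M x y‖ ^ 2 := by
  simp only [frobenius_norm_def, ← Real.sqrt_eq_rpow, Real.rpow_two]
  exact Real.sq_sqrt (by positivity)

theorem trace_mul_conjTranspose_self (M : Matrix X Y ℂ) :
    (M * Mᴴ).trace = ((‖M‖ ^ 2 : ℝ) : ℂ) := by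
  simp only [frobenius_norm_sq, trace, diag_apply, mul_apply, conjTranspose_apply,
    ← starRingEnd_apply, Complex.mul_conj', Complex.ofReal_sum, Complex.ofReal_pow]

theorem frobenius_norm_sq_eq_re_trace (M : Matrix X Y ℂ) : ‖M‖ ^ 2 = (M * Mᴴ).trace.re := by
  rw [trace_mul_conjTranspose_self, Complex.ofReal_re]

theorem frobenius_norm_sub_sq (M N : Matrix X Y ℂ) :
    ‖M - N‖ ^ 2 = ‖M‖ ^ 2 + ‖N‖ ^ 2 - 2 * (M * Nᴴ).trace.re := by
  have hswap : (N * Mᴴ).trace.re = (M * Nᴴ).trace.re := by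
    rw [← conjTranspose_conjTranspose N, ← conjTranspose_mul, trace_conjTranspose,
      conjTranspose_conjTranspose, Complex.star_def, Complex.conj_re]
  simp only [frobenius_norm_sq_eq_re_trace, conjTranspose_sub, Matrix.sub_mul, Matrix.mul_sub,
    trace_sub, Complex.sub_re, hswap]
  ring

theorem norm_trace_mul_conjTranspose_le (M N : Matrix X Y ℂ) :
    ‖(M * Nᴴ).trace‖ ≤ ‖M‖ * ‖N‖ := by
  refine abs_le_of_sq_le_sq' ?_ (by positivity) |>.2
  calc ‖(M * Nᴴ).trace‖ ^ 2 = ‖∑ p : X × Y, M p.1 p.2 * star (N p.1 p.2)‖ ^ 2 := by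
        simp only [trace, diag_apply, mul_apply, conjTranspose_apply, Fintype.sum_prod_type]
    _ ≤ (∑ p : X × Y, ‖M p.1 p.2‖ * ‖N p.1 p.2‖) ^ 2 := by
        gcongr
        exact (norm_sum_le _ _).trans_eq (by simp only [norm_mul, norm_star])
    _ ≤ (∑ p : X × Y, ‖M p.1 p.2‖ ^ 2) * ∑ p : X × Y, ‖N p.1 p.2‖ ^ 2 :=
        Finset.sum_mul_sq_le_sq_mul_sq _ _ _
    _ = (‖M‖ * ‖N‖) ^ 2 := by
        rw [mul_pow, frobenius_norm_sq, frobenius_norm_sq, Fintype.sum_prod_type,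
          Fintype.sum_prod_type]

/-- The operator norm of `U` is at most one. -/
def IsContraction [DecidableEq Y] (U : Matrix X Y ℂ) : Prop := (1 - Uᴴ * U).PosSemidef

theorem IsContraction.frobenius_norm_mul_le [Fintype Z] [DecidableEq Y] {U : Matrix X Y ℂ}
    (hU : IsContraction U) (M : Matrix Y Z ℂ) : ‖U * M‖ ≤ ‖M‖ := by
  have hdefect : Mᴴ * (1 - Uᴴ * U) * M = Mᴴ * Mᴴᴴ - (U * M)ᴴ * (U * M)ᴴᴴ := by
    simp [Matrix.mul_sub, Matrix.sub_mul, Matrix.mul_assoc]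
  have hnonneg := (hU.conjTranspose_mul_mul_same M).trace_nonneg
  rw [hdefect, trace_sub, trace_mul_conjTranspose_self, trace_mul_conjTranspose_self,
    frobenius_norm_conjTranspose, frobenius_norm_conjTranspose] at hnonneg
  exact pow_le_pow_iff_left₀ (norm_nonneg _) (norm_nonneg _) two_ne_zero |>.1
    (sub_nonneg.1 (by exact_mod_cast hnonneg))

theorem IsContraction.mul [Finite Z] [DecidableEq Y] [DecidableEq Z] {U : Matrix X Y ℂ}
    {V : Matrix Y Z ℂ} (hU : IsContraction U) (hV : IsContraction V) : IsContraction (U * V) := by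
  unfold IsContraction
  convert (hU.conjTranspose_mul_mul_same V).add hV using 1
  simp [Matrix.mul_sub, Matrix.sub_mul, Matrix.mul_assoc]

omit [Fintype Y] in
theorem isContraction_of_isometry [DecidableEq Y] {U : Matrix X Y ℂ} (hU : Uᴴ * U = 1) :
    IsContraction U := by
  rw [IsContraction, hU, sub_self]
  exact PosSemidef.zero

theorem isContraction_of_projection [DecidableEq X] {P : Matrix X X ℂ} (hH : Pᴴ = P)
    (hP : P * P = P) : IsContraction P := by
  unfold IsContraction
  convert posSemidef_conjTranspose_mul_self (1 - P) using 1
  simp [hH, hP, Matrix.mul_sub, Matrix.sub_mul]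

theorem isContraction_of_partialIsometry [DecidableEq Y] {W : Matrix X Y ℂ}
    (hW : W * Wᴴ * W = W) : IsContraction W := by
  have hidem : Wᴴ * W * (Wᴴ * W) = Wᴴ * W := by
    rw [Matrix.mul_assoc, ← Matrix.mul_assoc W, hW]
  have hproj : IsContraction (Wᴴ * W) := isContraction_of_projection (by simp) hidem
  rwa [IsContraction, conjTranspose_mul, conjTranspose_conjTranspose, hidem] at hproj

theorem conjTranspose_partialIsometry {W : Matrix X Y ℂ} (hW : W * Wᴴ * W = W) :
    Wᴴ * Wᴴᴴ * Wᴴ = Wᴴ := by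
  simpa [Matrix.mul_assoc] using congrArg conjTranspose hW

end Frobenius

section Spectral

variable {X Y : Type*} [Fintype X] [DecidableEq X]

/-- `F diag(d) Fᴴ`: for `F` with orthonormal columns, the Hermitian operator with eigenvectors
the columns of `F` and real eigenvalues `d`. -/
def conjDiagonal (F : Matrix Y X ℂ) (d : X → ℝ) : Matrix Y Y ℂ :=
  F * diagonal (fun i => (d i : ℂ)) * Fᴴ

theorem eq_conjDiagonal_eigenvalues {ρ : Matrix X X ℂ} (hρ : ρ.IsHermitian) :
    ρ = conjDiagonal (hρ.eigenvectorUnitary : Matrix X X ℂ) hρ.eigenvalues := by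
  conv_lhs => rw [hρ.spectral_theorem, Unitary.conjStarAlgAut_apply]
  rfl

theorem eigenvectorUnitary_conjTranspose_mul_self {ρ : Matrix X X ℂ} (hρ : ρ.IsHermitian) :
    (hρ.eigenvectorUnitary : Matrix X X ℂ)ᴴ * hρ.eigenvectorUnitary = 1 :=
  Unitary.coe_star_mul_self _

theorem conjDiagonal_mul [Fintype Y] {F : Matrix Y X ℂ} (hF : Fᴴ * F = 1) (d e : X → ℝ) :
    conjDiagonal F d * conjDiagonal F e = conjDiagonal F (d * e) := by
  calc conjDiagonal F d * conjDiagonal F e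
      = F * diagonal (fun i => (d i : ℂ)) * (Fᴴ * F) * diagonal (fun i => (e i : ℂ)) * Fᴴ := by
        simp only [conjDiagonal, Matrix.mul_assoc]
    _ = conjDiagonal F (d * e) := by
        simp only [hF, Matrix.mul_one, Matrix.mul_assoc F, diagonal_mul_diagonal, conjDiagonal,
          Pi.mul_apply, Complex.ofReal_mul]

theorem conjDiagonal_conjTranspose (F : Matrix Y X ℂ) (d : X → ℝ) :
    (conjDiagonal F d)ᴴ = conjDiagonal F d := by
  have hdiag : (star fun i => (d i : ℂ)) = fun i => (d i : ℂ) := by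
    ext i
    simp
  simp only [conjDiagonal, conjTranspose_mul, conjTranspose_conjTranspose,
    diagonal_conjTranspose, Matrix.mul_assoc, hdiag]

theorem conjDiagonal_posSemidef [Finite Y] (F : Matrix Y X ℂ) {d : X → ℝ} (hd : ∀ i, 0 ≤ d i) :
    (conjDiagonal F d).PosSemidef :=
  (posSemidef_diagonal_iff.2 fun i => by exact_mod_cast hd i).mul_mul_conjTranspose_same F

theorem trace_conjDiagonal [Fintype Y] {F : Matrix Y X ℂ} (hF : Fᴴ * F = 1) (d : X → ℝ) :
    (conjDiagonal F d).trace = ((∑ i, d i : ℝ) : ℂ) := by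
  rw [conjDiagonal, trace_mul_comm, ← Matrix.mul_assoc, hF, Matrix.one_mul, trace_diagonal,
    Complex.ofReal_sum]

theorem conjDiagonal_add (F : Matrix Y X ℂ) (d e : X → ℝ) :
    conjDiagonal F (d + e) = conjDiagonal F d + conjDiagonal F e := by
  simp only [conjDiagonal, Pi.add_apply, Complex.ofReal_add, ← diagonal_add, Matrix.mul_add,
    Matrix.add_mul]

theorem conjDiagonal_sub (F : Matrix Y X ℂ) (d e : X → ℝ) :
    conjDiagonal F (d - e) = conjDiagonal F d - conjDiagonal F e := by
  simp only [conjDiagonal, Pi.sub_apply, Complex.ofReal_sub, ← diagonal_sub, Matrix.mul_sub,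
    Matrix.sub_mul]

theorem eigenvectorUnitary_conjTranspose_mul_mul {ρ : Matrix X X ℂ} (hρ : ρ.IsHermitian) :
    (hρ.eigenvectorUnitary : Matrix X X ℂ)ᴴ * ρ * hρ.eigenvectorUnitary =
      diagonal fun i => (hρ.eigenvalues i : ℂ) := by
  simpa only [Unitary.conjStarAlgAut_star_apply] using! hρ.conjStarAlgAut_star_eigenvectorUnitary

theorem conjDiagonal_one (F : Matrix Y X ℂ) : conjDiagonal F 1 = F * Fᴴ := by
  simp [conjDiagonal]

end Spectral

section TraceNorm

variable {X Y Z : Type*} [Fintype X] [Fintype Y]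

theorem exists_partialIsometry_polar [DecidableEq Y] (M : Matrix X Y ℂ) :
    ∃ W : Matrix X Y ℂ, W * Wᴴ * W = W ∧ (Wᴴ * M).PosSemidef ∧ Wᴴ * M * (Wᴴ * M) = Mᴴ * M ∧
      (Wᴴ * M).trace =
        ((∑ i, √((isHermitian_conjTranspose_mul_self M).eigenvalues i) : ℝ) : ℂ) := by
  set hρ := isHermitian_conjTranspose_mul_self M
  set F : Matrix Y Y ℂ := (hρ.eigenvectorUnitary : Matrix Y Y ℂ)
  have hF : Fᴴ * F = 1 := eigenvectorUnitary_conjTranspose_mul_self hρ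
  have hρF : Mᴴ * M = conjDiagonal F hρ.eigenvalues := eq_conjDiagonal_eigenvalues hρ
  have hl (i : Y) : 0 ≤ hρ.eigenvalues i :=
    (posSemidef_conjTranspose_mul_self M).eigenvalues_nonneg i
  set s : Y → ℝ := fun i => √(hρ.eigenvalues i)
  have hls : hρ.eigenvalues = s * s := by
    ext i
    exact (Real.mul_self_sqrt (hl i)).symm
  set G := conjDiagonal F s⁻¹
  have hinv : s⁻¹ * s * s = s := funext fun i => inv_mul_mul_self (s i)
  have hinv' : s⁻¹ * s * s⁻¹ = s⁻¹ := funext fun i => by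
    simpa using mul_inv_mul_cancel (s i)⁻¹
  have hWM : (M * G)ᴴ * M = conjDiagonal F s := by
    rw [conjTranspose_mul, conjDiagonal_conjTranspose, Matrix.mul_assoc, hρF,
      conjDiagonal_mul hF, hls, ← mul_assoc, hinv]
  refine ⟨M * G, ?_, ?_, ?_, ?_⟩
  · rw [Matrix.mul_assoc, ← Matrix.mul_assoc _ M G, hWM, Matrix.mul_assoc,
      conjDiagonal_mul hF, conjDiagonal_mul hF, ← mul_assoc, hinv']
  · rw [hWM]
    exact conjDiagonal_posSemidef F fun i => Real.sqrt_nonneg _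
  · rw [hWM, conjDiagonal_mul hF, ← hls, ← hρF]
  · rw [hWM, trace_conjDiagonal hF]

open scoped MatrixOrder in
theorem exists_eq_conjTranspose_mul_self {P : Matrix X X ℂ} (hP : P.PosSemidef) :
    ∃ G : Matrix X X ℂ, P = Gᴴ * G := by
  classical
  exact CStarAlgebra.nonneg_iff_eq_star_mul_self.1 hP.nonneg

theorem re_trace_mul_nonneg {P Q : Matrix X X ℂ} (hP : P.PosSemidef) (hQ : Q.PosSemidef) :
    0 ≤ (P * Q).trace.re := by
  obtain ⟨G, rfl⟩ := exists_eq_conjTranspose_mul_self hQ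
  rw [← Matrix.mul_assoc, trace_mul_comm, ← Matrix.mul_assoc]
  exact (Complex.le_def.1 (hP.mul_mul_conjTranspose_same G).trace_nonneg).1

/-- The ket `M ⊗ |none⟩`, where `M` is a bipartite ket written as a matrix. -/
def padNone (P : Type*) (M : Matrix X Z ℂ) : Matrix X (Z × Option P) ℂ :=
  Matrix.of fun x q => if q.2 = none then M x q.1 else 0

omit [Fintype X] in
theorem padNone_sub (P : Type*) (M M' : Matrix X Z ℂ) :
    padNone P (M - M') = padNone P M - padNone P M' := by
  ext x z
  simp only [padNone, of_apply, Matrix.sub_apply, ite_sub_ite, sub_self]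

theorem frobenius_norm_padNone [Fintype Z] {P : Type*} [Fintype P] (M : Matrix X Z ℂ) :
    ‖padNone P M‖ = ‖M‖ := by
  rw [← pow_left_inj₀ (norm_nonneg _) (norm_nonneg _) two_ne_zero, frobenius_norm_sq,
    frobenius_norm_sq]
  simp [padNone, Fintype.sum_prod_type, Fintype.sum_option]

theorem exists_isometry_dilation [Fintype Z] [DecidableEq Y] [Nonempty Z] {C : Matrix Y Z ℂ}
    (hC : IsContraction Cᴴ) :
    ∃ T : Matrix Y (Z × Option Y) ℂ, T * Tᴴ = 1 ∧
      ∀ {X : Type*} (M : Matrix X Z ℂ), T * (padNone Y M)ᴴ = C * Mᴴ := by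
  classical
  obtain ⟨G, hG⟩ := exists_eq_conjTranspose_mul_self hC
  obtain ⟨z₀⟩ := ‹Nonempty Z›
  refine ⟨Matrix.of fun y q => Option.elim q.2 (C y q.1) fun y' =>
    if q.1 = z₀ then star (G y' y) else 0, ?_, fun M => ?_⟩
  · rw [conjTranspose_conjTranspose] at hG
    rw [← sub_add_cancel 1 (C * Cᴴ), hG, add_comm]
    ext y y'
    simp only [mul_apply, Matrix.add_apply, conjTranspose_apply, of_apply,
      Fintype.sum_prod_type, Fintype.sum_option, Option.elim, Finset.sum_add_distrib]
    congr 1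
    rw [Finset.sum_comm]
    refine Finset.sum_congr rfl fun k _ => ?_
    rw [Finset.sum_eq_single z₀] <;> simp +contextual
  · ext y x
    simp [mul_apply, padNone, Fintype.sum_prod_type, Fintype.sum_option]

variable [DecidableEq X]

theorem traceNorm_nonneg (M : Matrix X X ℂ) : 0 ≤ traceNorm M :=
  Finset.sum_nonneg fun _ _ => Real.sqrt_nonneg _

theorem exists_isContraction_trace_mul_eq_traceNorm (M : Matrix X X ℂ) :
    ∃ U : Matrix X X ℂ, IsContraction U ∧ (U * M).trace = (traceNorm M : ℂ) := by
  obtain ⟨W, hW, -, -, htrace⟩ := exists_partialIsometry_polar M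
  refine ⟨Wᴴ, isContraction_of_partialIsometry (conjTranspose_partialIsometry hW), htrace⟩

/-- In an eigenbasis of `Mᴴ * M` the columns of `M` have norms the singular values, and a
contraction does not increase them. -/
theorem IsContraction.norm_trace_mul_le_traceNorm {U : Matrix X X ℂ} (hU : IsContraction U)
    (M : Matrix X X ℂ) : ‖(U * M).trace‖ ≤ traceNorm M := by
  set hρ := isHermitian_conjTranspose_mul_self M
  set F : Matrix X X ℂ := (hρ.eigenvectorUnitary : Matrix X X ℂ)
  have hF : Fᴴ * F = 1 := eigenvectorUnitary_conjTranspose_mul_self hρ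
  have hF' : F * Fᴴ = 1 := mul_eq_one_comm.1 hF
  have hV : IsContraction (Fᴴ * U) := (isContraction_of_isometry (by simpa using hF')).mul hU
  have hdiag : (M * F)ᴴ * (M * F) = diagonal fun i => (hρ.eigenvalues i : ℂ) := by
    calc (M * F)ᴴ * (M * F) = Fᴴ * (Mᴴ * M) * F := by
          simp only [conjTranspose_mul, Matrix.mul_assoc]
      _ = _ := eigenvectorUnitary_conjTranspose_mul_mul hρ
  have hcol (i : X) : ‖(M * F).submatrix id fun _ : Unit => i‖ ^ 2 = hρ.eigenvalues i := by
    have hii := congrArg Complex.re (congrFun (congrFun hdiag i) i)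
    rw [diagonal_apply_eq, Complex.ofReal_re] at hii
    rw [← hii, ← frobenius_norm_conjTranspose, frobenius_norm_sq_eq_re_trace]
    simp [trace, mul_apply]
  have hentry (i : X) : ‖(Fᴴ * U * (M * F)) i i‖ ≤ √(hρ.eigenvalues i) := by
    rw [← hcol, Real.sqrt_sq (norm_nonneg _)]
    refine le_trans ?_ (hV.frobenius_norm_mul_le _)
    refine abs_le_of_sq_le_sq' ?_ (norm_nonneg _) |>.2
    rw [frobenius_norm_sq]
    exact Finset.single_le_sum (f := fun x => ∑ _ : Unit, ‖(Fᴴ * U * (M * F)) x i‖ ^ 2)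
      (fun _ _ => by positivity) (Finset.mem_univ i) |>.trans' (by simp)
  calc ‖(U * M).trace‖ = ‖(Fᴴ * U * (M * F)).trace‖ := by
        rw [← Matrix.mul_assoc, trace_mul_comm (Fᴴ * U * M), ← Matrix.mul_assoc,
          ← Matrix.mul_assoc, hF', Matrix.one_mul]
    _ ≤ ∑ i, ‖(Fᴴ * U * (M * F)) i i‖ := norm_sum_le _ _
    _ ≤ traceNorm M := Finset.sum_le_sum fun i _ => hentry i

theorem traceNorm_le_of_norm_trace_mul_le {M : Matrix X X ℂ} {δ : ℝ}
    (h : ∀ U : Matrix X X ℂ, IsContraction U → ‖(U * M).trace‖ ≤ δ) : traceNorm M ≤ δ := by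
  obtain ⟨U, hU, htrace⟩ := exists_isContraction_trace_mul_eq_traceNorm M
  have hδ := h U hU
  rw [htrace, Complex.norm_real] at hδ
  exact (Real.le_norm_self _).trans hδ

theorem traceNorm_add_le (M N : Matrix X X ℂ) :
    traceNorm (M + N) ≤ traceNorm M + traceNorm N :=
  traceNorm_le_of_norm_trace_mul_le fun U hU => by
    rw [Matrix.mul_add, trace_add]
    exact (norm_add_le _ _).trans
      (add_le_add (hU.norm_trace_mul_le_traceNorm M) (hU.norm_trace_mul_le_traceNorm N))

theorem traceNorm_neg (M : Matrix X X ℂ) : traceNorm (-M) = traceNorm M := by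
  simp only [traceNorm, conjTranspose_neg, Matrix.neg_mul, Matrix.mul_neg, neg_neg]

theorem traceNorm_mul_conjTranspose_le (M N : Matrix X Y ℂ) :
    traceNorm (M * Nᴴ) ≤ ‖M‖ * ‖N‖ :=
  traceNorm_le_of_norm_trace_mul_le fun U hU => by
    rw [← Matrix.mul_assoc]
    refine (norm_trace_mul_conjTranspose_le (U * M) N).trans ?_
    gcongr
    exact hU.frobenius_norm_mul_le M

theorem traceNorm_mul_conjTranspose_sub_le (M N : Matrix X Y ℂ) :
    traceNorm (M * Mᴴ - N * Nᴴ) ≤ (‖M‖ + ‖N‖) * ‖M - N‖ := by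
  have hsplit : M * Mᴴ - N * Nᴴ = (M - N) * Mᴴ + N * (M - N)ᴴ := by
    simp [Matrix.sub_mul, Matrix.mul_sub]
  rw [hsplit]
  refine (traceNorm_add_le _ _).trans ((add_le_add (traceNorm_mul_conjTranspose_le _ _)
    (traceNorm_mul_conjTranspose_le _ _)).trans_eq ?_)
  ring

theorem exists_sign_mul_posSemidef {T : Matrix X X ℂ} (hT : T.IsHermitian) :
    ∃ U : Matrix X X ℂ, IsContraction U ∧ T * U = U * T ∧
      (U * T - T).PosSemidef ∧ (U * T + T).PosSemidef := by
  set F : Matrix X X ℂ := (hT.eigenvectorUnitary : Matrix X X ℂ)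
  have hF : Fᴴ * F = 1 := eigenvectorUnitary_conjTranspose_mul_self hT
  set l := hT.eigenvalues
  have hTF : T = conjDiagonal F l := eq_conjDiagonal_eigenvalues hT
  set g : X → ℝ := fun i => if 0 ≤ l i then 1 else -1 with hg
  have hgg : g * g = 1 := by
    ext i
    simp only [hg, Pi.mul_apply, Pi.one_apply]
    split_ifs <;> norm_num
  have habs (i : X) : |l i| = g i * l i := by
    simp only [hg]
    split_ifs with h
    · rw [abs_of_nonneg h, one_mul]
    · rw [abs_of_neg (not_le.1 h), neg_one_mul]
  refine ⟨conjDiagonal F g, isContraction_of_isometry ?_, ?_, ?_, ?_⟩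
  · rw [conjDiagonal_conjTranspose, conjDiagonal_mul hF, hgg, conjDiagonal_one,
      mul_eq_one_comm.1 hF]
  · rw [hTF, conjDiagonal_mul hF, conjDiagonal_mul hF, mul_comm]
  · rw [hTF, conjDiagonal_mul hF, ← conjDiagonal_sub]
    refine conjDiagonal_posSemidef F fun i => ?_
    rw [Pi.sub_apply, Pi.mul_apply, ← habs]
    exact sub_nonneg.2 (le_abs_self _)
  · rw [hTF, conjDiagonal_mul hF, ← conjDiagonal_add]
    refine conjDiagonal_posSemidef F fun i => ?_
    rw [Pi.add_apply, Pi.mul_apply, ← habs]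
    linarith [neg_abs_le (l i)]

/-- The Powers–Størmer inequality. With `T = p - s` and `U` its sign,
`2 (p² - s²) = T (p + s) + (p + s) T` gives `tr (U (p² - s²)) = tr (|T| (p + s)) ≥ tr T²`. -/
theorem frobenius_norm_sub_sq_le_traceNorm {p s : Matrix X X ℂ} (hp : p.PosSemidef)
    (hs : s.PosSemidef) : ‖p - s‖ ^ 2 ≤ traceNorm (p * p - s * s) := by
  have hT : (p - s).IsHermitian := hp.1.sub hs.1
  obtain ⟨U, hU, hcomm, hneg, hpos⟩ := exists_sign_mul_posSemidef hT
  set T := p - s with hT_def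
  have hsq : (2 : ℂ) • (U * (p * p - s * s)) = U * T * (p + s) + U * (p + s) * T := by
    simp only [hT_def, two_smul]
    noncomm_ring
  have htrace : (U * (p * p - s * s)).trace = (U * T * (p + s)).trace := by
    have htrace := congrArg trace hsq
    rw [trace_smul, trace_add, trace_mul_cycle U (p + s) T, hcomm, smul_eq_mul] at htrace
    linear_combination htrace / 2
  have hsplit : U * T * (p + s) - T * T = (U * T - T) * p + (U * T + T) * s := by
    simp only [hT_def]
    noncomm_ring
  have hlower : (T * T).trace.re ≤ (U * T * (p + s)).trace.re := by
    rw [← sub_nonneg, ← Complex.sub_re, ← trace_sub, hsplit, trace_add, Complex.add_re]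
    exact add_nonneg (re_trace_mul_nonneg hneg hp) (re_trace_mul_nonneg hpos hs)
  calc ‖T‖ ^ 2 = (T * T).trace.re := by rw [frobenius_norm_sq_eq_re_trace, hT.eq]
    _ ≤ (U * (p * p - s * s)).trace.re := htrace ▸ hlower
    _ ≤ ‖(U * (p * p - s * s)).trace‖ := Complex.re_le_norm _
    _ ≤ traceNorm (p * p - s * s) := hU.norm_trace_mul_le_traceNorm _

/-- Uhlmann's theorem: purifications of nearby states are related by an isometry, up to a small
error. The kets are written as matrices, and the isometry acts from the right. -/
theorem exists_isometry_frobenius_norm_sub_padNone_sq_le [DecidableEq Y] [Fintype Z]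
    [Nonempty Z]
    (M : Matrix X Y ℂ) (M' : Matrix X Z ℂ) :
    ∃ T : Matrix Y (Z × Option Y) ℂ, T * Tᴴ = 1 ∧
      ‖M * T - padNone Y M'‖ ^ 2 ≤ traceNorm (M * Mᴴ - M' * M'ᴴ) := by
  classical
  obtain ⟨W, hW, hp, hpp, -⟩ := exists_partialIsometry_polar Mᴴ
  obtain ⟨W', hW', hs, hss, -⟩ := exists_partialIsometry_polar M'ᴴ
  rw [conjTranspose_conjTranspose] at hpp hss
  have hWc : IsContraction Wᴴ := isContraction_of_partialIsometry (conjTranspose_partialIsometry hW)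
  obtain ⟨T, hT, hTpad⟩ := exists_isometry_dilation (C := W * W'ᴴ) (by
    rw [conjTranspose_mul, conjTranspose_conjTranspose]
    exact (isContraction_of_partialIsometry hW').mul hWc)
  refine ⟨T, hT, ?_⟩
  have hMT : ‖M * T‖ ^ 2 = ‖Wᴴ * Mᴴ‖ ^ 2 := by
    rw [frobenius_norm_sq_eq_re_trace, frobenius_norm_sq_eq_re_trace, hp.1.eq, hpp,
      conjTranspose_mul, Matrix.mul_assoc, ← Matrix.mul_assoc T, hT, Matrix.one_mul]
  have hM' : ‖padNone Y M'‖ ^ 2 = ‖W'ᴴ * M'ᴴ‖ ^ 2 := by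
    rw [frobenius_norm_padNone, frobenius_norm_sq_eq_re_trace, frobenius_norm_sq_eq_re_trace,
      hs.1.eq, hss]
  have hcross : M * T * (padNone Y M')ᴴ = (Wᴴ * Mᴴ) * (W'ᴴ * M'ᴴ)ᴴ := by
    rw [Matrix.mul_assoc, hTpad, hs.1.eq, ← hp.1.eq, conjTranspose_mul,
      conjTranspose_conjTranspose, conjTranspose_conjTranspose]
    simp only [Matrix.mul_assoc]
  calc ‖M * T - padNone Y M'‖ ^ 2 = ‖Wᴴ * Mᴴ - W'ᴴ * M'ᴴ‖ ^ 2 := by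
        rw [frobenius_norm_sub_sq, hMT, hM', hcross, ← frobenius_norm_sub_sq]
    _ ≤ traceNorm (M * Mᴴ - M' * M'ᴴ) := by
        rw [← hpp, ← hss]
        exact frobenius_norm_sub_sq_le_traceNorm hp hs

end TraceNorm

section RandomPhases

theorem expect_mul_le_of_expect_sq_le {Ω : Type*} [Fintype Ω] {f g : Ω → ℝ} {a b : ℝ}
    (ha : 0 ≤ a) (hb : 0 ≤ b) (hf : 𝔼 v, f v ^ 2 ≤ a ^ 2) (hg : 𝔼 v, g v ^ 2 ≤ b ^ 2) :
    𝔼 v, f v * g v ≤ a * b := by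
  refine le_of_sq_le_sq ?_ (mul_nonneg ha hb)
  calc (𝔼 v, f v * g v) ^ 2 ≤ (𝔼 v, f v ^ 2) * 𝔼 v, g v ^ 2 :=
        Finset.expect_mul_sq_le_sq_mul_sq _ _ _
    _ ≤ a ^ 2 * b ^ 2 := mul_le_mul hf hg (Finset.expect_nonneg fun v _ => sq_nonneg _)
        (sq_nonneg a)
    _ = (a * b) ^ 2 := (mul_pow a b 2).symm

theorem expect_norm_sq_sum_addChar {G ι : Type*} [AddCommGroup G] [Fintype G] {s : Finset ι}
    {χ : ι → AddChar G ℂ} (hχ : Set.InjOn χ s) (c : ι → ℂ) :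
    𝔼 v, ‖∑ i ∈ s, c i * χ i v‖ ^ 2 = ∑ i ∈ s, ‖c i‖ ^ 2 := by
  classical
  have horth : ∀ i ∈ s, ∀ j ∈ s,
      𝔼 v, χ i v * (starRingEnd ℂ) (χ j v) = if i = j then (1 : ℂ) else 0 := by
    intro i hi j hj
    have hinner := AddChar.wInner_cWeight_eq_boole (χ j) (χ i)
    simp only [RCLike.wInner_cWeight_eq_expect, RCLike.inner_apply] at hinner
    simp only [hinner, eq_comm (a := χ j), hχ.eq_iff hi hj]
  apply Complex.ofReal_injective
  calc ((𝔼 v, ‖∑ i ∈ s, c i * χ i v‖ ^ 2 : ℝ) : ℂ)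
      = 𝔼 v, ∑ i ∈ s, ∑ j ∈ s, c i * (starRingEnd ℂ) (c j) *
          (χ i v * (starRingEnd ℂ) (χ j v)) := by
        rw [Complex.ofReal_expect]
        refine Finset.expect_congr rfl fun v _ => ?_
        rw [Complex.ofReal_pow, ← Complex.mul_conj', map_sum, Finset.sum_mul_sum]
        simp only [map_mul, mul_mul_mul_comm]
    _ = ∑ i ∈ s, ∑ j ∈ s, c i * (starRingEnd ℂ) (c j) * if i = j then (1 : ℂ) else 0 := by
        simp only [Finset.expect_sum_comm, ← Finset.mul_expect]
        exact Finset.sum_congr rfl fun i hi => Finset.sum_congr rfl fun j hj => by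
          rw [horth i hi j hj]
    _ = ((∑ i ∈ s, ‖c i‖ ^ 2 : ℝ) : ℂ) := by
        simp only [mul_ite, mul_one, mul_zero, Finset.sum_ite_eq, Finset.sum_ite_mem,
          Finset.inter_self, Complex.mul_conj', Complex.ofReal_sum, Complex.ofReal_pow]

variable {I : Type*}

/-- The character of `(ℤ/3)^I` sending `v` to the cube root of unity with exponent `v x`. Three
is the least modulus for which the characters `pairChar x y` with `x ≠ y` are distinct. -/
def coordChar (x : I) : AddChar (I → ZMod 3) ℂ :=
  ZMod.stdAddChar.compAddMonoidHom (Pi.evalAddMonoidHom _ x)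

/-- The ratio of two coordinate characters. -/
def pairChar (x y : I) : AddChar (I → ZMod 3) ℂ := coordChar x * (coordChar y)⁻¹

theorem pairChar_apply [Finite I] (x y : I) (v : I → ZMod 3) :
    pairChar x y v = coordChar x v * star (coordChar y v) := by
  rw [pairChar, AddChar.mul_apply, AddChar.inv_apply', AddChar.inv_apply_eq_conj,
    starRingEnd_apply]

theorem pairChar_self (x : I) (v : I → ZMod 3) : pairChar x x v = 1 := by
  rw [pairChar, mul_inv_cancel, AddChar.one_apply]

theorem pairChar_eq_stdAddChar [Finite I] (x y : I) (v : I → ZMod 3) :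
    pairChar x y v = ZMod.stdAddChar (v x - v y) := by
  rw [AddChar.map_sub_eq_div, div_eq_mul_inv, AddChar.inv_apply_eq_conj, starRingEnd_apply,
    pairChar_apply]
  rfl

theorem coordChar_injective : Function.Injective (coordChar : I → AddChar (I → ZMod 3) ℂ) := by
  classical
  intro x y hxy
  have hval := ZMod.injective_stdAddChar (DFunLike.congr_fun hxy (Pi.single x 1))
  simp only [Pi.evalAddMonoidHom_apply, Pi.single_eq_same] at hval
  by_contra hne
  rw [Pi.single_eq_of_ne (Ne.symm hne)] at hval
  exact one_ne_zero hval

theorem eq_and_eq_of_pairChar_eq [Finite I] {x y z w : I} (hxy : x ≠ y)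
    (h : pairChar x y = pairChar z w) : x = z ∧ y = w := by
  classical
  have hval : ∀ v : I → ZMod 3, v x - v y = v z - v w := fun v =>
    ZMod.injective_stdAddChar
      (by simpa only [pairChar_eq_stdAddChar] using DFunLike.congr_fun h v)
  have hx := hval (Pi.single x 1)
  have hy := hval (Pi.single y 1)
  simp only [Pi.single_apply, hxy, hxy.symm, if_true, if_false] at hx hy
  constructor
  · by_contra hne
    rw [if_neg (Ne.symm hne)] at hx
    split_ifs at hx <;> revert hx <;> decide
  · by_contra hne
    rw [if_neg (Ne.symm hne)] at hy
    split_ifs at hy <;> revert hy <;> decide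

end RandomPhases

section Decoupling

variable {K M J A X Z : Type*} [Fintype K] [Fintype A]

/-- The matrix with entries of modulus `|K|^{-1/2}` and phases given by `v`. Averaged over `v`,
it plays the role of a random encoding isometry. -/
def phaseMatrix (v : K × A → ZMod 3) : Matrix K A ℂ :=
  Matrix.of fun k a => (((√(Fintype.card K))⁻¹ : ℝ) : ℂ) * coordChar (k, a) v

/-- The ket obtained from the ket `φ` on `A X Z` by applying `V : A → K ≃ M J` to `A`, written as
a matrix on `(M X) ⊗ (J Z)`. -/
def codedKet (e : K ≃ M × J) (V : Matrix K A ℂ) (φ : Matrix (A × X) Z ℂ) :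
    Matrix (M × X) (J × Z) ℂ :=
  Matrix.of fun p q => ∑ a, V (e.symm (p.1, q.1)) a * φ (a, p.2) q.2

omit [Fintype K] in
theorem codedKet_sub (e : K ≃ M × J) (V : Matrix K A ℂ) (φ φ' : Matrix (A × X) Z ℂ) :
    codedKet e V (φ - φ') = codedKet e V φ - codedKet e V φ' := by
  ext p q
  simp only [codedKet, of_apply, Matrix.sub_apply, mul_sub, Finset.sum_sub_distrib]

omit [Fintype K] in
theorem kronecker_mul_codedKet [Fintype M] [DecidableEq M] [Fintype X] [DecidableEq A]
    (e : K ≃ M × J) (V : Matrix K A ℂ) {P : Matrix X X ℂ} {φ : Matrix (A × X) Z ℂ}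
    (hP : (1 : Matrix A A ℂ) ⊗ₖ P * φ = φ) :
    (1 : Matrix M M ℂ) ⊗ₖ P * codedKet e V φ = codedKet e V φ := by
  have hentry : ∀ a x z, ∑ x', P x x' * φ (a, x') z = φ (a, x) z := fun a x z => by
    simpa only [mul_apply, Fintype.sum_prod_type, kronecker_apply, one_apply, ite_mul, one_mul,
      zero_mul, Finset.sum_ite_irrel, Finset.sum_const_zero, Finset.sum_ite_eq, Finset.mem_univ,
      if_true] using congrFun (congrFun hP (a, x)) z
  ext ⟨m, x⟩ ⟨j, z⟩
  simp only [mul_apply, Fintype.sum_prod_type, kronecker_apply, one_apply, ite_mul, one_mul,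
    zero_mul, Finset.sum_ite_irrel, Finset.sum_const_zero, Finset.sum_ite_eq, Finset.mem_univ,
    if_true, codedKet, of_apply, Finset.mul_sum]
  rw [Finset.sum_comm]
  refine Finset.sum_congr rfl fun a _ => ?_
  rw [← hentry a x z, Finset.mul_sum]
  exact Finset.sum_congr rfl fun x' _ => by ring

/-- The tripartite ket `φ` on `A X Z` regrouped as `X ⊗ (A Z)`. -/
def sideKet (φ : Matrix (A × X) Z ℂ) : Matrix X (A × Z) ℂ :=
  Matrix.of fun x q => φ (q.1, x) q.2

theorem sideKet_one_kronecker_mul [Fintype X] [DecidableEq A] (P : Matrix X X ℂ)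
    (φ : Matrix (A × X) Z ℂ) : sideKet ((1 : Matrix A A ℂ) ⊗ₖ P * φ) = P * sideKet φ := by
  ext x ⟨a, z⟩
  simp [mul_apply, Fintype.sum_prod_type, one_apply, ite_mul, Finset.sum_ite_irrel, sideKet]

variable [Fintype M] [Fintype X] [Fintype Z]

theorem frobenius_norm_sideKet (φ : Matrix (A × X) Z ℂ) : ‖sideKet φ‖ = ‖φ‖ := by
  rw [← pow_left_inj₀ (norm_nonneg _) (norm_nonneg _) two_ne_zero, frobenius_norm_sq,
    frobenius_norm_sq]
  simp only [sideKet, of_apply, Fintype.sum_prod_type]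
  exact Finset.sum_comm

theorem one_kronecker_frobenius_norm_sq [DecidableEq M] {Y : Type*} [Fintype Y]
    (N : Matrix X Y ℂ) : ‖(1 : Matrix M M ℂ) ⊗ₖ N‖ ^ 2 = Fintype.card M * ‖N‖ ^ 2 := by
  rw [frobenius_norm_sq_eq_re_trace, conjTranspose_kronecker, ← mul_kronecker_mul,
    conjTranspose_one, Matrix.mul_one, trace_kronecker, trace_one, trace_mul_conjTranspose_self]
  norm_cast

theorem one_kronecker_frobenius_norm [DecidableEq M] {Y : Type*} [Fintype Y] (N : Matrix X Y ℂ) :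
    ‖(1 : Matrix M M ℂ) ⊗ₖ N‖ = √(Fintype.card M) * ‖N‖ := by
  rw [← pow_left_inj₀ (norm_nonneg _) (by positivity) two_ne_zero,
    one_kronecker_frobenius_norm_sq, mul_pow, Real.sq_sqrt (Nat.cast_nonneg _)]

/-- The ideal outcome of decoupling: the state `1/|M| ⊗ φ^X`. -/
def refState (M : Type*) [Fintype M] [DecidableEq M] (φ : Matrix (A × X) Z ℂ) :
    Matrix (M × X) (M × X) ℂ :=
  ((Fintype.card M : ℂ)⁻¹ • (1 : Matrix M M ℂ)) ⊗ₖ (sideKet φ * (sideKet φ)ᴴ)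

/-- The purification of `refState M φ` given by a maximally entangled ket on `M M` and `φ`. -/
def refKet (M : Type*) [Fintype M] [DecidableEq M] (φ : Matrix (A × X) Z ℂ) :
    Matrix (M × X) (M × (A × Z)) ℂ :=
  ((((√(Fintype.card M))⁻¹ : ℝ) : ℂ) • (1 : Matrix M M ℂ)) ⊗ₖ sideKet φ

theorem inv_sqrt_mul_inv_sqrt (n : ℕ) :
    (((√n)⁻¹ : ℝ) : ℂ) * (((√n)⁻¹ : ℝ) : ℂ) = (n : ℂ)⁻¹ := by
  norm_cast
  rw [← mul_inv, Real.mul_self_sqrt (Nat.cast_nonneg n)]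
  push_cast
  rfl

omit [Fintype X] in
theorem smul_one_kronecker_mul_conjTranspose [DecidableEq M] (P : Matrix X Z ℂ) :
    (((((√(Fintype.card M))⁻¹ : ℝ) : ℂ) • (1 : Matrix M M ℂ)) ⊗ₖ P) *
        (((((√(Fintype.card M))⁻¹ : ℝ) : ℂ) • (1 : Matrix M M ℂ)) ⊗ₖ P)ᴴ =
      ((Fintype.card M : ℂ)⁻¹ • (1 : Matrix M M ℂ)) ⊗ₖ (P * Pᴴ) := by
  rw [conjTranspose_kronecker, ← mul_kronecker_mul, conjTranspose_smul, conjTranspose_one,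
    Matrix.smul_mul, Matrix.one_mul, smul_smul, Complex.star_def, Complex.conj_ofReal,
    inv_sqrt_mul_inv_sqrt]

omit [Fintype X] in
theorem refKet_mul_conjTranspose [DecidableEq M] (φ : Matrix (A × X) Z ℂ) :
    refKet M φ * (refKet M φ)ᴴ = refState M φ :=
  smul_one_kronecker_mul_conjTranspose _

omit [Fintype A] [Fintype X] [Fintype Z] in
theorem refKet_sub [DecidableEq M] (φ φ' : Matrix (A × X) Z ℂ) :
    refKet M (φ - φ') = refKet M φ - refKet M φ' := by
  ext ⟨m, x⟩ ⟨n, a, z⟩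
  simp only [refKet, sideKet, kroneckerMap_apply, of_apply, Matrix.sub_apply, mul_sub]

omit [Fintype A] in
theorem frobenius_norm_smul_one_kronecker [DecidableEq M] [Nonempty M] (P : Matrix X Z ℂ) :
    ‖((((√(Fintype.card M))⁻¹ : ℝ) : ℂ) • (1 : Matrix M M ℂ)) ⊗ₖ P‖ = ‖P‖ := by
  have hM : √(Fintype.card M : ℝ) ≠ 0 := by positivity
  rw [smul_kronecker, norm_smul, one_kronecker_frobenius_norm, Complex.norm_real, norm_inv,
    Real.norm_of_nonneg (Real.sqrt_nonneg _), ← mul_assoc, inv_mul_cancel₀ hM, one_mul]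

theorem frobenius_norm_refKet [DecidableEq M] [Nonempty M] (φ : Matrix (A × X) Z ℂ) :
    ‖refKet M φ‖ = ‖φ‖ := by
  rw [refKet, frobenius_norm_smul_one_kronecker, frobenius_norm_sideKet]

theorem expect_frobenius_norm_codedKet_sq [Nonempty K] [Fintype J] [DecidableEq K]
    [DecidableEq A] (e : K ≃ M × J) (φ : Matrix (A × X) Z ℂ) :
    𝔼 v : K × A → ZMod 3, ‖codedKet e (phaseMatrix v) φ‖ ^ 2 = ‖φ‖ ^ 2 := by
  have hentry : ∀ (k : K) (x : X) (z : Z), 𝔼 v : K × A → ZMod 3,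
      ‖∑ a, phaseMatrix v k a * φ (a, x) z‖ ^ 2
        = (Fintype.card K : ℝ)⁻¹ * ∑ a, ‖φ (a, x) z‖ ^ 2 := fun k x z => by
    have hparseval := expect_norm_sq_sum_addChar (s := Finset.univ)
      (χ := fun a : A => coordChar (k, a))
      (fun a _ b _ hab => (Prod.ext_iff.1 (coordChar_injective hab)).2)
      fun a => (((√(Fintype.card K))⁻¹ : ℝ) : ℂ) * φ (a, x) z
    simp only [norm_mul, mul_pow, Complex.norm_real, norm_inv, inv_pow, ← Finset.mul_sum,
      Real.norm_of_nonneg (Real.sqrt_nonneg _), Real.sq_sqrt (Nat.cast_nonneg _)] at hparseval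
    rw [← hparseval]
    simp only [phaseMatrix, of_apply, mul_right_comm]
  simp only [frobenius_norm_sq, Finset.expect_sum_comm, codedKet, of_apply, hentry,
    Fintype.sum_prod_type, Finset.sum_const, Finset.card_univ, nsmul_eq_mul, ← Finset.mul_sum]
  have hcard : (Fintype.card M : ℝ) * Fintype.card J = Fintype.card K := by
    rw [Fintype.card_congr e, Fintype.card_prod, Nat.cast_mul]
  rw [Finset.sum_comm_cycle, ← mul_assoc, ← mul_assoc, hcard]
  field_simp

omit [Fintype M] [Fintype X] in
theorem codedKet_mul_conjTranspose_apply [Fintype J] (e : K ≃ M × J) (φ : Matrix (A × X) Z ℂ)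
    (v : K × A → ZMod 3) (p q : M × X) :
    (codedKet e (phaseMatrix v) φ * (codedKet e (phaseMatrix v) φ)ᴴ) p q =
      ∑ i : J × A × A, (Fintype.card K : ℂ)⁻¹ * (φ * φᴴ) (i.2.1, p.2) (i.2.2, q.2) *
        pairChar (e.symm (p.1, i.1), i.2.1) (e.symm (q.1, i.1), i.2.2) v := by
  simp only [mul_apply, conjTranspose_apply, codedKet, of_apply, Fintype.sum_prod_type,
    star_sum, phaseMatrix, Finset.mul_sum, Finset.sum_mul]
  refine Finset.sum_congr rfl fun j _ => ?_
  rw [Finset.sum_comm_cycle]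
  refine Finset.sum_congr rfl fun a _ => ?_
  rw [Finset.sum_comm]
  refine Finset.sum_congr rfl fun b _ => Finset.sum_congr rfl fun z _ => ?_
  rw [← inv_sqrt_mul_inv_sqrt, pairChar_apply, star_mul', star_mul', Complex.star_def,
    Complex.conj_ofReal]
  ring

omit [Fintype X] in
theorem refState_apply [Nonempty K] [Fintype J] [DecidableEq A] [DecidableEq M] (e : K ≃ M × J)
    (φ : Matrix (A × X) Z ℂ) (v : K × A → ZMod 3) (p q : M × X) :
    refState M φ p q = ∑ i : J × A × A with p.1 = q.1 ∧ i.2.1 = i.2.2,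
      (Fintype.card K : ℂ)⁻¹ * (φ * φᴴ) (i.2.1, p.2) (i.2.2, q.2) *
        pairChar (e.symm (p.1, i.1), i.2.1) (e.symm (q.1, i.1), i.2.2) v := by
  have hcard : (Fintype.card K : ℂ) = Fintype.card M * Fintype.card J := by
    rw [Fintype.card_congr e, Fintype.card_prod, Nat.cast_mul]
  have hK : (Fintype.card K : ℂ) ≠ 0 := Nat.cast_ne_zero.2 Fintype.card_ne_zero
  have hM : (Fintype.card M : ℂ) ≠ 0 := left_ne_zero_of_mul (hcard ▸ hK)
  have hJ : (Fintype.card J : ℂ) ≠ 0 := right_ne_zero_of_mul (hcard ▸ hK)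
  rw [refState, kronecker_apply, Matrix.smul_apply, one_apply, smul_eq_mul]
  by_cases hpq : p.1 = q.1
  · simp only [hpq, if_true, true_and, Finset.sum_filter, Fintype.sum_prod_type,
      Finset.sum_ite_eq, Finset.mem_univ, pairChar_self, mul_one, Finset.sum_const,
      Finset.card_univ, nsmul_eq_mul, ← Finset.mul_sum, hcard]
    have hside : (sideKet φ * (sideKet φ)ᴴ) p.2 q.2 = ∑ a, (φ * φᴴ) (a, p.2) (a, q.2) := by
      simp only [mul_apply, sideKet, conjTranspose_apply, of_apply, Fintype.sum_prod_type]
    rw [hside]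
    field_simp
  · simp [hpq]

omit [Fintype X] in
theorem codedKet_mul_conjTranspose_sub_refState_apply [Nonempty K] [Fintype J] [DecidableEq A]
    [DecidableEq M] (e : K ≃ M × J) (φ : Matrix (A × X) Z ℂ) (v : K × A → ZMod 3)
    (p q : M × X) :
    (codedKet e (phaseMatrix v) φ * (codedKet e (phaseMatrix v) φ)ᴴ - refState M φ) p q =
      ∑ i : J × A × A with ¬(p.1 = q.1 ∧ i.2.1 = i.2.2),
        (Fintype.card K : ℂ)⁻¹ * (φ * φᴴ) (i.2.1, p.2) (i.2.2, q.2) *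
          pairChar (e.symm (p.1, i.1), i.2.1) (e.symm (q.1, i.1), i.2.2) v := by
  rw [Matrix.sub_apply, codedKet_mul_conjTranspose_apply, refState_apply e φ v,
    sub_eq_iff_eq_add', Finset.sum_filter_add_sum_filter_not]

/-- Distinct off-diagonal phase pairs are orthogonal, so only the diagonal ones survive in the
mean, and these make up `refState`. -/
theorem expect_frobenius_norm_codedKet_sub_refState_sq_le [Nonempty K] [Fintype J]
    [DecidableEq K] [DecidableEq A] [DecidableEq M] (e : K ≃ M × J) (φ : Matrix (A × X) Z ℂ) :
    𝔼 v : K × A → ZMod 3, ‖codedKet e (phaseMatrix v) φ * (codedKet e (phaseMatrix v) φ)ᴴ -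
      refState M φ‖ ^ 2 ≤ ‖φ * φᴴ‖ ^ 2 / Fintype.card J := by
  set G := φ * φᴴ with hG
  have hentry : ∀ p q : M × X, 𝔼 v : K × A → ZMod 3, ‖(codedKet e (phaseMatrix v) φ *
      (codedKet e (phaseMatrix v) φ)ᴴ - refState M φ) p q‖ ^ 2
        ≤ ((Fintype.card K : ℝ)⁻¹) ^ 2 * Fintype.card J *
          ∑ a, ∑ b, ‖G (a, p.2) (b, q.2)‖ ^ 2 := fun p q => by
    simp only [codedKet_mul_conjTranspose_sub_refState_apply]
    rw [expect_norm_sq_sum_addChar]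
    · refine (Finset.sum_le_univ_sum_of_nonneg fun i => by positivity).trans_eq ?_
      simp only [norm_mul, mul_pow, norm_inv, Complex.norm_natCast, ← Finset.mul_sum,
        Fintype.sum_prod_type, Finset.sum_const, Finset.card_univ, nsmul_eq_mul, mul_assoc, hG]
    · rintro ⟨j, a, b⟩ hi ⟨j', a', b'⟩ - hχ
      simp only [Finset.coe_filter, Finset.mem_univ, true_and, Set.mem_ofPred_eq] at hi
      obtain ⟨hleft, hright⟩ := eq_and_eq_of_pairChar_eq (fun h => hi (by simpa using h)) hχ
      simp_all
  simp only [frobenius_norm_sq (_ - _), Finset.expect_sum_comm]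
  refine (Finset.sum_le_sum fun p _ => Finset.sum_le_sum fun q _ => hentry p q).trans_eq ?_
  have hcard : (Fintype.card K : ℝ) = Fintype.card M * Fintype.card J := by
    rw [Fintype.card_congr e, Fintype.card_prod, Nat.cast_mul]
  have hK : (Fintype.card K : ℝ) ≠ 0 := Nat.cast_ne_zero.2 Fintype.card_ne_zero
  have hM : (Fintype.card M : ℝ) ≠ 0 := left_ne_zero_of_mul (hcard ▸ hK)
  have hJ : (Fintype.card J : ℝ) ≠ 0 := right_ne_zero_of_mul (hcard ▸ hK)
  have hreorder : ∑ x, ∑ y, ∑ a, ∑ b, ‖G (a, x) (b, y)‖ ^ 2 = ‖G‖ ^ 2 := by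
    simp only [frobenius_norm_sq, Fintype.sum_prod_type]
    rw [Finset.sum_comm_cycle]
    exact Finset.sum_congr rfl fun a _ => Finset.sum_congr rfl fun x _ => Finset.sum_comm
  simp only [Fintype.sum_prod_type, Finset.sum_const, Finset.card_univ, nsmul_eq_mul,
    ← Finset.mul_sum, hreorder, hcard]
  field_simp

theorem expect_traceNorm_codedKet_sub_le [Nonempty K] [Fintype J] [DecidableEq K] [DecidableEq A]
    [DecidableEq M] [DecidableEq X] (e : K ≃ M × J) (φ φ' : Matrix (A × X) Z ℂ) :
    𝔼 v : K × A → ZMod 3, traceNorm (codedKet e (phaseMatrix v) φ *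
      (codedKet e (phaseMatrix v) φ)ᴴ - codedKet e (phaseMatrix v) φ' *
      (codedKet e (phaseMatrix v) φ')ᴴ) ≤ (‖φ‖ + ‖φ'‖) * ‖φ - φ'‖ := by
  have hnorm : ∀ χ : Matrix (A × X) Z ℂ,
      𝔼 v : K × A → ZMod 3, ‖codedKet e (phaseMatrix v) χ‖ ^ 2 ≤ ‖χ‖ ^ 2 := fun χ =>
    (expect_frobenius_norm_codedKet_sq e χ).le
  refine (Finset.expect_le_expect fun v _ => traceNorm_mul_conjTranspose_sub_le _ _).trans ?_
  simp only [add_mul, Finset.expect_add_distrib, ← codedKet_sub]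
  exact add_le_add
    (expect_mul_le_of_expect_sq_le (norm_nonneg _) (norm_nonneg _) (hnorm φ) (hnorm _))
    (expect_mul_le_of_expect_sq_le (norm_nonneg _) (norm_nonneg _) (hnorm φ') (hnorm _))

theorem expect_traceNorm_codedKet_sub_refState_le_of_mul_eq [Nonempty K] [Fintype J]
    [DecidableEq K] [DecidableEq A] [DecidableEq M] [DecidableEq X] (e : K ≃ M × J)
    {P : Matrix X X ℂ} {φ : Matrix (A × X) Z ℂ} (hP : (1 : Matrix A A ℂ) ⊗ₖ P * φ = φ) :
    𝔼 v : K × A → ZMod 3, traceNorm (codedKet e (phaseMatrix v) φ *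
      (codedKet e (phaseMatrix v) φ)ᴴ - refState M φ) ≤
      √(Fintype.card M) * ‖P‖ * (‖φ * φᴴ‖ / √(Fintype.card J)) := by
  set Q : Matrix (M × X) (M × X) ℂ := 1 ⊗ₖ P with hQ
  have hQref : Q * refState M φ = refState M φ := by
    rw [hQ, refState, ← mul_kronecker_mul, Matrix.one_mul, ← Matrix.mul_assoc,
      ← sideKet_one_kronecker_mul, hP]
  have htrace : ∀ v : K × A → ZMod 3, traceNorm (codedKet e (phaseMatrix v) φ *
      (codedKet e (phaseMatrix v) φ)ᴴ - refState M φ) ≤ ‖Q‖ * ‖codedKet e (phaseMatrix v) φ *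
      (codedKet e (phaseMatrix v) φ)ᴴ - refState M φ‖ := fun v => by
    set Y := codedKet e (phaseMatrix v) φ * (codedKet e (phaseMatrix v) φ)ᴴ - refState M φ
      with hY
    have hQY : Q * Yᴴᴴ = Y := by
      rw [conjTranspose_conjTranspose, hY, Matrix.mul_sub, ← Matrix.mul_assoc,
        kronecker_mul_codedKet e _ hP, hQref]
    simpa only [hQY, frobenius_norm_conjTranspose] using traceNorm_mul_conjTranspose_le Q Yᴴ
  refine (Finset.expect_le_expect fun v _ => htrace v).trans ?_
  rw [← one_kronecker_frobenius_norm]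
  refine expect_mul_le_of_expect_sq_le (norm_nonneg _) (by positivity)
    (Fintype.expect_const _).le ?_
  rw [div_pow, Real.sq_sqrt (Nat.cast_nonneg _)]
  exact expect_frobenius_norm_codedKet_sub_refState_sq_le e φ

/-- Decoupling of `X` by a random matrix. The ket `φ'` smooths `φ`: it is supported on the range
of `P`, which trades the dimension of `X` for `‖P‖ ^ 2`. -/
theorem expect_traceNorm_codedKet_sub_refState_le [Nonempty K] [Nonempty M] [Fintype J]
    [DecidableEq K] [DecidableEq A] [DecidableEq M] [DecidableEq X] (e : K ≃ M × J)
    {P : Matrix X X ℂ} (φ : Matrix (A × X) Z ℂ) {φ' : Matrix (A × X) Z ℂ}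
    (hP : (1 : Matrix A A ℂ) ⊗ₖ P * φ' = φ') :
    𝔼 v : K × A → ZMod 3, traceNorm (codedKet e (phaseMatrix v) φ *
      (codedKet e (phaseMatrix v) φ)ᴴ - refState M φ) ≤
      √(Fintype.card M) * ‖P‖ * (‖φ' * φ'ᴴ‖ / √(Fintype.card J)) +
        2 * ((‖φ‖ + ‖φ'‖) * ‖φ - φ'‖) := by
  have href : traceNorm (refState M φ' - refState M φ) ≤ (‖φ‖ + ‖φ'‖) * ‖φ - φ'‖ := by
    rw [← traceNorm_neg, neg_sub, ← refKet_mul_conjTranspose, ← refKet_mul_conjTranspose]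
    refine (traceNorm_mul_conjTranspose_sub_le _ _).trans_eq ?_
    simp only [← refKet_sub, frobenius_norm_refKet]
  have hsplit : ∀ v : K × A → ZMod 3, traceNorm (codedKet e (phaseMatrix v) φ *
      (codedKet e (phaseMatrix v) φ)ᴴ - refState M φ) ≤
      traceNorm (codedKet e (phaseMatrix v) φ * (codedKet e (phaseMatrix v) φ)ᴴ -
        codedKet e (phaseMatrix v) φ' * (codedKet e (phaseMatrix v) φ')ᴴ) +
      traceNorm (codedKet e (phaseMatrix v) φ' * (codedKet e (phaseMatrix v) φ')ᴴ -
        refState M φ') + (‖φ‖ + ‖φ'‖) * ‖φ - φ'‖ := fun v => by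
    rw [← sub_add_sub_cancel _ (refState M φ') (refState M φ), ← sub_add_sub_cancel _
      (codedKet e (phaseMatrix v) φ' * (codedKet e (phaseMatrix v) φ')ᴴ) (refState M φ')]
    exact (traceNorm_add_le _ _).trans (add_le_add (traceNorm_add_le _ _) href)
  refine (Finset.expect_le_expect fun v _ => hsplit v).trans ?_
  rw [Finset.expect_add_distrib, Finset.expect_add_distrib, Fintype.expect_const]
  linarith [expect_traceNorm_codedKet_sub_le e φ φ',
    expect_traceNorm_codedKet_sub_refState_le_of_mul_eq (M := M) e hP]

end Decoupling

section TypicalSet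

variable {X : Type*} [Fintype X]

/-- The Shannon entropy, in bits. -/
def shannonEntropy (p : X → ℝ) : ℝ := ∑ x, Real.negMulLog (p x) / Real.log 2

/-- The centred information content `-log₂ p(x) - H(p)`. -/
def surprisalDeviation (p : X → ℝ) (x : X) : ℝ := -Real.logb 2 (p x) - shannonEntropy p

theorem sum_mul_surprisalDeviation {p : X → ℝ} (hp : ∑ x, p x = 1) :
    ∑ x, p x * surprisalDeviation p x = 0 := by
  simp only [surprisalDeviation, mul_sub, Finset.sum_sub_distrib, ← Finset.sum_mul, hp, one_mul]
  refine sub_eq_zero.2 (Finset.sum_congr rfl fun x _ => ?_)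
  rw [Real.negMulLog, Real.logb]
  ring

theorem prod_eq_rpow_surprisalDeviation {p : X → ℝ} (hp0 : ∀ x, 0 ≤ p x) {n : ℕ} {x : Fin n → X}
    (hx : ∀ i, p (x i) ≠ 0) :
    ∏ i, p (x i) = 2 ^ (-∑ i, surprisalDeviation p (x i) - n * shannonEntropy p) := by
  have hlog (i : Fin n) : p (x i) = (2 : ℝ) ^ Real.logb 2 (p (x i)) :=
    (Real.rpow_logb two_pos (by norm_num) ((hp0 _).lt_of_ne' (hx i))).symm
  rw [Finset.prod_congr rfl fun i _ => hlog i, ← Real.rpow_sum_of_pos two_pos]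
  congr 1
  simp only [surprisalDeviation, Finset.sum_sub_distrib, Finset.sum_neg_distrib, Finset.sum_const,
    Finset.card_univ, Fintype.card_fin, nsmul_eq_mul]
  ring

theorem sum_prod_mul_mul (p g : X → ℝ) (hp : ∑ x, p x = 1) (hg : ∑ x, p x * g x = 0) {n : ℕ}
    (i j : Fin n) :
    ∑ x : Fin n → X, (∏ k, p (x k)) * (g (x i) * g (x j)) =
      if i = j then ∑ x, p x * g x ^ 2 else 0 := by
  have hprod (x : Fin n → X) : (∏ k, p (x k)) * (g (x i) * g (x j)) =
      ∏ k, p (x k) * ((if k = i then g (x k) else 1) * (if k = j then g (x k) else 1)) := by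
    simp only [Finset.prod_mul_distrib, Finset.prod_ite_eq', Finset.mem_univ, if_true]
  simp only [hprod]
  rw [← Fintype.prod_sum fun k y =>
    p y * ((if k = i then g y else 1) * (if k = j then g y else 1))]
  split_ifs with hij
  · subst hij
    rw [Finset.prod_eq_single i (fun k _ hk => by simp [hk, hp]) (by simp)]
    simp [sq]
  · exact Finset.prod_eq_zero (Finset.mem_univ i) (by simp [hij, hg])

theorem sum_prod_mul_sum_sq (p g : X → ℝ) (hp : ∑ x, p x = 1) (hg : ∑ x, p x * g x = 0) (n : ℕ) :
    ∑ x : Fin n → X, (∏ i, p (x i)) * (∑ i, g (x i)) ^ 2 = n * ∑ x, p x * g x ^ 2 := by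
  have hexpand (x : Fin n → X) : (∏ i, p (x i)) * (∑ i, g (x i)) ^ 2 =
      ∑ i, ∑ j, (∏ k, p (x k)) * (g (x i) * g (x j)) := by
    rw [sq, Finset.sum_mul_sum]
    simp only [Finset.mul_sum]
  simp only [hexpand]
  rw [Finset.sum_comm]
  simp only [Finset.sum_comm (s := (Finset.univ : Finset (Fin n → X))),
    sum_prod_mul_mul p g hp hg]
  simp

open Classical in
/-- The entropy-typical sequences: those with all letters of nonzero weight whose average
information content differs from the entropy by at most `δ`. The first condition is there because
`Real.logb 2 0 = 0`. -/
def typicalSet (p : X → ℝ) (n : ℕ) (δ : ℝ) : Finset (Fin n → X) :=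
  Finset.univ.filter fun x =>
    (∀ i, p (x i) ≠ 0) ∧ |∑ i, surprisalDeviation p (x i)| ≤ n * δ

variable {p : X → ℝ}

theorem prod_le_of_mem_typicalSet (hp0 : ∀ x, 0 ≤ p x) {n : ℕ} {δ : ℝ} {x : Fin n → X}
    (hx : x ∈ typicalSet p n δ) : ∏ i, p (x i) ≤ 2 ^ (-(n * (shannonEntropy p - δ))) := by
  obtain ⟨hx0, hdev⟩ := (Finset.mem_filter.1 hx).2
  rw [prod_eq_rpow_surprisalDeviation hp0 hx0]
  refine Real.rpow_le_rpow_of_exponent_le one_le_two ?_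
  linarith [neg_le_of_abs_le hdev]

theorem le_prod_of_mem_typicalSet (hp0 : ∀ x, 0 ≤ p x) {n : ℕ} {δ : ℝ} {x : Fin n → X}
    (hx : x ∈ typicalSet p n δ) : 2 ^ (-(n * (shannonEntropy p + δ))) ≤ ∏ i, p (x i) := by
  obtain ⟨hx0, hdev⟩ := (Finset.mem_filter.1 hx).2
  rw [prod_eq_rpow_surprisalDeviation hp0 hx0]
  refine Real.rpow_le_rpow_of_exponent_le one_le_two ?_
  linarith [le_of_abs_le hdev]

theorem sum_prod_eq_one (hp : ∑ x, p x = 1) (n : ℕ) : ∑ x : Fin n → X, ∏ i, p (x i) = 1 := by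
  rw [← Fintype.sum_pow, hp, one_pow]

theorem card_typicalSet_le (hp0 : ∀ x, 0 ≤ p x) (hp : ∑ x, p x = 1) (n : ℕ) (δ : ℝ) :
    ((typicalSet p n δ).card : ℝ) ≤ 2 ^ (n * (shannonEntropy p + δ)) := by
  have hmass : (typicalSet p n δ).card * (2 : ℝ) ^ (-(n * (shannonEntropy p + δ))) ≤ 1 :=
    calc _ = ∑ _ ∈ typicalSet p n δ, (2 : ℝ) ^ (-(n * (shannonEntropy p + δ))) := by simp
      _ ≤ ∑ x ∈ typicalSet p n δ, ∏ i, p (x i) :=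
          Finset.sum_le_sum fun _ => le_prod_of_mem_typicalSet hp0
      _ ≤ ∑ x : Fin n → X, ∏ i, p (x i) :=
          Finset.sum_le_univ_sum_of_nonneg fun _ => Finset.prod_nonneg fun i _ => hp0 _
      _ = 1 := sum_prod_eq_one hp n
  rwa [Real.rpow_neg two_pos.le, mul_inv_le_iff₀ (by positivity), one_mul] at hmass

theorem sum_prod_sq_typicalSet_le (hp0 : ∀ x, 0 ≤ p x) (hp : ∑ x, p x = 1) (n : ℕ) (δ : ℝ) :
    ∑ x ∈ typicalSet p n δ, (∏ i, p (x i)) ^ 2 ≤ 2 ^ (-(n * (shannonEntropy p - δ))) := by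
  have hprod (x : Fin n → X) : 0 ≤ ∏ i, p (x i) := Finset.prod_nonneg fun i _ => hp0 _
  set L : ℝ := 2 ^ (-(n * (shannonEntropy p - δ)))
  calc ∑ x ∈ typicalSet p n δ, (∏ i, p (x i)) ^ 2
      ≤ ∑ x ∈ typicalSet p n δ, L * ∏ i, p (x i) := Finset.sum_le_sum fun x hx => by
        rw [sq]
        exact mul_le_mul_of_nonneg_right (prod_le_of_mem_typicalSet hp0 hx) (hprod x)
    _ ≤ ∑ x : Fin n → X, L * ∏ i, p (x i) := Finset.sum_le_univ_sum_of_nonneg fun x =>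
        mul_nonneg (Real.rpow_nonneg two_pos.le _) (hprod x)
    _ = L := by rw [← Finset.mul_sum, sum_prod_eq_one hp, mul_one]

theorem sum_compl_typicalSet_le (hp0 : ∀ x, 0 ≤ p x) (hp : ∑ x, p x = 1) {n : ℕ} {δ : ℝ}
    (hnδ : 0 < n * δ) [DecidableEq X] :
    ∑ x ∈ (typicalSet p n δ)ᶜ, ∏ i, p (x i) ≤
      n * (∑ x, p x * surprisalDeviation p x ^ 2) / (n * δ) ^ 2 := by
  have hprod (x : Fin n → X) : 0 ≤ ∏ i, p (x i) := Finset.prod_nonneg fun i _ => hp0 _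
  rw [← sum_prod_mul_sum_sq p _ hp (sum_mul_surprisalDeviation hp), Finset.sum_div]
  refine (Finset.sum_le_sum fun x hx => ?_).trans (Finset.sum_le_univ_sum_of_nonneg fun x =>
    div_nonneg (mul_nonneg (hprod x) (sq_nonneg _)) (sq_nonneg _))
  by_cases hx0 : ∀ i, p (x i) ≠ 0
  · have hdev : n * δ < |∑ i, surprisalDeviation p (x i)| := by
      simpa [typicalSet, hx0] using hx
    rw [le_div_iff₀ (by positivity), ← sq_abs (∑ i, _)]
    gcongr
    exact hprod x
  · obtain ⟨i, hi⟩ := not_forall_not.1 hx0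
    rw [Finset.prod_eq_zero (f := fun i => p (x i)) (Finset.mem_univ i) hi, zero_mul, zero_div]

theorem eventually_sum_compl_typicalSet_le (hp0 : ∀ x, 0 ≤ p x) (hp : ∑ x, p x = 1) {δ ε : ℝ}
    (hδ : 0 < δ) (hε : 0 < ε) [DecidableEq X] :
    ∀ᶠ n : ℕ in atTop, ∑ x ∈ (typicalSet p n δ)ᶜ, ∏ i, p (x i) ≤ ε := by
  have hlim : Tendsto (fun n : ℕ => (∑ x, p x * surprisalDeviation p x ^ 2) / δ ^ 2 / (n : ℝ))
      atTop (𝓝 0) := tendsto_const_div_atTop_nhds_zero_nat _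
  filter_upwards [hlim.eventually_le_const hε, eventually_gt_atTop 0] with n hn hn0
  refine (sum_compl_typicalSet_le hp0 hp (by positivity)).trans (hn.trans' (le_of_eq ?_))
  field_simp

end TypicalSet

section TensorPower

variable {X Y Z : Type*}

/-- The `n`-fold tensor power of a matrix. -/
def tpow (M : Matrix X Y ℂ) (n : ℕ) : Matrix (Fin n → X) (Fin n → Y) ℂ :=
  Matrix.of fun f g => ∏ i, M (f i) (g i)

theorem tpow_mul [Fintype Y] (M : Matrix X Y ℂ) (N : Matrix Y Z ℂ) (n : ℕ) :
    tpow (M * N) n = tpow M n * tpow N n := by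
  ext f g
  simp only [tpow, of_apply, mul_apply, ← Finset.prod_mul_distrib]
  exact Fintype.prod_sum fun i y => M (f i) y * N y (g i)

theorem tpow_conjTranspose (M : Matrix X Y ℂ) (n : ℕ) : tpow Mᴴ n = (tpow M n)ᴴ := by
  ext f g
  simp [tpow]

theorem tpow_diagonal [DecidableEq X] (d : X → ℂ) (n : ℕ) :
    tpow (diagonal d) n = diagonal fun x : Fin n → X => ∏ i, d (x i) := by
  ext f g
  rw [tpow, of_apply]
  by_cases hfg : f = g
  · simp [hfg]
  · obtain ⟨i, hi⟩ := Function.ne_iff.1 hfg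
    rw [diagonal_apply_ne _ hfg]
    exact Finset.prod_eq_zero (Finset.mem_univ i) (diagonal_apply_ne _ hi)

theorem tpow_one [DecidableEq X] (n : ℕ) : tpow (1 : Matrix X X ℂ) n = 1 := by
  simp [← diagonal_one, tpow_diagonal]

theorem tpow_conjTranspose_mul_self [Fintype X] [DecidableEq Y] {F : Matrix X Y ℂ}
    (hF : Fᴴ * F = 1) (n : ℕ) : (tpow F n)ᴴ * tpow F n = 1 := by
  rw [← tpow_conjTranspose, ← tpow_mul, hF, tpow_one]

theorem tpow_conjDiagonal [Fintype X] [DecidableEq X] (F : Matrix Y X ℂ) (d : X → ℝ) (n : ℕ) :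
    tpow (conjDiagonal F d) n = conjDiagonal (tpow F n) fun x => ∏ i, d (x i) := by
  simp [conjDiagonal, tpow_mul, tpow_diagonal, tpow_conjTranspose]

theorem frobenius_norm_tpow [Fintype X] [Fintype Y] (M : Matrix X Y ℂ) (n : ℕ) :
    ‖tpow M n‖ = ‖M‖ ^ n := by
  refine (sq_eq_sq₀ (norm_nonneg _) (by positivity)).1 ?_
  rw [pow_right_comm, frobenius_norm_sq, frobenius_norm_sq, Fintype.sum_pow]
  refine Finset.sum_congr rfl fun f _ => ?_
  rw [Fintype.prod_sum]
  simp [tpow, Finset.prod_pow]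

end TensorPower

section TypicalProjection

theorem frobenius_norm_sub_projection_mul_sq {X Y : Type*} [Fintype X] [Fintype Y]
    {P : Matrix X X ℂ} (hPH : Pᴴ = P) (hP : P * P = P) (w : Matrix X Y ℂ) :
    ‖w - P * w‖ ^ 2 = ‖w‖ ^ 2 - ‖P * w‖ ^ 2 := by
  have hcross : (w * (P * w)ᴴ).trace = (P * w * (P * w)ᴴ).trace := by
    rw [conjTranspose_mul, hPH, ← Matrix.mul_assoc, Matrix.mul_assoc P, ← Matrix.mul_assoc w,
      Matrix.trace_mul_comm P, Matrix.mul_assoc _ P, hP]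
  rw [frobenius_norm_sub_sq, hcross, ← frobenius_norm_sq_eq_re_trace]
  ring

theorem isState_mul_conjTranspose_self {X Y : Type*} [Fintype X] [Fintype Y] {w : Matrix X Y ℂ}
    (hw : ‖w‖ = 1) : IsState (w * wᴴ) :=
  ⟨posSemidef_self_mul_conjTranspose w, by simp [trace_mul_conjTranspose_self, hw]⟩

variable {X Y : Type*} [Fintype X] [Fintype Y] [DecidableEq X]

theorem entropy_eq_shannonEntropy {ρ : Matrix X X ℂ} (hρ : ρ.IsHermitian) :
    entropy ρ = shannonEntropy hρ.eigenvalues := by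
  rw [entropy, dif_pos hρ, shannonEntropy]

open Classical in
/-- The projection onto the span of the products of eigenvectors of `ρ` whose eigenvalue sequences
are typical. -/
def typicalProjection {ρ : Matrix X X ℂ} (hρ : ρ.IsHermitian) (n : ℕ) (δ : ℝ) :
    Matrix (Fin n → X) (Fin n → X) ℂ :=
  conjDiagonal (tpow (hρ.eigenvectorUnitary : Matrix X X ℂ) n)
    fun x => if x ∈ typicalSet hρ.eigenvalues n δ then 1 else 0

section Hermitian

variable {ρ : Matrix X X ℂ} (hρ : ρ.IsHermitian) (n : ℕ) (δ : ℝ)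

theorem typicalProjection_conjTranspose :
    (typicalProjection hρ n δ)ᴴ = typicalProjection hρ n δ :=
  conjDiagonal_conjTranspose _ _

theorem tpow_eigenvectorUnitary_conjTranspose_mul_self :
    (tpow (hρ.eigenvectorUnitary : Matrix X X ℂ) n)ᴴ * tpow (hρ.eigenvectorUnitary) n = 1 :=
  tpow_conjTranspose_mul_self (eigenvectorUnitary_conjTranspose_mul_self hρ) n

theorem typicalProjection_mul_self :
    typicalProjection hρ n δ * typicalProjection hρ n δ = typicalProjection hρ n δ := by
  rw [typicalProjection, conjDiagonal_mul (tpow_eigenvectorUnitary_conjTranspose_mul_self hρ n)]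
  congr 1
  ext x
  simp

open Classical in
theorem typicalProjection_mul_tpow_mul_typicalProjection :
    typicalProjection hρ n δ * tpow ρ n * typicalProjection hρ n δ =
      conjDiagonal (tpow (hρ.eigenvectorUnitary : Matrix X X ℂ) n)
        fun x => if x ∈ typicalSet hρ.eigenvalues n δ then ∏ i, hρ.eigenvalues (x i) else 0 := by
  have hF := tpow_eigenvectorUnitary_conjTranspose_mul_self hρ n
  have hspectral : tpow ρ n = conjDiagonal (tpow (hρ.eigenvectorUnitary : Matrix X X ℂ) n)
      fun x => ∏ i, hρ.eigenvalues (x i) := by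
    rw [← tpow_conjDiagonal, ← eq_conjDiagonal_eigenvalues hρ]
  rw [hspectral, typicalProjection, conjDiagonal_mul hF, conjDiagonal_mul hF]
  congr 1
  ext x
  simp only [Pi.mul_apply]
  split_ifs <;> simp

end Hermitian

theorem sum_eigenvalues_eq_one {ρ : Matrix X X ℂ} (hρ : ρ.IsHermitian) (htr : ρ.trace = 1) :
    ∑ x, hρ.eigenvalues x = 1 := by
  rw [hρ.trace_eq_sum_eigenvalues] at htr
  exact Complex.ofReal_injective (by simpa using htr)

theorem frobenius_norm_typicalProjection_sq_le {ρ : Matrix X X ℂ} (hρ : IsState ρ) (n : ℕ)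
    (δ : ℝ) :
    ‖typicalProjection hρ.1.isHermitian n δ‖ ^ 2 ≤ 2 ^ (n * (entropy ρ + δ)) := by
  rw [frobenius_norm_sq_eq_re_trace, typicalProjection_conjTranspose, typicalProjection_mul_self,
    typicalProjection,
    trace_conjDiagonal (tpow_eigenvectorUnitary_conjTranspose_mul_self hρ.1.isHermitian n),
    Complex.ofReal_re, entropy_eq_shannonEntropy hρ.1.isHermitian]
  simpa using card_typicalSet_le hρ.1.eigenvalues_nonneg
    (sum_eigenvalues_eq_one hρ.1.isHermitian hρ.2) n δ

variable (w : Matrix X Y ℂ) (n : ℕ) (δ : ℝ)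

open Classical in
theorem typicalProjection_mul_tpow_mul_conjTranspose :
    typicalProjection (isHermitian_mul_conjTranspose_self w) n δ * tpow w n *
        (typicalProjection (isHermitian_mul_conjTranspose_self w) n δ * tpow w n)ᴴ =
      conjDiagonal (tpow ((isHermitian_mul_conjTranspose_self w).eigenvectorUnitary :
        Matrix X X ℂ) n) fun x =>
          if x ∈ typicalSet (isHermitian_mul_conjTranspose_self w).eigenvalues n δ
          then ∏ i, (isHermitian_mul_conjTranspose_self w).eigenvalues (x i) else 0 := by
  rw [← typicalProjection_mul_tpow_mul_typicalProjection, tpow_mul, tpow_conjTranspose,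
    conjTranspose_mul, typicalProjection_conjTranspose]
  simp only [Matrix.mul_assoc]

variable {w} (hw : ‖w‖ = 1)
include hw

theorem frobenius_norm_typicalProjection_mul_tpow_gram_sq_le :
    ‖typicalProjection (isHermitian_mul_conjTranspose_self w) n δ * tpow w n *
        (typicalProjection (isHermitian_mul_conjTranspose_self w) n δ * tpow w n)ᴴ‖ ^ 2 ≤
      2 ^ (-(n * (entropy (w * wᴴ) - δ))) := by
  have hρ := isState_mul_conjTranspose_self hw
  have hF := tpow_eigenvectorUnitary_conjTranspose_mul_self hρ.1.isHermitian n
  rw [typicalProjection_mul_tpow_mul_conjTranspose, frobenius_norm_sq_eq_re_trace,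
    conjDiagonal_conjTranspose, conjDiagonal_mul hF, trace_conjDiagonal hF, Complex.ofReal_re,
    entropy_eq_shannonEntropy hρ.1.isHermitian]
  simpa [sq] using sum_prod_sq_typicalSet_le hρ.1.eigenvalues_nonneg
    (sum_eigenvalues_eq_one hρ.1.isHermitian hρ.2) n δ

open Classical in
theorem frobenius_norm_tpow_sub_typicalProjection_mul_sq :
    ‖tpow w n - typicalProjection (isHermitian_mul_conjTranspose_self w) n δ * tpow w n‖ ^ 2 =
      ∑ x ∈ (typicalSet (isHermitian_mul_conjTranspose_self w).eigenvalues n δ)ᶜ,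
        ∏ i, (isHermitian_mul_conjTranspose_self w).eigenvalues (x i) := by
  have hρ := isState_mul_conjTranspose_self hw
  have htotal := sum_prod_eq_one (sum_eigenvalues_eq_one hρ.1.isHermitian hρ.2) n
  rw [frobenius_norm_sub_projection_mul_sq (typicalProjection_conjTranspose _ n δ)
    (typicalProjection_mul_self _ n δ), frobenius_norm_tpow, hw, one_pow, one_pow,
    frobenius_norm_sq_eq_re_trace, typicalProjection_mul_tpow_mul_conjTranspose,
    trace_conjDiagonal (tpow_eigenvectorUnitary_conjTranspose_mul_self hρ.1.isHermitian n),
    Complex.ofReal_re, sub_eq_iff_eq_add, ← htotal, Finset.sum_ite_mem, Finset.univ_inter,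
    Finset.sum_compl_add_sum]

theorem eventually_frobenius_norm_tpow_sub_typicalProjection_mul_sq_le {δ ε : ℝ} (hδ : 0 < δ)
    (hε : 0 < ε) :
    ∀ᶠ n : ℕ in atTop,
      ‖tpow w n - typicalProjection (isHermitian_mul_conjTranspose_self w) n δ * tpow w n‖ ^ 2
        ≤ ε := by
  have hρ := isState_mul_conjTranspose_self hw
  simp only [frobenius_norm_tpow_sub_typicalProjection_mul_sq _ _ hw]
  convert! eventually_sum_compl_typicalSet_le hρ.1.eigenvalues_nonneg
    (sum_eigenvalues_eq_one hρ.1.isHermitian hρ.2) hδ hε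

end TypicalProjection

section Entropy

variable {X Y : Type*} [Fintype X] [Fintype Y] [DecidableEq X] [DecidableEq Y]

theorem entropy_eq_sum_roots {ρ : Matrix X X ℂ} (hρ : ρ.IsHermitian) :
    entropy ρ = (ρ.charpoly.roots.map fun z => Real.negMulLog z.re / Real.log 2).sum := by
  rw [entropy, dif_pos hρ, hρ.roots_charpoly_eq_eigenvalues, Multiset.map_map]
  rfl

theorem entropy_transpose {ρ : Matrix X X ℂ} (hρ : ρ.IsHermitian) : entropy ρᵀ = entropy ρ := by
  rw [entropy_eq_sum_roots hρ, entropy_eq_sum_roots hρ.transpose, charpoly_transpose]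

theorem entropy_mul_conjTranspose_comm (w : Matrix X Y ℂ) :
    entropy (w * wᴴ) = entropy (wᴴ * w) := by
  rw [entropy_eq_sum_roots (isHermitian_mul_conjTranspose_self w),
    entropy_eq_sum_roots (isHermitian_conjTranspose_mul_self w)]
  have hroots := congrArg (fun q : Polynomial ℂ =>
    (q.roots.map fun z => Real.negMulLog z.re / Real.log 2).sum) (charpoly_mul_comm' w wᴴ)
  rw [Polynomial.roots_mul, Polynomial.roots_mul] at hroots
  · simpa [Multiset.map_nsmul, Multiset.sum_nsmul] using hroots
  · exact mul_ne_zero (pow_ne_zero _ Polynomial.X_ne_zero) (charpoly_monic _).ne_zero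
  · exact mul_ne_zero (pow_ne_zero _ Polynomial.X_ne_zero) (charpoly_monic _).ne_zero

theorem entropy_transpose_mul_conjTranspose (w : Matrix X Y ℂ) :
    entropy (wᵀ * wᵀᴴ) = entropy (w * wᴴ) := by
  rw [entropy_mul_conjTranspose_comm w,
    ← entropy_transpose (isHermitian_conjTranspose_mul_self w), transpose_mul]
  rfl

end Entropy

section Subadditivity

theorem sum_norm_sq_row {X Y : Type*} [Fintype Y] [DecidableEq X] {O : Matrix X Y ℂ}
    (hO : O * Oᴴ = 1) (x : X) : ∑ y, ‖O x y‖ ^ 2 = 1 := by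
  have hxx := congrFun (congrFun hO x) x
  simp only [mul_apply, conjTranspose_apply, one_apply_eq, ← starRingEnd_apply,
    Complex.mul_conj'] at hxx
  exact_mod_cast hxx

theorem conjDiagonal_apply_self {X Y : Type*} [Fintype X] [DecidableEq X] (F : Matrix Y X ℂ)
    (d : X → ℝ) (y : Y) :
    conjDiagonal F d y y = ((∑ x, ‖F y x‖ ^ 2 * d x : ℝ) : ℂ) := by
  rw [conjDiagonal, mul_apply, Complex.ofReal_sum]
  refine Finset.sum_congr rfl fun x _ => ?_
  rw [mul_diagonal, conjTranspose_apply, mul_right_comm, ← starRingEnd_apply, Complex.mul_conj']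
  push_cast
  rfl

/-- The diagonal of `Kᴴ * ρ * K` is a doubly stochastic image of the spectrum, and `negMulLog` is
concave. -/
theorem entropy_le_shannonEntropy_diag {X : Type*} [Fintype X] [DecidableEq X] {ρ K : Matrix X X ℂ}
    (hρ : ρ.PosSemidef) (hK : Kᴴ * K = 1) :
    entropy ρ ≤ shannonEntropy fun x => ((Kᴴ * ρ * K) x x).re := by
  set R : Matrix X X ℂ := (hρ.isHermitian.eigenvectorUnitary : Matrix X X ℂ)
  set l := hρ.isHermitian.eigenvalues
  have hR : Rᴴ * R = 1 := eigenvectorUnitary_conjTranspose_mul_self hρ.isHermitian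
  have hK' : K * Kᴴ = 1 := mul_eq_one_comm.1 hK
  have hdiag (x : X) : ((Kᴴ * ρ * K) x x).re = ∑ k, ‖(Kᴴ * R) x k‖ ^ 2 * l k := by
    have hconj : Kᴴ * ρ * K = conjDiagonal (Kᴴ * R) l := by
      conv_lhs => rw [eq_conjDiagonal_eigenvalues hρ.isHermitian]
      simp only [conjDiagonal, conjTranspose_mul, conjTranspose_conjTranspose, Matrix.mul_assoc]
      rfl
    rw [hconj, conjDiagonal_apply_self, Complex.ofReal_re]
  have hO' : (Kᴴ * R)ᴴ * (Kᴴ * R) = 1 := by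
    rw [conjTranspose_mul, conjTranspose_conjTranspose, Matrix.mul_assoc, ← Matrix.mul_assoc K,
      hK', Matrix.one_mul, hR]
  have hrow := sum_norm_sq_row (mul_eq_one_comm.1 hO')
  have hcol (k : X) : ∑ x, ‖(Kᴴ * R) x k‖ ^ 2 = 1 := by
    simpa using sum_norm_sq_row (O := (Kᴴ * R)ᴴ) (by rwa [conjTranspose_conjTranspose]) k
  have hjensen (x : X) :
      ∑ k, ‖(Kᴴ * R) x k‖ ^ 2 * Real.negMulLog (l k) ≤
        Real.negMulLog (∑ k, ‖(Kᴴ * R) x k‖ ^ 2 * l k) :=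
    Real.concaveOn_negMulLog.le_map_sum (fun k _ => by positivity) (hrow x)
      fun k _ => hρ.eigenvalues_nonneg k
  rw [entropy_eq_shannonEntropy hρ.isHermitian, shannonEntropy, shannonEntropy, ← Finset.sum_div,
    ← Finset.sum_div]
  refine div_le_div_of_nonneg_right ?_ (Real.log_nonneg one_le_two)
  calc ∑ k, Real.negMulLog (l k)
      = ∑ x, ∑ k, ‖(Kᴴ * R) x k‖ ^ 2 * Real.negMulLog (l k) := by
        rw [Finset.sum_comm]
        simp only [← Finset.sum_mul, hcol, one_mul]
    _ ≤ _ := by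
        simp only [hdiag]
        exact Finset.sum_le_sum fun x _ => hjensen x

theorem negMulLog_add_mul_log_le {m p q : ℝ} (hm : 0 ≤ m) (hp : m ≤ p) (hq : m ≤ q) :
    Real.negMulLog m + m * Real.log p + m * Real.log q ≤ p * q - m := by
  obtain rfl | hm := hm.eq_or_lt
  · simpa using mul_nonneg hp hq
  have hp := hm.trans_le hp
  have hq := hm.trans_le hq
  have hlog := mul_le_mul_of_nonneg_left
    (Real.log_le_sub_one_of_pos (by positivity : 0 < p * q / m)) hm.le
  rw [Real.log_div (by positivity) hm.ne', Real.log_mul hp.ne' hq.ne', mul_sub_one,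
    mul_div_cancel₀ _ hm.ne'] at hlog
  rw [Real.negMulLog]
  linarith

variable {a b : Type*} [Fintype a] [Fintype b]

theorem shannonEntropy_le_add_marginals {m : a × b → ℝ} (hm0 : ∀ x, 0 ≤ m x) (hm : ∑ x, m x = 1) :
    shannonEntropy m ≤
      shannonEntropy (fun i => ∑ j, m (i, j)) + shannonEntropy fun j => ∑ i, m (i, j) := by
  set p : a → ℝ := fun i => ∑ j, m (i, j) with hp
  set q : b → ℝ := fun j => ∑ i, m (i, j) with hq
  rw [Fintype.sum_prod_type] at hm
  have hpsum : ∑ i, p i = 1 := hm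
  have hqsum : ∑ j, q j = 1 := by rw [← hm, Finset.sum_comm]
  have hterm (i : a) (j : b) : Real.negMulLog (m (i, j)) + m (i, j) * Real.log (p i) +
      m (i, j) * Real.log (q j) ≤ p i * q j - m (i, j) :=
    negMulLog_add_mul_log_le (hm0 _)
      (Finset.single_le_sum (f := fun j => m (i, j)) (fun _ _ => hm0 _) (Finset.mem_univ j))
      (Finset.single_le_sum (f := fun i => m (i, j)) (fun _ _ => hm0 _) (Finset.mem_univ i))
  have hleft : ∑ i, ∑ j, (Real.negMulLog (m (i, j)) + m (i, j) * Real.log (p i) +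
      m (i, j) * Real.log (q j)) = ∑ x, Real.negMulLog (m x) - ∑ i, Real.negMulLog (p i) -
        ∑ j, Real.negMulLog (q j) := by
    simp only [Finset.sum_add_distrib, ← Finset.sum_mul, Fintype.sum_prod_type]
    rw [Finset.sum_comm (f := fun i j => m (i, j) * Real.log (q j))]
    simp only [← Finset.sum_mul, Real.negMulLog, neg_mul, Finset.sum_neg_distrib, sub_neg_eq_add,
      hp, hq]
  have hright : ∑ i, ∑ j, (p i * q j - m (i, j)) = 0 := by
    simp only [Finset.sum_sub_distrib, ← Finset.mul_sum, hqsum, mul_one, hpsum, hm, sub_self]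
  have hsum := Finset.sum_le_sum fun i (_ : i ∈ Finset.univ) =>
    Finset.sum_le_sum fun j (_ : j ∈ Finset.univ) => hterm i j
  rw [hleft, hright] at hsum
  simp only [shannonEntropy, ← Finset.sum_div, ← add_div]
  exact div_le_div_of_nonneg_right (by linarith) (Real.log_nonneg one_le_two)

theorem traceFst_eq_traceSnd_submatrix_swap {a b : Type*} [Fintype a]
    (ρ : Matrix (a × b) (a × b) ℂ) :
    traceFst ρ = traceSnd (ρ.submatrix Prod.swap Prod.swap) :=
  rfl

theorem traceSnd_isHermitian {a b : Type*} [Fintype b] {ρ : Matrix (a × b) (a × b) ℂ}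
    (hρ : ρ.IsHermitian) : (traceSnd ρ).IsHermitian := by
  ext i j
  simp only [traceSnd, conjTranspose_apply, of_apply, star_sum]
  exact Finset.sum_congr rfl fun k _ => hρ.apply _ _

theorem traceFst_isHermitian {a b : Type*} [Fintype a] {ρ : Matrix (a × b) (a × b) ℂ}
    (hρ : ρ.IsHermitian) : (traceFst ρ).IsHermitian :=
  traceSnd_isHermitian (hρ.submatrix Prod.swap)

theorem trace_mul_kronecker_one [DecidableEq b] (ρ : Matrix (a × b) (a × b) ℂ) (Q : Matrix a a ℂ) :
    (ρ * (Q ⊗ₖ (1 : Matrix b b ℂ))).trace = (traceSnd ρ * Q).trace := by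
  simp only [trace, diag_apply, mul_apply, traceSnd, of_apply, Fintype.sum_prod_type,
    kroneckerMap_apply, Finset.sum_mul, one_apply, mul_ite, mul_one, mul_zero,
    Finset.sum_ite_eq', Finset.mem_univ, if_true]
  exact Finset.sum_congr rfl fun i _ => Finset.sum_comm

theorem traceSnd_conj_kronecker [DecidableEq b] (ρ : Matrix (a × b) (a × b) ℂ) (F : Matrix a a ℂ)
    {G : Matrix b b ℂ} (hG : G * Gᴴ = 1) :
    traceSnd ((F ⊗ₖ G)ᴴ * ρ * (F ⊗ₖ G)) = Fᴴ * traceSnd ρ * F := by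
  classical
  refine ext_iff_trace_mul_right.2 fun Q => ?_
  have hconj : (F ⊗ₖ G) * (Q ⊗ₖ 1) * (F ⊗ₖ G)ᴴ = (F * Q * Fᴴ) ⊗ₖ (1 : Matrix b b ℂ) := by
    rw [conjTranspose_kronecker, ← mul_kronecker_mul, ← mul_kronecker_mul, Matrix.mul_one, hG]
  calc _ = ((F ⊗ₖ G)ᴴ * (ρ * (F ⊗ₖ G) * (Q ⊗ₖ 1))).trace := by
        rw [← trace_mul_kronecker_one]
        simp only [Matrix.mul_assoc]
    _ = (ρ * ((F * Q * Fᴴ) ⊗ₖ 1)).trace := by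
        rw [trace_mul_comm, ← hconj]
        simp only [Matrix.mul_assoc]
    _ = (traceSnd ρ * F * Q * Fᴴ).trace := by
        rw [trace_mul_kronecker_one]
        simp only [Matrix.mul_assoc]
    _ = _ := by
        rw [trace_mul_comm]
        simp only [Matrix.mul_assoc]

theorem traceFst_conj_kronecker [DecidableEq a] (ρ : Matrix (a × b) (a × b) ℂ) {F : Matrix a a ℂ}
    (G : Matrix b b ℂ) (hF : F * Fᴴ = 1) :
    traceFst ((F ⊗ₖ G)ᴴ * ρ * (F ⊗ₖ G)) = Gᴴ * traceFst ρ * G := by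
  have hswap : (F ⊗ₖ G).submatrix Prod.swap Prod.swap = G ⊗ₖ F := by
    ext p q
    exact mul_comm _ _
  simp only [traceFst_eq_traceSnd_submatrix_swap, ← traceSnd_conj_kronecker _ G hF, ← hswap,
    conjTranspose_submatrix, ← Equiv.coe_prodComm, submatrix_mul_equiv]

variable [DecidableEq a] [DecidableEq b]

/-- Subadditivity: dephasing in a product eigenbasis of the two reduced states does not decrease
the joint entropy, and leaves a classical distribution with the spectra of the reduced states as
marginals. -/
theorem mutualInfo_nonneg {ρ : Matrix (a × b) (a × b) ℂ} (hρ : IsState ρ) : 0 ≤ mutualInfo ρ := by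
  have ha := traceSnd_isHermitian hρ.1.isHermitian
  have hb := traceFst_isHermitian hρ.1.isHermitian
  set F : Matrix a a ℂ := (ha.eigenvectorUnitary : Matrix a a ℂ)
  set G : Matrix b b ℂ := (hb.eigenvectorUnitary : Matrix b b ℂ)
  have hF : Fᴴ * F = 1 := eigenvectorUnitary_conjTranspose_mul_self ha
  have hG : Gᴴ * G = 1 := eigenvectorUnitary_conjTranspose_mul_self hb
  set K := F ⊗ₖ G with hK
  have hKK : Kᴴ * K = 1 := by
    rw [hK, conjTranspose_kronecker, ← mul_kronecker_mul, hF, hG, one_kronecker_one]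
  set m : a × b → ℝ := fun x => ((Kᴴ * ρ * K) x x).re
  have hm0 (x : a × b) : 0 ≤ m x :=
    (Complex.nonneg_iff.1 ((hρ.1.conjTranspose_mul_mul_same K).diag_nonneg)).1
  have hm : ∑ x, m x = 1 := by
    have htr : (Kᴴ * ρ * K).trace = 1 := by
      rw [trace_mul_comm, ← Matrix.mul_assoc, mul_eq_one_comm.1 hKK, Matrix.one_mul, hρ.2]
    simpa [trace] using congrArg Complex.re htr
  have hp : (fun i => ∑ j, m (i, j)) = ha.eigenvalues := funext fun i => by
    have hdiag := (traceSnd_conj_kronecker ρ F (mul_eq_one_comm.1 hG)).trans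
      (eigenvectorUnitary_conjTranspose_mul_mul ha)
    simpa [traceSnd, m, hK] using congrArg Complex.re (congrFun (congrFun hdiag i) i)
  have hq : (fun j => ∑ i, m (i, j)) = hb.eigenvalues := funext fun j => by
    have hdiag := (traceFst_conj_kronecker ρ G (mul_eq_one_comm.1 hF)).trans
      (eigenvectorUnitary_conjTranspose_mul_mul hb)
    simpa [traceFst, m, hK] using congrArg Complex.re (congrFun (congrFun hdiag j) j)
  have hmarg := shannonEntropy_le_add_marginals hm0 hm
  rw [hp, hq, ← entropy_eq_shannonEntropy ha, ← entropy_eq_shannonEntropy hb] at hmarg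
  exact sub_nonneg.2 ((entropy_le_shannonEntropy_diag hρ.1 hKK).trans hmarg)

end Subadditivity

section Reindex

variable {X Y X' Y' Z : Type*} [Fintype X] [Fintype Y] [Fintype X'] [Fintype Y'] [Fintype Z]

theorem frobenius_norm_eq_of_equiv {M : Matrix X Y ℂ} {M' : Matrix X' Y' ℂ}
    (e : X × Y ≃ X' × Y') (h : ∀ p, M p.1 p.2 = M' (e p).1 (e p).2) : ‖M‖ = ‖M'‖ := by
  refine (sq_eq_sq₀ (norm_nonneg _) (norm_nonneg _)).1 ?_
  simp only [frobenius_norm_sq, ← Fintype.sum_prod_type']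
  rw [← e.sum_comp]
  exact Finset.sum_congr rfl fun p _ => by rw [h]

theorem frobenius_norm_submatrix_equiv (M : Matrix X Y ℂ) (e : X' ≃ X) (f : Y' ≃ Y) :
    ‖M.submatrix e f‖ = ‖M‖ :=
  frobenius_norm_eq_of_equiv (e.prodCongr f) fun _ => rfl

theorem frobenius_norm_mul_of_isometry [DecidableEq Y] {U : Matrix X Y ℂ} (hU : Uᴴ * U = 1)
    (P : Matrix Y Z ℂ) : ‖U * P‖ = ‖P‖ := by
  refine (sq_eq_sq₀ (norm_nonneg _) (norm_nonneg _)).1 ?_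
  rw [← frobenius_norm_conjTranspose (U * P), ← frobenius_norm_conjTranspose P,
    frobenius_norm_sq_eq_re_trace, frobenius_norm_sq_eq_re_trace, conjTranspose_conjTranspose,
    conjTranspose_conjTranspose, conjTranspose_mul, Matrix.mul_assoc, ← Matrix.mul_assoc Uᴴ, hU,
    Matrix.one_mul]

theorem IsContraction.frobenius_norm_conj_le [DecidableEq X] {R : Matrix X X ℂ}
    (hR : IsContraction R) (M : Matrix X X ℂ) : ‖R * M * Rᴴ‖ ≤ ‖M‖ := by
  rw [← frobenius_norm_conjTranspose (R * M * Rᴴ), conjTranspose_mul,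
    conjTranspose_conjTranspose]
  refine (hR.frobenius_norm_mul_le _).trans ?_
  rw [frobenius_norm_conjTranspose]
  exact hR.frobenius_norm_mul_le M

end Reindex

section Iid

variable {A X Z : Type*}

/-- The ket of `n` copies of the tripartite ket `w` on `A X Z`. -/
def ketPow (w : Matrix (A × X) Z ℂ) (n : ℕ) :
    Matrix ((Fin n → A) × (Fin n → X)) (Fin n → Z) ℂ :=
  (tpow w n).submatrix
    (Equiv.arrowProdEquivProdArrow (Fin n) (fun _ => A) (fun _ => X)).symm (Equiv.refl _)

theorem sideKet_ketPow (w : Matrix (A × X) Z ℂ) (n : ℕ) :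
    sideKet (ketPow w n) = (tpow (sideKet w) n).submatrix (Equiv.refl _)
      (Equiv.arrowProdEquivProdArrow (Fin n) (fun _ => A) (fun _ => Z)).symm := rfl

variable [Fintype A] [Fintype X] [Fintype Z]

theorem frobenius_norm_ketPow (w : Matrix (A × X) Z ℂ) (n : ℕ) : ‖ketPow w n‖ = ‖w‖ ^ n := by
  rw [ketPow, frobenius_norm_submatrix_equiv, frobenius_norm_tpow]

variable [DecidableEq A] [DecidableEq X]

/-- The `n` copies of `w` projected first onto the typical subspace of `A X` and then onto the
typical subspace of `X`. -/
def smoothedKet (w : Matrix (A × X) Z ℂ) (n : ℕ) (δ : ℝ) :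
    Matrix ((Fin n → A) × (Fin n → X)) (Fin n → Z) ℂ :=
  (1 : Matrix (Fin n → A) (Fin n → A) ℂ) ⊗ₖ
      typicalProjection (isHermitian_mul_conjTranspose_self (sideKet w)) n δ *
    (typicalProjection (isHermitian_mul_conjTranspose_self w) n δ * tpow w n).submatrix
      (Equiv.arrowProdEquivProdArrow (Fin n) (fun _ => A) (fun _ => X)).symm (Equiv.refl _)

theorem one_kronecker_typicalProjection_mul_self {ρ : Matrix X X ℂ} (hρ : ρ.IsHermitian)
    (n : ℕ) (δ : ℝ) :
    (1 : Matrix A A ℂ) ⊗ₖ typicalProjection hρ n δ * (1 ⊗ₖ typicalProjection hρ n δ) =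
      1 ⊗ₖ typicalProjection hρ n δ := by
  rw [← mul_kronecker_mul, Matrix.one_mul, typicalProjection_mul_self]

theorem isContraction_one_kronecker_typicalProjection {ρ : Matrix X X ℂ} (hρ : ρ.IsHermitian)
    (n : ℕ) (δ : ℝ) : IsContraction ((1 : Matrix A A ℂ) ⊗ₖ typicalProjection hρ n δ) :=
  isContraction_of_projection
    (by rw [conjTranspose_kronecker, conjTranspose_one, typicalProjection_conjTranspose])
    (one_kronecker_typicalProjection_mul_self hρ n δ)

section SmoothedKet

variable (w : Matrix (A × X) Z ℂ) (n : ℕ) (δ : ℝ)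

theorem one_kronecker_typicalProjection_mul_smoothedKet :
    (1 : Matrix (Fin n → A) (Fin n → A) ℂ) ⊗ₖ
        typicalProjection (isHermitian_mul_conjTranspose_self (sideKet w)) n δ *
      smoothedKet w n δ = smoothedKet w n δ := by
  rw [smoothedKet, ← Matrix.mul_assoc, one_kronecker_typicalProjection_mul_self]

variable {w} (hw : ‖w‖ = 1)
include hw

theorem frobenius_norm_smoothedKet_le_one : ‖smoothedKet w n δ‖ ≤ 1 := by
  refine ((isContraction_one_kronecker_typicalProjection _ n δ).frobenius_norm_mul_le _).trans ?_
  rw [frobenius_norm_submatrix_equiv]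
  refine ((isContraction_of_projection (typicalProjection_conjTranspose _ n δ)
    (typicalProjection_mul_self _ n δ)).frobenius_norm_mul_le _).trans_eq ?_
  rw [frobenius_norm_tpow, hw, one_pow]

theorem frobenius_norm_smoothedKet_gram_sq_le :
    ‖smoothedKet w n δ * (smoothedKet w n δ)ᴴ‖ ^ 2 ≤ 2 ^ (-(n * (entropy (w * wᴴ) - δ))) := by
  refine le_trans ?_ (frobenius_norm_typicalProjection_mul_tpow_gram_sq_le n δ hw)
  gcongr
  rw [smoothedKet, conjTranspose_mul, Matrix.mul_assoc, ← Matrix.mul_assoc _ _ (_ ⊗ₖ _)ᴴ,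
    ← Matrix.mul_assoc]
  refine ((isContraction_one_kronecker_typicalProjection _ n δ).frobenius_norm_conj_le _).trans ?_
  rw [conjTranspose_submatrix, submatrix_mul_equiv, frobenius_norm_submatrix_equiv]

omit hw in
theorem frobenius_norm_ketPow_sub_smoothedKet_le :
    ‖ketPow w n - smoothedKet w n δ‖ ≤
      ‖tpow (sideKet w) n -
        typicalProjection (isHermitian_mul_conjTranspose_self (sideKet w)) n δ *
          tpow (sideKet w) n‖ +
      ‖tpow w n - typicalProjection (isHermitian_mul_conjTranspose_self w) n δ * tpow w n‖ := by
  set P := typicalProjection (isHermitian_mul_conjTranspose_self (sideKet w)) n δ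
  set Q := typicalProjection (isHermitian_mul_conjTranspose_self w) n δ
  set e := (Equiv.arrowProdEquivProdArrow (Fin n) (fun _ => A) (fun _ => X)).symm
  set R : Matrix ((Fin n → A) × (Fin n → X)) ((Fin n → A) × (Fin n → X)) ℂ := 1 ⊗ₖ P with hR
  have hsplit : ketPow w n - smoothedKet w n δ = (ketPow w n - R * ketPow w n) +
      R * (tpow w n - Q * tpow w n).submatrix e (Equiv.refl _) := by
    have hsub : (tpow w n - Q * tpow w n).submatrix e (Equiv.refl _) =
        ketPow w n - (Q * tpow w n).submatrix e (Equiv.refl _) := rfl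
    rw [hsub, Matrix.mul_sub, sub_add_sub_cancel]
    rfl
  have hside : ‖ketPow w n - R * ketPow w n‖ =
      ‖tpow (sideKet w) n - P * tpow (sideKet w) n‖ := by
    have hsub : sideKet (ketPow w n - R * ketPow w n) =
        sideKet (ketPow w n) - sideKet (R * ketPow w n) := rfl
    rw [← frobenius_norm_sideKet, hsub, hR, sideKet_one_kronecker_mul, sideKet_ketPow,
      ← frobenius_norm_submatrix_equiv (tpow (sideKet w) n - _) (Equiv.refl _)
        (Equiv.arrowProdEquivProdArrow (Fin n) (fun _ => A) (fun _ => Z)).symm]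
    rfl
  rw [hsplit]
  refine (norm_add_le _ _).trans (add_le_add hside.le ?_)
  exact ((isContraction_one_kronecker_typicalProjection _ n δ).frobenius_norm_mul_le _).trans_eq
    (frobenius_norm_submatrix_equiv _ _ _)

theorem eventually_frobenius_norm_ketPow_sub_smoothedKet_le {ε : ℝ} (hδ : 0 < δ) (hε : 0 < ε) :
    ∀ᶠ n : ℕ in atTop, ‖ketPow w n - smoothedKet w n δ‖ ≤ ε := by
  have hε' : 0 < (ε / 2) ^ 2 := by positivity
  filter_upwards [eventually_frobenius_norm_tpow_sub_typicalProjection_mul_sq_le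
      ((frobenius_norm_sideKet w).trans hw) hδ hε',
    eventually_frobenius_norm_tpow_sub_typicalProjection_mul_sq_le hw hδ hε'] with n hside hjoint
  linarith [frobenius_norm_ketPow_sub_smoothedKet_le (w := w) n δ,
    le_of_sq_le_sq hside (half_pos hε).le, le_of_sq_le_sq hjoint (half_pos hε).le]

end SmoothedKet

theorem eventually_two_rpow_neg_mul_le {δ ε : ℝ} (hδ : 0 < δ) (hε : 0 < ε) :
    ∀ᶠ n : ℕ in atTop, (2 : ℝ) ^ (-(n * δ)) ≤ ε := by
  have hlim : Tendsto (fun n : ℕ => ((2 : ℝ) ^ (-δ)) ^ n) atTop (𝓝 0) :=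
    tendsto_pow_atTop_nhds_zero_of_lt_one (Real.rpow_nonneg two_pos.le _)
      (Real.rpow_lt_one_of_one_lt_of_neg one_lt_two (neg_lt_zero.2 hδ))
  filter_upwards [hlim.eventually_le_const hε] with n hn
  rwa [← Real.rpow_natCast, ← Real.rpow_mul two_pos.le, neg_mul, mul_comm] at hn

/-- The conditional entropy `H(A|X) = H(A X) - H(X)` of the ket `w` on `A X Z`, written as a
matrix with the purifying system `Z` as its columns. -/
def condEntropy (w : Matrix (A × X) Z ℂ) : ℝ :=
  entropy (w * wᴴ) - entropy (sideKet w * (sideKet w)ᴴ)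

theorem smoothed_decoupling_error_sq_le {w : Matrix (A × X) Z ℂ} (hw : ‖w‖ = 1) (n : ℕ) (δ : ℝ)
    {m j : ℕ} (hj : 0 < j)
    (hmj : (m : ℝ) ≤ j * 2 ^ (n * (condEntropy w - δ))) :
    (√m * ‖typicalProjection (isHermitian_mul_conjTranspose_self (sideKet w)) n (δ / 4)‖ *
      (‖smoothedKet w n (δ / 4) * (smoothedKet w n (δ / 4))ᴴ‖ / √j)) ^ 2 ≤
        2 ^ (-(n * (δ / 2))) := by
  have hpow : ∀ x : ℝ, (0 : ℝ) ≤ 2 ^ x := fun x => Real.rpow_nonneg two_pos.le x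
  have hsupport := frobenius_norm_typicalProjection_sq_le
    (isState_mul_conjTranspose_self ((frobenius_norm_sideKet w).trans hw)) n (δ / 4)
  have hgram := frobenius_norm_smoothedKet_gram_sq_le n (δ / 4) hw
  have hj' : (0 : ℝ) < j := Nat.cast_pos.2 hj
  rw [mul_pow, mul_pow, div_pow, Real.sq_sqrt (Nat.cast_nonneg m), Real.sq_sqrt hj'.le,
    mul_div_assoc', div_le_iff₀ hj']
  calc _ ≤ (j : ℝ) * 2 ^ (n * (condEntropy w - δ)) *
          2 ^ (n * (entropy (sideKet w * (sideKet w)ᴴ) + δ / 4)) *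
          2 ^ (-(n * (entropy (w * wᴴ) - δ / 4))) :=
        mul_le_mul (mul_le_mul hmj hsupport (sq_nonneg _) (mul_nonneg hj'.le (hpow _))) hgram
          (sq_nonneg _) (mul_nonneg (mul_nonneg hj'.le (hpow _)) (hpow _))
    _ = (2 : ℝ) ^ (-(n * (δ / 2))) * j := by
        rw [mul_assoc, mul_assoc, mul_comm (j : ℝ), ← Real.rpow_add two_pos,
          ← Real.rpow_add two_pos, condEntropy]
        ring_nf

theorem eventually_expect_traceNorm_codedKet_sub_refState_le {w : Matrix (A × X) Z ℂ}
    (hw : ‖w‖ = 1) {δ s : ℝ} (hδ : 0 < δ) (hs : 0 < s) :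
    ∀ᶠ n : ℕ in atTop, ∀ (K M J : Type) [Fintype K] [Fintype M] [Fintype J] [DecidableEq K]
      [DecidableEq M] [Nonempty K] [Nonempty M] [Nonempty J] (e : K ≃ M × J),
      (Fintype.card M : ℝ) ≤ Fintype.card J * 2 ^ (n * (condEntropy w - δ)) →
      𝔼 v, traceNorm (codedKet e (phaseMatrix v) (ketPow w n) *
        (codedKet e (phaseMatrix v) (ketPow w n))ᴴ - refState M (ketPow w n)) ≤ s := by
  filter_upwards [
    eventually_frobenius_norm_ketPow_sub_smoothedKet_le (δ / 4) hw (by positivity)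
      (by positivity : 0 < s / 8),
    eventually_two_rpow_neg_mul_le (half_pos hδ) (by positivity : 0 < (s / 2) ^ 2)]
    with n hclose hsmall K M J _ _ _ _ _ _ _ _ e hMJ
  refine (expect_traceNorm_codedKet_sub_refState_le e (ketPow w n)
    (one_kronecker_typicalProjection_mul_smoothedKet w n (δ / 4))).trans ?_
  have hmain := le_of_sq_le_sq
    ((smoothed_decoupling_error_sq_le hw n δ Fintype.card_pos hMJ).trans hsmall) (half_pos hs).le
  have hnorms : ‖ketPow w n‖ + ‖smoothedKet w n (δ / 4)‖ ≤ 2 := by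
    linarith [(frobenius_norm_ketPow w n).trans (by rw [hw, one_pow]),
      frobenius_norm_smoothedKet_le_one n (δ / 4) hw]
  nlinarith [norm_nonneg (ketPow w n - smoothedKet w n (δ / 4))]

end Iid

section Dilation

variable {a b c e r f : Type*} [Fintype a]

section Channel

variable [Fintype b] [Fintype c] [Fintype e]

theorem isChannel_of_kraus [DecidableEq a] {ι : Type*} [Fintype ι]
    {Φ : Matrix a a ℂ →ₗ[ℂ] Matrix b b ℂ} {K : ι → Matrix b a ℂ} (hK : ∑ i, (K i)ᴴ * K i = 1)
    (hΦ : ∀ X, Φ X = ∑ i, K i * X * (K i)ᴴ) : IsChannel Φ :=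
  ⟨Fintype.card ι, fun i => K ((Fintype.equivFin ι).symm i),
    by rw [(Fintype.equivFin ι).symm.sum_comp fun i => (K i)ᴴ * K i, hK],
    fun X => by rw [(Fintype.equivFin ι).symm.sum_comp fun i => K i * X * (K i)ᴴ, hΦ]⟩

theorem exists_isIsometricExtension [DecidableEq a]
    {N : Matrix a a ℂ →ₗ[ℂ] Matrix b b ℂ} (hN : IsChannel N) :
    ∃ (k : ℕ) (U : Matrix (b × Fin k) a ℂ), IsIsometricExtension N U := by
  obtain ⟨k, K, hK, hNK⟩ := hN
  refine ⟨k, Matrix.of fun p x => K p.2 p.1 x, ?_, fun X => ?_⟩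
  · rw [← hK]
    ext i j
    simp only [Matrix.sum_apply, mul_apply, conjTranspose_apply, of_apply, Fintype.sum_prod_type]
    exact Finset.sum_comm
  · ext i j
    rw [hNK, Matrix.sum_apply]
    rfl

theorem IsChannel.comp [DecidableEq a] [DecidableEq b] {Ψ : Matrix b b ℂ →ₗ[ℂ] Matrix c c ℂ}
    {Φ : Matrix a a ℂ →ₗ[ℂ] Matrix b b ℂ} (hΨ : IsChannel Ψ) (hΦ : IsChannel Φ) :
    IsChannel (Ψ ∘ₗ Φ) := by
  obtain ⟨k, K, hK, hΨK⟩ := hΨ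
  obtain ⟨l, L, hL, hΦL⟩ := hΦ
  refine isChannel_of_kraus (K := fun p : Fin l × Fin k => K p.2 * L p.1) ?_ fun X => ?_
  · have hterm : ∀ i, ∑ j, (K j * L i)ᴴ * (K j * L i) = (L i)ᴴ * L i := fun i => by
      simp only [conjTranspose_mul, Matrix.mul_assoc]
      simp only [← Matrix.mul_assoc (K _)ᴴ, ← Matrix.mul_sum, ← Matrix.sum_mul, hK,
        Matrix.one_mul]
    rw [Fintype.sum_prod_type, ← hL]
    exact Finset.sum_congr rfl fun i _ => hterm i
  · rw [LinearMap.comp_apply, hΦL, map_sum, Fintype.sum_prod_type]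
    simp only [hΨK, conjTranspose_mul, Matrix.mul_assoc]

/-- The map `X ↦ tr_e (V X Vᴴ)`. -/
def dilatedChannel (V : Matrix (b × e) a ℂ) : Matrix a a ℂ →ₗ[ℂ] Matrix b b ℂ where
  toFun X := traceSnd (V * X * Vᴴ)
  map_add' X Y := by
    ext i j
    simp [traceSnd, Matrix.mul_add, Matrix.add_mul, Finset.sum_add_distrib]
  map_smul' c X := by
    ext i j
    simp [traceSnd, Finset.mul_sum]

theorem isChannel_dilatedChannel [DecidableEq a] {V : Matrix (b × e) a ℂ} (hV : Vᴴ * V = 1) :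
    IsChannel (dilatedChannel V) := by
  refine isChannel_of_kraus (K := fun k => Matrix.of fun i j => V (i, k) j) ?_ fun X => ?_
  · ext i j
    simp only [← hV, Matrix.sum_apply, mul_apply, conjTranspose_apply, of_apply,
      Fintype.sum_prod_type]
    exact Finset.sum_comm
  · ext i j
    simp only [dilatedChannel, LinearMap.coe_mk, AddHom.coe_mk, traceSnd, of_apply,
      Matrix.sum_apply, mul_apply, conjTranspose_apply]

end Channel

/-- The effect of `V : a → b e` on a ket on `(r a) ⊗ f`; the environment `e` joins `f`. -/
def pushKet (V : Matrix (b × e) a ℂ) (κ : Matrix (r × a) f ℂ) : Matrix (r × b) (e × f) ℂ :=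
  Matrix.of fun p q => (V * sideKet κ) (p.2, q.1) (p.1, q.2)

theorem applySnd_mul_conjTranspose [Fintype e] [Fintype f]
    {Φ : Matrix a a ℂ →ₗ[ℂ] Matrix b b ℂ} {V : Matrix (b × e) a ℂ}
    (hΦ : ∀ X, Φ X = traceSnd (V * X * Vᴴ)) (κ : Matrix (r × a) f ℂ) :
    applySnd Φ (κ * κᴴ) = pushKet V κ * (pushKet V κ)ᴴ := by
  ext p q
  let slice : r → Matrix a f ℂ := fun i => Matrix.of fun x g => κ (i, x) g
  have hblock : (Matrix.of fun x y => (κ * κᴴ) (p.1, x) (q.1, y)) =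
      slice p.1 * (slice q.1)ᴴ := rfl
  rw [applySnd, of_apply, hΦ, hblock, Matrix.mul_assoc, Matrix.mul_assoc, ← conjTranspose_mul,
    ← Matrix.mul_assoc, mul_apply, Fintype.sum_prod_type]
  rfl

theorem pushKet_sub (V : Matrix (b × e) a ℂ) (κ κ' : Matrix (r × a) f ℂ) :
    pushKet V (κ - κ') = pushKet V κ - pushKet V κ' := by
  have hside : sideKet (κ - κ') = sideKet κ - sideKet κ' := rfl
  ext p q
  simp only [pushKet, hside, Matrix.mul_sub, of_apply, Matrix.sub_apply]

theorem frobenius_norm_pushKet [Fintype b] [Fintype e] [Fintype r] [Fintype f] [DecidableEq a]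
    {V : Matrix (b × e) a ℂ} (hV : Vᴴ * V = 1)
    (κ : Matrix (r × a) f ℂ) : ‖pushKet V κ‖ = ‖κ‖ := by
  rw [← frobenius_norm_sideKet κ, ← frobenius_norm_mul_of_isometry hV]
  exact frobenius_norm_eq_of_equiv
    { toFun := fun p => ((p.1.2, p.2.1), (p.1.1, p.2.2))
      invFun := fun p => ((p.2.1, p.1.1), (p.1.2, p.2.2))
      left_inv := fun _ => rfl
      right_inv := fun _ => rfl } fun _ => rfl

/-- The tensor power of a dilation `U : a → b e`, as a dilation `aⁿ → bⁿ eⁿ`. -/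
def dilationPow (U : Matrix (b × e) a ℂ) (n : ℕ) :
    Matrix ((Fin n → b) × (Fin n → e)) (Fin n → a) ℂ :=
  (tpow U n).submatrix (Equiv.arrowProdEquivProdArrow (Fin n) (fun _ => b) (fun _ => e)).symm
    (Equiv.refl _)

omit [Fintype a] in
theorem conjTranspose_submatrix_mul_submatrix_eq_one {a' b' : Type*}
    [Fintype b] [Fintype b'] [DecidableEq a] [DecidableEq a'] {V : Matrix b a ℂ}
    (hV : Vᴴ * V = 1) (g : b' ≃ b) (g' : a' ≃ a) :
    (V.submatrix g g')ᴴ * V.submatrix g g' = 1 := by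
  rw [conjTranspose_submatrix, submatrix_mul_equiv, hV, submatrix_one_equiv]

omit [Fintype a] in
theorem dilationPow_conjTranspose_mul_self [Fintype b] [Fintype e] [DecidableEq a]
    {U : Matrix (b × e) a ℂ} (hU : Uᴴ * U = 1) (n : ℕ) : (dilationPow U n)ᴴ * dilationPow U n = 1 :=
  conjTranspose_submatrix_mul_submatrix_eq_one (tpow_conjTranspose_mul_self hU n) _ _

theorem traceSnd_mul_single_mul_conjTranspose [Fintype e] [DecidableEq a]
    (U : Matrix (b × e) a ℂ) (x y : a) (p q : b) :
    traceSnd (U * single x y (1 : ℂ) * Uᴴ) p q = ∑ k, U (p, k) x * star (U (q, k) y) := by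
  refine Finset.sum_congr rfl fun k _ => ?_
  rw [mul_apply, Finset.sum_eq_single y]
  · simp
  · intro z _ hz
    rw [mul_single_apply_of_ne _ _ _ _ _ hz, zero_mul]
  · simp

theorem tensorPower_eq_traceSnd [Fintype e] [DecidableEq a]
    {Φ : Matrix a a ℂ →ₗ[ℂ] Matrix b b ℂ} {U : Matrix (b × e) a ℂ}
    (hΦ : ∀ X, Φ X = traceSnd (U * X * Uᴴ)) (n : ℕ) (X : Matrix (Fin n → a) (Fin n → a) ℂ) :
    tensorPower Φ n X = traceSnd (dilationPow U n * X * (dilationPow U n)ᴴ) := by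
  ext p q
  have hprod : ∀ x y : Fin n → a, ∏ i, Φ (single (x i) (y i) 1) (p i) (q i) =
      ∑ k, dilationPow U n (p, k) x * star (dilationPow U n (q, k) y) := fun x y => by
    simp only [hΦ, traceSnd_mul_single_mul_conjTranspose, Fintype.prod_sum,
      Finset.prod_mul_distrib, ← star_prod]
    rfl
  simp only [tensorPower, LinearMap.coe_mk, AddHom.coe_mk, of_apply, hprod, traceSnd, mul_apply,
    conjTranspose_apply, Finset.sum_mul]
  rw [Finset.sum_comm, Finset.sum_congr rfl fun y _ => Finset.sum_comm, Finset.sum_comm]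
  exact Finset.sum_congr rfl fun k _ => Finset.sum_congr rfl fun y _ =>
    Finset.sum_congr rfl fun x _ => mul_right_comm _ _ _

end Dilation

section VecMulVec

variable {X Y : Type*} [Fintype Y]

theorem ofReal_sum_norm_sq (χ : Y → ℂ) : ((∑ y, ‖χ y‖ ^ 2 : ℝ) : ℂ) = ∑ y, χ y * star (χ y) := by
  push_cast
  exact Finset.sum_congr rfl fun y _ => by rw [← starRingEnd_apply, Complex.mul_conj']

theorem vecMulVec_mul_conjTranspose (m : X → ℂ) {χ : Y → ℂ} (hχ : IsKet χ) :
    vecMulVec m χ * (vecMulVec m χ)ᴴ = proj m := by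
  ext p q
  have hsum : ∑ y, χ y * star (χ y) = 1 := by rw [← ofReal_sum_norm_sq, hχ, Complex.ofReal_one]
  simp only [mul_apply, conjTranspose_apply, vecMulVec_apply, star_mul', proj, of_apply,
    mul_mul_mul_comm (m p) _ (star (m q)), ← Finset.mul_sum, hsum, mul_one]

theorem frobenius_norm_vecMulVec_sq [Fintype X] (m : X → ℂ) (χ : Y → ℂ) :
    ‖vecMulVec m χ‖ ^ 2 = (∑ x, ‖m x‖ ^ 2) * ∑ y, ‖χ y‖ ^ 2 := by
  simp only [frobenius_norm_sq, vecMulVec_apply, norm_mul, mul_pow, Finset.sum_mul_sum]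

end VecMulVec

section MaxEnt

theorem maxEnt_mul_maxEnt {r t : ℕ} (i i' : Fin r) (j j' : Fin t) :
    maxEnt r i i' * maxEnt t j j' =
      ((((√(Fintype.card (Fin r × Fin t)))⁻¹ : ℝ) : ℂ) • (1 : Matrix (Fin r × Fin t) _ ℂ))
        (i, j) (i', j') := by
  by_cases hi : i = i' <;> by_cases hj : j = j' <;>
    simp [maxEnt, one_apply, hi, hj, mul_comm]

/-- The ket `Φ^{R B̄} ⊗ Φ^{Â B̂}` of `targetState`. -/
def targetKet (r h : ℕ) (p : (Fin r × Fin h) × (Fin r × Fin h)) : ℂ :=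
  maxEnt r p.1.1 p.2.1 * maxEnt h p.1.2 p.2.2

theorem isKet_maxEnt {d : ℕ} (hd : 0 < d) : IsKet fun p : Fin d × Fin d => maxEnt d p.1 p.2 := by
  have hentry : ∀ i j : Fin d, ‖maxEnt d i j‖ ^ 2 = if i = j then (d : ℝ)⁻¹ else 0 := fun i j => by
    by_cases hij : i = j <;> simp [maxEnt, hij]
  have hd' : (d : ℝ) ≠ 0 := by positivity
  simp only [IsKet, Fintype.sum_prod_type, hentry, Finset.sum_ite_eq, Finset.mem_univ, if_true,
    Finset.sum_const, Finset.card_univ, Fintype.card_fin, nsmul_eq_mul, mul_inv_cancel₀ hd']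

theorem isKet_targetKet {r h : ℕ} (hr : 0 < r) (hh : 0 < h) : IsKet (targetKet r h) := by
  rw [IsKet, ← (Equiv.prodProdProdComm (Fin r) (Fin r) (Fin h) (Fin h)).sum_comp]
  calc _ = ∑ p : (Fin r × Fin r) × (Fin h × Fin h),
        ‖maxEnt r p.1.1 p.1.2‖ ^ 2 * ‖maxEnt h p.2.1 p.2.2‖ ^ 2 :=
        Finset.sum_congr rfl fun p _ => by
          rw [← mul_pow, ← norm_mul]
          rfl
    _ = (∑ p : Fin r × Fin r, ‖maxEnt r p.1 p.2‖ ^ 2) *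
        ∑ q : Fin h × Fin h, ‖maxEnt h q.1 q.2‖ ^ 2 := by
        rw [Fintype.sum_prod_type, Finset.sum_mul_sum]
    _ = 1 := by rw [isKet_maxEnt hr, isKet_maxEnt hh, one_mul]

end MaxEnt

section Protocol

variable {A' S S' B E e₁ e₂ : Type*} [Fintype A'] [Fintype S] {n r t h : ℕ}

/-- The ket of `inputState`, as a matrix with one column. -/
def inputKet (ψ : S × S' → ℂ) (n r t : ℕ) :
    Matrix ((Fin r × Fin t × (Fin n → S)) × (Fin r × Fin t × (Fin n → S'))) Unit ℂ :=
  replicateCol Unit fun p => maxEnt r p.1.1 p.2.1 * maxEnt t p.1.2.1 p.2.2.1 *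
    ∏ i, ψ (p.1.2.2 i, p.2.2.2 i)

omit [Fintype S] in
theorem inputKet_mul_conjTranspose (ψ : S × S' → ℂ) (n r t : ℕ) :
    inputKet ψ n r t * (inputKet ψ n r t)ᴴ = inputState ψ n r t := by
  ext p q
  simp [inputState, inputKet, proj, mul_apply]

/-- The rearrangement of the systems between the encoder and the channel. -/
def channelInputEquiv (A' S : Type*) (n r t h : ℕ) :
    (Fin r × Fin h × Fin t) × (Fin n → A' × S) ≃
      (Fin r × Fin t × (Fin n → S)) × ((Fin n → A') × Fin h) where
  toFun p := ((p.1.1, p.1.2.2, fun i => (p.2 i).2), (fun i => (p.2 i).1, p.1.2.1))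
  invFun p := ((p.1.1, p.2.2, p.1.2.1), fun i => (p.2.1 i, p.1.2.2 i))
  left_inv _ := rfl
  right_inv _ := rfl

/-- The rearrangement of the systems between the channel and the decoder. -/
def decoderInputEquiv (B : Type*) (n r t h : ℕ) :
    (Fin r × Fin h) × ((Fin n → B) × Fin t) ≃ (Fin r × Fin h × Fin t) × (Fin n → B) where
  toFun p := ((p.1.1, p.1.2, p.2.2), p.2.1)
  invFun p := ((p.1.1, p.1.2.1), (p.2, p.1.2.2))
  left_inv _ := rfl
  right_inv _ := rfl

/-- The ket obtained from the encoded ket `κ` by transmission through `U^{⊗ n}` followed by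
decoding with the isometry `W`. -/
def receiveKet [Fintype B] (U : Matrix (B × E) (A' × S) ℂ)
    (W : Matrix ((Fin r × Fin h) × e₂) ((Fin n → B) × Fin t) ℂ)
    (κ : Matrix ((Fin r × Fin t × (Fin n → S)) × ((Fin n → A') × Fin h)) e₁ ℂ) :
    Matrix ((Fin r × Fin h) × (Fin r × Fin h)) (e₂ × ((Fin n → E) × e₁)) ℂ :=
  pushKet W ((pushKet (dilationPow U n) (κ.submatrix (channelInputEquiv A' S n r t h)
    (Equiv.refl _))).submatrix (decoderInputEquiv B n r t h) (Equiv.refl _))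

theorem receiveKet_sub [Fintype B] (U : Matrix (B × E) (A' × S) ℂ)
    (W : Matrix ((Fin r × Fin h) × e₂) ((Fin n → B) × Fin t) ℂ)
    (κ κ' : Matrix ((Fin r × Fin t × (Fin n → S)) × ((Fin n → A') × Fin h)) e₁ ℂ) :
    receiveKet U W (κ - κ') = receiveKet U W κ - receiveKet U W κ' := by
  have hinput : (κ - κ').submatrix (channelInputEquiv A' S n r t h) (Equiv.refl _) =
      κ.submatrix (channelInputEquiv A' S n r t h) (Equiv.refl _) -
        κ'.submatrix (channelInputEquiv A' S n r t h) (Equiv.refl _) := rfl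
  rw [receiveKet, receiveKet, receiveKet, hinput, pushKet_sub, ← pushKet_sub W]
  rfl

variable [DecidableEq A'] [DecidableEq S]

theorem frobenius_norm_receiveKet [Fintype B] [DecidableEq B] [Fintype E] [Fintype e₁]
    [Fintype e₂] {U : Matrix (B × E) (A' × S) ℂ} (hU : Uᴴ * U = 1)
    {W : Matrix ((Fin r × Fin h) × e₂) ((Fin n → B) × Fin t) ℂ} (hW : Wᴴ * W = 1)
    (κ : Matrix ((Fin r × Fin t × (Fin n → S)) × ((Fin n → A') × Fin h)) e₁ ℂ) :
    ‖receiveKet U W κ‖ = ‖κ‖ := by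
  rw [receiveKet, frobenius_norm_pushKet hW, frobenius_norm_submatrix_equiv,
    frobenius_norm_pushKet (dilationPow_conjTranspose_mul_self hU n),
    frobenius_norm_submatrix_equiv]

variable [Fintype S'] [Fintype B] [Fintype E] [Fintype e₁] [Fintype e₂]
  {N : Matrix (A' × S) (A' × S) ℂ →ₗ[ℂ] Matrix B B ℂ}
  {U : Matrix (B × E) (A' × S) ℂ} (hU : IsIsometricExtension N U) (ψ : S × S' → ℂ)
include hU

theorem applySnd_receivedState_eq
    (V : Matrix (((Fin n → A') × Fin h) × e₁) (Fin r × Fin t × (Fin n → S')) ℂ)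
    (W : Matrix ((Fin r × Fin h) × e₂) ((Fin n → B) × Fin t) ℂ) :
    applySnd (dilatedChannel W) (receivedState N ψ n r t h (dilatedChannel V)) =
      receiveKet U W (pushKet V (inputKet ψ n r t)) *
        (receiveKet U W (pushKet V (inputKet ψ n r t)))ᴴ := by
  set f := channelInputEquiv A' S n r t h
  set g := decoderInputEquiv B n r t h
  have hencoded : encodedState (A' := A') ψ n r t h (dilatedChannel V) =
      (pushKet V (inputKet ψ n r t)).submatrix f (Equiv.refl _) *
        ((pushKet V (inputKet ψ n r t)).submatrix f (Equiv.refl _))ᴴ := by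
    rw [conjTranspose_submatrix, submatrix_mul_equiv, ← applySnd_mul_conjTranspose
      (Φ := dilatedChannel V) fun _ => rfl, inputKet_mul_conjTranspose]
    rfl
  have hreceived : receivedState N ψ n r t h (dilatedChannel V) =
      (applySnd (tensorPower N n) (encodedState ψ n r t h (dilatedChannel V))).submatrix g g :=
    rfl
  rw [hreceived, hencoded, applySnd_mul_conjTranspose (tensorPower_eq_traceSnd hU.2 n),
    ← submatrix_mul_equiv _ _ _ (Equiv.refl _), ← conjTranspose_submatrix,
    applySnd_mul_conjTranspose (Φ := dilatedChannel W) fun _ => rfl]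
  rfl

theorem hasCode_of_frobenius_norm_sub_le [DecidableEq S'] [DecidableEq B] (hr : 0 < r)
    (ht : 0 < t) (hh : 0 < h)
    {V : Matrix (((Fin n → A') × Fin h) × e₁) (Fin r × Fin t × (Fin n → S')) ℂ}
    (hV : Vᴴ * V = 1) {W : Matrix ((Fin r × Fin h) × e₂) ((Fin n → B) × Fin t) ℂ}
    (hW : Wᴴ * W = 1) {χ : e₂ × ((Fin n → E) × (e₁ × Unit)) → ℂ} (hχ : IsKet χ) {s : ℝ}
    (hs : s ≤ 1)
    (hclose : ‖receiveKet U W (pushKet V (inputKet ψ n r t)) - vecMulVec (targetKet r h) χ‖ ≤ s) :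
    HasCode N ψ n r t h (3 * s) := by
  refine ⟨hr, ht, hh, dilatedChannel V, dilatedChannel W, isChannel_dilatedChannel hV,
    isChannel_dilatedChannel hW, ?_⟩
  have htarget : targetState r h =
      vecMulVec (targetKet r h) χ * (vecMulVec (targetKet r h) χ)ᴴ := by
    rw [vecMulVec_mul_conjTranspose _ hχ]
    rfl
  rw [applySnd_receivedState_eq hU, htarget]
  refine (traceNorm_mul_conjTranspose_sub_le _ _).trans ?_
  set Ω := receiveKet U W (pushKet V (inputKet ψ n r t))
  set τ := vecMulVec (targetKet r h) χ
  have hτ : ‖τ‖ = 1 := by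
    rw [← pow_left_inj₀ (norm_nonneg _) zero_le_one two_ne_zero, frobenius_norm_vecMulVec_sq,
      isKet_targetKet hr hh, hχ, one_mul, one_pow]
  have hΩ : ‖Ω‖ ≤ s + 1 := by
    calc ‖Ω‖ ≤ ‖Ω - τ‖ + ‖τ‖ := norm_le_norm_sub_add _ _
      _ ≤ s + 1 := add_le_add hclose hτ.le
  nlinarith [norm_nonneg (Ω - τ)]

end Protocol

section Discard

variable {a b c r : Type*} [Fintype a] [DecidableEq a] [Fintype b] [DecidableEq b] [Fintype c]
  [DecidableEq c]

theorem IsContraction.kronecker_one {U : Matrix a a ℂ} (hU : IsContraction U) :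
    IsContraction (U ⊗ₖ (1 : Matrix b b ℂ)) := by
  have hsub : (1 : Matrix (a × b) (a × b) ℂ) - (U ⊗ₖ (1 : Matrix b b ℂ))ᴴ * (U ⊗ₖ 1) =
      (1 - Uᴴ * U) ⊗ₖ (1 : Matrix b b ℂ) := by
    rw [conjTranspose_kronecker, ← mul_kronecker_mul, conjTranspose_one, Matrix.one_mul,
      ← one_kronecker_one]
    ext p q
    simp only [Matrix.sub_apply, kroneckerMap_apply, sub_mul]
  rw [IsContraction, hsub]
  exact hU.kronecker PosSemidef.one

theorem IsContraction.submatrix_equiv {U : Matrix a a ℂ} (hU : IsContraction U) (e : c ≃ a) :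
    IsContraction (U.submatrix e e) := by
  have hsub : (1 : Matrix c c ℂ) - (U.submatrix e e)ᴴ * U.submatrix e e =
      (1 - Uᴴ * U).submatrix e e := by
    rw [conjTranspose_submatrix, submatrix_mul_equiv, ← submatrix_one_equiv e]
    rfl
  rw [IsContraction, hsub]
  exact hU.submatrix e

omit [DecidableEq b] in
theorem traceNorm_traceSnd_submatrix_le (e : a × b ≃ c) (X : Matrix c c ℂ) :
    traceNorm (traceSnd (X.submatrix e e)) ≤ traceNorm X := by
  classical
  refine traceNorm_le_of_norm_trace_mul_le fun U hU => ?_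
  have hU' := (hU.kronecker_one (b := b)).submatrix_equiv e.symm
  have htrace : (U * traceSnd (X.submatrix e e)).trace =
      ((U ⊗ₖ (1 : Matrix b b ℂ)).submatrix e.symm e.symm * X).trace := by
    have hreindex : (U ⊗ₖ (1 : Matrix b b ℂ)).submatrix e.symm e.symm * X =
        ((U ⊗ₖ (1 : Matrix b b ℂ)) * X.submatrix e e).submatrix e.symm e.symm := by
      rw [← submatrix_mul_equiv _ _ _ e.symm, submatrix_submatrix, e.self_comp_symm,
        submatrix_id_id]
    rw [hreindex, trace_mul_comm, ← trace_mul_kronecker_one, trace_mul_comm]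
    exact (e.symm.sum_comp _).symm
  rw [htrace]
  exact hU'.norm_trace_mul_le_traceNorm X

/-- The partial trace over `b`, with a one-dimensional system left in its place. -/
def discard (a b : Type*) [Fintype a] [Fintype b] [DecidableEq a] [DecidableEq b] :
    Matrix (a × b) (a × b) ℂ →ₗ[ℂ] Matrix (a × Fin 1) (a × Fin 1) ℂ :=
  dilatedChannel ((1 : Matrix (a × b) (a × b) ℂ).submatrix (fun p => (p.1.1, p.2)) id)

theorem discard_apply (X : Matrix (a × b) (a × b) ℂ) (p q : a × Fin 1) :
    discard a b X p q = ∑ k, X (p.1, k) (q.1, k) := by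
  simp [discard, dilatedChannel, traceSnd, mul_apply, one_apply]

theorem isChannel_discard : IsChannel (discard a b) := by
  let e : (a × Fin 1) × b ≃ a × b := (Equiv.prodUnique a (Fin 1)).prodCongr (Equiv.refl b)
  have hone : (1 : Matrix (a × b) (a × b) ℂ)ᴴ * 1 = 1 := by
    rw [conjTranspose_one, Matrix.one_mul]
  exact isChannel_dilatedChannel
    (conjTranspose_submatrix_mul_submatrix_eq_one hone e (Equiv.refl _))

end Discard

section Discard

variable {A' S S' B : Type*} [Fintype A'] [DecidableEq A'] [Fintype S] [DecidableEq S]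
  {n r t h : ℕ}

/-- The rearrangement separating the message systems `R B̄` from the entanglement `Â B̂`. -/
def messageEquiv (r h : ℕ) :
    ((Fin r × Fin 1) × (Fin r × Fin 1)) × (Fin h × Fin h) ≃
      (Fin r × Fin h) × (Fin r × Fin h) where
  toFun p := ((p.1.1.1, p.2.1), (p.1.2.1, p.2.2))
  invFun p := (((p.1.1, 0), (p.2.1, 0)), (p.1.2, p.2.2))
  left_inv p := by ext <;> simp
  right_inv _ := rfl

theorem receivedState_discard_comp (N : Matrix (A' × S) (A' × S) ℂ →ₗ[ℂ] Matrix B B ℂ)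
    (ψ : S × S' → ℂ)
    (enc : Matrix (Fin r × Fin t × (Fin n → S')) (Fin r × Fin t × (Fin n → S')) ℂ →ₗ[ℂ]
      Matrix ((Fin n → A') × Fin h) ((Fin n → A') × Fin h) ℂ)
    (p q : (Fin r × Fin 1) × ((Fin n → B) × Fin t)) :
    receivedState N ψ n r t 1 (discard _ _ ∘ₗ enc) p q =
      ∑ k, receivedState N ψ n r t h enc ((p.1.1, k), p.2) ((q.1.1, k), q.2) := by
  simp only [receivedState, applySnd, submatrix_apply, of_apply, encodedState]
  rw [← Matrix.sum_apply, ← map_sum]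
  refine congrArg (fun X => tensorPower N n X p.2.1 q.2.1) ?_
  ext x y
  simp only [of_apply, Matrix.sum_apply, LinearMap.comp_apply, discard_apply]

theorem applySnd_discard_comp
    (dec : Matrix ((Fin n → B) × Fin t) ((Fin n → B) × Fin t) ℂ →ₗ[ℂ]
      Matrix (Fin r × Fin h) (Fin r × Fin h) ℂ)
    {X : Matrix ((Fin r × Fin h) × ((Fin n → B) × Fin t)) _ ℂ}
    {X' : Matrix ((Fin r × Fin 1) × ((Fin n → B) × Fin t)) _ ℂ}
    (hX : ∀ p q, X' p q = ∑ k, X ((p.1.1, k), p.2) ((q.1.1, k), q.2)) :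
    applySnd (discard _ _ ∘ₗ dec) X' =
      traceSnd ((applySnd dec X).submatrix (messageEquiv r h) (messageEquiv r h)) := by
  ext p q
  have hblock : (Matrix.of fun x y => X' (p.1, x) (q.1, y)) =
      ∑ k, Matrix.of fun x y => X ((p.1.1, k), x) ((q.1.1, k), y) := by
    ext x y
    simp only [of_apply, hX, Matrix.sum_apply]
  simp only [applySnd, of_apply, hblock, LinearMap.comp_apply, discard_apply, map_sum,
    Matrix.sum_apply, traceSnd, Fintype.sum_prod_type, submatrix_apply]
  exact Finset.sum_comm

theorem traceSnd_targetState (hh : 0 < h) :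
    traceSnd ((targetState r h).submatrix (messageEquiv r h) (messageEquiv r h)) =
      targetState r 1 := by
  have hnorm : ∑ k : Fin h × Fin h, maxEnt h k.1 k.2 * star (maxEnt h k.1 k.2) = 1 := by
    rw [← ofReal_sum_norm_sq, isKet_maxEnt hh, Complex.ofReal_one]
  ext p q
  have hterm : ∀ k : Fin h × Fin h,
      (targetState r h).submatrix (messageEquiv r h) (messageEquiv r h) (p, k) (q, k) =
        maxEnt r p.1.1 p.2.1 * star (maxEnt r q.1.1 q.2.1) *
          (maxEnt h k.1 k.2 * star (maxEnt h k.1 k.2)) := fun k => by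
    simp only [targetState, proj, messageEquiv, submatrix_apply, of_apply,
      Equiv.coe_fn_mk, star_mul']
    ring
  rw [traceSnd, of_apply, Finset.sum_congr rfl fun k _ => hterm k, ← Finset.mul_sum, hnorm]
  simp [targetState, proj, maxEnt, Subsingleton.elim _ (0 : Fin 1)]

theorem HasCode.discard_entanglement [Fintype S'] [DecidableEq S'] [Fintype B]
    [DecidableEq B] {N : Matrix (A' × S) (A' × S) ℂ →ₗ[ℂ] Matrix B B ℂ}
    {ψ : S × S' → ℂ} {ε : ℝ} (hcode : HasCode N ψ n r t h ε) : HasCode N ψ n r t 1 ε := by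
  obtain ⟨hr, ht, hh, enc, dec, henc, hdec, hε⟩ := hcode
  refine ⟨hr, ht, one_pos, discard _ _ ∘ₗ enc, discard _ _ ∘ₗ dec, isChannel_discard.comp henc,
    isChannel_discard.comp hdec, le_trans ?_ hε⟩
  rw [applySnd_discard_comp dec (receivedState_discard_comp N ψ enc), ← traceSnd_targetState hh]
  set Y := applySnd dec (receivedState N ψ n r t h enc)
  have hsub : ∀ Z W : Matrix _ _ ℂ, traceSnd (Z.submatrix (messageEquiv r h) (messageEquiv r h)) -
      traceSnd (W.submatrix (messageEquiv r h) (messageEquiv r h)) =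
      traceSnd ((Z - W).submatrix (messageEquiv r h) (messageEquiv r h)) := fun Z W => by
    ext p q
    simp [traceSnd, Finset.sum_sub_distrib]
  rw [hsub]
  exact traceNorm_traceSnd_submatrix_le _ _

end Discard

section Regroup

variable {X Y X' Y' : Type*}

/-- The ket `M` on `X' Y'` with its systems redistributed over the cut `X | Y` along `e`. -/
def regroup (e : X × Y ≃ X' × Y') (M : Matrix X' Y' ℂ) : Matrix X Y ℂ :=
  Matrix.of fun p q => M (e (p, q)).1 (e (p, q)).2

theorem regroup_sub (e : X × Y ≃ X' × Y') (M M' : Matrix X' Y' ℂ) :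
    regroup e (M - M') = regroup e M - regroup e M' := rfl

theorem frobenius_norm_regroup [Fintype X] [Fintype Y] [Fintype X'] [Fintype Y']
    (e : X × Y ≃ X' × Y') (M : Matrix X' Y' ℂ) : ‖regroup e M‖ = ‖M‖ :=
  frobenius_norm_eq_of_equiv e fun _ => rfl

end Regroup

section OneShot

/-- The randomizing system `R B̃ Â`, cut as `R B̃ | Â` for decoupling from the side information. -/
def sideCut (r t h : ℕ) : Fin r × Fin t × Fin h ≃ (Fin r × Fin t) × Fin h :=
  (Equiv.prodAssoc _ _ _).symm

/-- The randomizing system `R B̃ Â`, cut as `R Â | B̃` for decoupling from the environment. -/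
def environmentCut (r t h : ℕ) : Fin r × Fin t × Fin h ≃ (Fin r × Fin h) × Fin t where
  toFun p := ((p.1, p.2.2), p.2.1)
  invFun p := (p.1.1, p.2, p.1.2)
  left_inv _ := rfl
  right_inv _ := rfl

variable {A' S S' B E D L o : Type*} {n r t h : ℕ}

/-- The output `A'ⁿ Â Dⁿ O` of the encoder, cut as `Â (A' D)ⁿ | O`. -/
def encoderOutputEquiv (A' D o : Type*) (n h : ℕ) :
    ((Fin n → A') × Fin h) × ((Fin n → D) × o) ≃ (Fin h × (Fin n → A' × D)) × o where
  toFun p := ((p.1.2, fun i => (p.1.1 i, p.2.1 i)), p.2.2)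
  invFun p := ((fun i => (p.1.2 i).1, p.1.1), (fun i => (p.1.2 i).2, p.2))
  left_inv _ := rfl
  right_inv _ := rfl

/-- The systems after the encoder, with `R B̃ Sⁿ` on one side of the cut. -/
def encodedEquiv (A' S D o : Type*) (n r t h : ℕ) :
    ((Fin r × Fin t × (Fin n → S)) × ((Fin n → A') × Fin h)) × (((Fin n → D) × o) × Unit) ≃
      ((Fin r × Fin t) × (Fin n → S)) × ((Fin h × (Fin n → A' × D)) × o) where
  toFun p := (((p.1.1.1, p.1.1.2.1), p.1.1.2.2),
    ((p.1.2.2, fun i => (p.1.2.1 i, p.2.1.1 i)), p.2.1.2))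
  invFun p := (((p.1.1.1, p.1.1.2, p.1.2), (fun i => (p.2.1.2 i).1, p.2.1.1)),
    ((fun i => (p.2.1.2 i).2, p.2.2), ()))
  left_inv _ := rfl
  right_inv _ := rfl

/-- The systems after the decoder, with `R Â` and the environment `(E D)ⁿ` on one side of the
cut. -/
def decodedEquiv (E D m q o₁ o₂ : Type*) (n : ℕ) :
    (m × m) × ((q × o₂) × ((Fin n → E) × (((Fin n → D) × o₁) × Unit))) ≃
      (m × (Fin n → E × D)) × (((m × q) × o₂) × o₁) where
  toFun p := ((p.1.1, fun i => (p.2.2.1 i, p.2.2.2.1.1 i)),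
    (((p.1.2, p.2.1.1), p.2.1.2), p.2.2.2.1.2))
  invFun p := ((p.1.1, p.2.1.1.1),
    ((p.2.1.1.2, p.2.1.2), (fun i => (p.1.2 i).1, ((fun i => (p.1.2 i).2, p.2.2), ()))))
  left_inv _ := rfl
  right_inv _ := rfl

/-- The source ket `Φ^{RR'} ⊗ Φ^{B̃Ã} ⊗ ψ^{⊗ n}` of `inputState`, with `R B̃ Sⁿ` on one side of
the cut. -/
def sourceKet (ψ : S × S' → ℂ) (n r t : ℕ) :
    Matrix ((Fin r × Fin t) × (Fin n → S)) (Fin r × Fin t × (Fin n → S')) ℂ :=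
  Matrix.of fun p y => inputKet ψ n r t ((p.1.1, p.1.2, p.2), y) ()

theorem sourceKet_eq_submatrix (ψ : S × S' → ℂ) (n r t : ℕ) :
    sourceKet ψ n r t =
      (((((√(Fintype.card (Fin r × Fin t)))⁻¹ : ℝ) : ℂ) •
        (1 : Matrix (Fin r × Fin t) (Fin r × Fin t) ℂ)) ⊗ₖ
          tpow (Matrix.of (Function.curry ψ)) n).submatrix (Equiv.refl _)
            (Equiv.prodAssoc _ _ _).symm := by
  ext p q
  rw [sourceKet, of_apply, inputKet, replicateCol_apply, maxEnt_mul_maxEnt]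
  rfl

theorem traceSnd_proj {X Y : Type*} [Fintype Y] (v : X × Y → ℂ) :
    traceSnd (proj v) = Matrix.of (Function.curry v) * (Matrix.of (Function.curry v))ᴴ := rfl

theorem sourceKet_mul_conjTranspose [Fintype S'] [Fintype L] {Z : Type*} [Fintype Z]
    {ψ : S × S' → ℂ} {φ : Matrix (L × (Fin n → S)) Z ℂ}
    (hφ : sideKet φ * (sideKet φ)ᴴ = tpow (traceSnd (proj ψ)) n) :
    sourceKet ψ n r t * (sourceKet ψ n r t)ᴴ = refState (Fin r × Fin t) φ := by
  rw [sourceKet_eq_submatrix, conjTranspose_submatrix, submatrix_mul_equiv,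
    smul_one_kronecker_mul_conjTranspose, refState, hφ, traceSnd_proj, tpow_mul, tpow_conjTranspose]
  rfl

theorem frobenius_norm_inputKet [Fintype S] [Fintype S'] (hr : 0 < r) (ht : 0 < t)
    {ψ : S × S' → ℂ} (hψ : IsKet ψ) (n : ℕ) : ‖inputKet ψ n r t‖ = 1 := by
  have : Nonempty (Fin r × Fin t) := ⟨⟨0, hr⟩, ⟨0, ht⟩⟩
  have hsource : ‖inputKet ψ n r t‖ = ‖sourceKet ψ n r t‖ :=
    frobenius_norm_eq_of_equiv
      { toFun := fun p => (((p.1.1.1, p.1.1.2.1), p.1.1.2.2), p.1.2)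
        invFun := fun p => (((p.1.1.1, p.1.1.2, p.1.2), p.2), ())
        left_inv := fun _ => rfl
        right_inv := fun _ => rfl } fun _ => rfl
  have hcurry : ‖Matrix.of (Function.curry ψ)‖ = 1 := by
    rw [← pow_left_inj₀ (norm_nonneg _) zero_le_one two_ne_zero, one_pow, frobenius_norm_sq, ← hψ,
      Fintype.sum_prod_type]
    rfl
  rw [hsource, sourceKet_eq_submatrix, frobenius_norm_submatrix_equiv,
    frobenius_norm_smul_one_kronecker, frobenius_norm_tpow, hcurry, one_pow]

variable [Fintype A'] [Fintype S]

/-- The purifying systems `(A' D)ⁿ` of a ket on `L Sⁿ (A' D)ⁿ` sent through `U^{⊗ n}` together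
with `Sⁿ`, giving a ket on `L (E D)ⁿ Bⁿ`. -/
def channelOutput (U : Matrix (B × E) (A' × S) ℂ)
    (φ : Matrix (L × (Fin n → S)) (Fin n → A' × D) ℂ) :
    Matrix (L × (Fin n → E × D)) (Fin n → B) ℂ :=
  Matrix.of fun p b => ∑ y : Fin n → A' × S, dilationPow U n (b, fun i => (p.2 i).1) y *
    φ (p.1, fun i => (y i).2) fun i => ((y i).1, (p.2 i).2)

theorem codedKet_channelOutput [Fintype L] (U : Matrix (B × E) (A' × S) ℂ)
    (φ : Matrix (L × (Fin n → S)) (Fin n → A' × D) ℂ) (V : Matrix (Fin r × Fin t × Fin h) L ℂ)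
    (i : Fin r) (j : Fin h) (x : Fin n → E × D) (k : Fin t) (b : Fin n → B) :
    codedKet (environmentCut r t h) V (channelOutput U φ) ((i, j), x) (k, b) =
      ∑ y : Fin n → A' × S, dilationPow U n (b, fun i => (x i).1) y *
        codedKet (sideCut r t h) V φ ((i, k), fun i => (y i).2)
          (j, fun i => ((y i).1, (x i).2)) := by
  simp only [codedKet, of_apply, channelOutput, Finset.mul_sum]
  rw [Finset.sum_comm]
  exact Finset.sum_congr rfl fun y _ => Finset.sum_congr rfl fun l _ => mul_left_comm _ _ _

/-- The isometry `T` of Uhlmann's theorem, read as an encoding isometry. -/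
def encoder (T : Matrix (Fin r × Fin t × (Fin n → S')) ((Fin h × (Fin n → A' × D)) × o) ℂ) :
    Matrix (((Fin n → A') × Fin h) × ((Fin n → D) × o)) (Fin r × Fin t × (Fin n → S')) ℂ :=
  Tᵀ.submatrix (encoderOutputEquiv A' D o n h) (Equiv.refl _)

/-- The isometry `T` of Uhlmann's theorem, read as a decoding isometry. -/
def decoder {m q : Type*} (T : Matrix (Fin t × (Fin n → B)) ((m × q) × o) ℂ) :
    Matrix (m × (q × o)) ((Fin n → B) × Fin t) ℂ :=
  Tᵀ.submatrix (Equiv.prodAssoc m q o).symm (Equiv.prodComm (Fin n → B) (Fin t))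

theorem transpose_conjTranspose_mul_self {X Y : Type*} [Fintype Y] [DecidableEq X]
    {T : Matrix X Y ℂ} (hT : T * Tᴴ = 1) : Tᵀᴴ * Tᵀ = 1 := by
  have hcomm : Tᵀᴴ = Tᴴᵀ := rfl
  rw [hcomm, ← transpose_mul, hT, transpose_one]

omit [Fintype A'] [Fintype S] in
theorem pushKet_encoder [Fintype S'] (ψ : S × S' → ℂ)
    (T : Matrix (Fin r × Fin t × (Fin n → S')) ((Fin h × (Fin n → A' × D)) × o) ℂ) :
    pushKet (encoder T) (inputKet ψ n r t) =
      regroup (encodedEquiv A' S D o n r t h) (sourceKet ψ n r t * T) := by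
  ext p q
  exact Finset.sum_congr rfl fun z _ => mul_comm _ _

theorem receiveKet_decoder [Fintype B] {q P : Type*} (U : Matrix (B × E) (A' × S) ℂ)
    {κ : Matrix ((Fin r × Fin t) × (Fin n → S)) (Fin h × (Fin n → A' × D)) ℂ}
    {ω : Matrix ((Fin r × Fin h) × (Fin n → E × D)) (Fin t × (Fin n → B)) ℂ}
    (hω : ∀ i j x k b, ω ((i, j), x) (k, b) =
      ∑ y : Fin n → A' × S, dilationPow U n (b, fun i => (x i).1) y *
        κ ((i, k), fun i => (y i).2) (j, fun i => ((y i).1, (x i).2)))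
    (T : Matrix (Fin t × (Fin n → B)) (((Fin r × Fin h) × q) × o) ℂ) :
    receiveKet U (decoder T) (regroup (encodedEquiv A' S D (Option P) n r t h) (padNone P κ)) =
      regroup (decodedEquiv E D (Fin r × Fin h) q (Option P) o n) (padNone P (ω * T)) := by
  ext ⟨⟨i, j⟩, m⟩ ⟨⟨l, o₂⟩, ⟨e, ⟨⟨d, o₁⟩, ⟨⟩⟩⟩⟩
  have hentry : receiveKet U (decoder T)
      (regroup (encodedEquiv A' S D (Option P) n r t h) (padNone P κ)) ((i, j), m)
        ((l, o₂), (e, ((d, o₁), ()))) =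
      ∑ c : (Fin n → B) × Fin t, T (c.2, c.1) ((m, l), o₂) *
        ∑ y : Fin n → A' × S, dilationPow U n (c.1, e) y *
          if o₁ = none then κ ((i, c.2), fun i => (y i).2) (j, fun i => ((y i).1, d i)) else 0 :=
    rfl
  rw [hentry, ← (Equiv.prodComm (Fin t) (Fin n → B)).sum_comp, regroup, of_apply, padNone, of_apply]
  simp only [decodedEquiv, Equiv.coe_fn_mk, mul_apply]
  split_ifs with ho
  · refine Finset.sum_congr rfl fun c _ => ?_
    rw [mul_comm, hω]
    rfl
  · simp only [mul_zero, Finset.sum_const_zero]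

/-- The state of the systems other than `R Â B̄ B̂` left by a perfect decoder. -/
def residualKet {B' : Type*} (P P' : Type*) (θ : Matrix (L × (Fin n → E × D)) B' ℂ) :
    ((L × B') × Option P') × ((Fin n → E) × (((Fin n → D) × Option P) × Unit)) → ℂ := fun x =>
  padNone P (padNone P' (sideKet θ)) (fun i => (x.2.1 i, x.2.2.1.1 i)) (x.1, x.2.2.1.2)

omit [Fintype A'] [Fintype S] in
theorem regroup_refKet {B' : Type*} (P P' : Type*) (θ : Matrix (L × (Fin n → E × D)) B' ℂ) :
    regroup (decodedEquiv E D (Fin r × Fin h) (L × B') (Option P) (Option P') n)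
        (padNone P (padNone P' (refKet (Fin r × Fin h) θ))) =
      vecMulVec (targetKet r h) (residualKet P P' θ) := by
  ext m x
  rw [vecMulVec_apply, targetKet, maxEnt_mul_maxEnt, residualKet]
  simp only [regroup, decodedEquiv, padNone, refKet, of_apply, Equiv.coe_fn_mk, kroneckerMap_apply,
    mul_ite, mul_zero]

theorem isKet_residualKet {B' : Type*} [Fintype L] [Fintype E] [Fintype D] [Fintype B']
    {P P' : Type*} [Fintype P] [Fintype P']
    (hr : 0 < r) (hh : 0 < h) {θ : Matrix (L × (Fin n → E × D)) B' ℂ} (hθ : ‖θ‖ = 1) :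
    IsKet (residualKet P P' θ) := by
  have : Nonempty (Fin r × Fin h) := ⟨⟨0, hr⟩, ⟨0, hh⟩⟩
  have hnorm : ‖vecMulVec (targetKet r h) (residualKet P P' θ)‖ = 1 := by
    rw [← regroup_refKet, frobenius_norm_regroup, frobenius_norm_padNone, frobenius_norm_padNone,
      frobenius_norm_refKet, hθ]
  have hsq := frobenius_norm_vecMulVec_sq (targetKet r h) (residualKet P P' θ)
  rw [hnorm, isKet_targetKet hr hh, one_pow, one_mul] at hsq
  exact hsq.symm

theorem hasCode_of_traceNorm_codedKet_sub_refState_le [Fintype S'] [Fintype B] [Fintype E]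
    [Fintype D] [Fintype L] [DecidableEq A'] [DecidableEq S] [DecidableEq S'] [DecidableEq B]
    [DecidableEq E] [DecidableEq D]
    [Nonempty A'] [Nonempty B] [Nonempty D] [Nonempty L]
    {N : Matrix (A' × S) (A' × S) ℂ →ₗ[ℂ] Matrix B B ℂ} {U : Matrix (B × E) (A' × S) ℂ}
    (hU : IsIsometricExtension N U) {ψ : S × S' → ℂ} (hr : 0 < r) (ht : 0 < t) (hh : 0 < h)
    {φ : Matrix (L × (Fin n → S)) (Fin n → A' × D) ℂ}
    (hφ : sideKet φ * (sideKet φ)ᴴ = tpow (traceSnd (proj ψ)) n) (hθ : ‖channelOutput U φ‖ = 1)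
    {V : Matrix (Fin r × Fin t × Fin h) L ℂ} {s₁ s₂ : ℝ} (hs₁ : 0 ≤ s₁) (hs₂ : 0 ≤ s₂)
    (hs : s₁ + s₂ ≤ 1)
    (hside : traceNorm (codedKet (sideCut r t h) V φ * (codedKet (sideCut r t h) V φ)ᴴ -
      refState (Fin r × Fin t) φ) ≤ s₁ ^ 2)
    (henv : traceNorm (codedKet (environmentCut r t h) V (channelOutput U φ) *
      (codedKet (environmentCut r t h) V (channelOutput U φ))ᴴ -
        refState (Fin r × Fin h) (channelOutput U φ)) ≤ s₂ ^ 2) :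
    HasCode N ψ n r t h (3 * (s₁ + s₂)) := by
  have : Nonempty (Fin r) := ⟨⟨0, hr⟩⟩
  have : Nonempty (Fin h) := ⟨⟨0, hh⟩⟩
  set θ := channelOutput U φ
  set κ := codedKet (sideCut r t h) V φ
  set ω := codedKet (environmentCut r t h) V θ
  rw [← traceNorm_neg, neg_sub, ← sourceKet_mul_conjTranspose hφ] at hside
  rw [← refKet_mul_conjTranspose] at henv
  obtain ⟨T, hT, hTclose⟩ := exists_isometry_frobenius_norm_sub_padNone_sq_le
    (sourceKet ψ n r t) κ
  obtain ⟨T', hT', hTclose'⟩ := exists_isometry_frobenius_norm_sub_padNone_sq_le ω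
    (refKet (Fin r × Fin h) θ)
  have hW : (decoder T')ᴴ * decoder T' = 1 :=
    conjTranspose_submatrix_mul_submatrix_eq_one (transpose_conjTranspose_mul_self hT') _ _
  set σ := regroup (encodedEquiv A' S D _ n r t h) (padNone (Fin r × Fin t × (Fin n → S')) κ)
  have hencoded : ‖pushKet (encoder T) (inputKet ψ n r t) - σ‖ ≤ s₁ := by
    rw [pushKet_encoder, ← regroup_sub, frobenius_norm_regroup]
    exact le_of_sq_le_sq (hTclose.trans hside) hs₁
  have hdecoded : ‖receiveKet U (decoder T') σ - vecMulVec (targetKet r h)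
      (residualKet (Fin r × Fin t × (Fin n → S')) (Fin t × (Fin n → B)) θ)‖ ≤ s₂ := by
    rw [receiveKet_decoder U (codedKet_channelOutput U φ V), ← regroup_refKet, ← regroup_sub,
      frobenius_norm_regroup, ← padNone_sub, frobenius_norm_padNone]
    exact le_of_sq_le_sq (hTclose'.trans henv) hs₂
  have hreceived : ‖receiveKet U (decoder T') (pushKet (encoder T) (inputKet ψ n r t)) -
      vecMulVec (targetKet r h)
        (residualKet (Fin r × Fin t × (Fin n → S')) (Fin t × (Fin n → B)) θ)‖ ≤ s₁ + s₂ := by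
    refine (norm_sub_le_norm_sub_add_norm_sub _ (receiveKet U (decoder T') σ) _).trans
      (add_le_add ?_ hdecoded)
    rwa [← receiveKet_sub, frobenius_norm_receiveKet hU.1 hW]
  exact hasCode_of_frobenius_norm_sub_le hU ψ hr ht hh
    (conjTranspose_submatrix_mul_submatrix_eq_one (transpose_conjTranspose_mul_self hT) _ _) hW
    (isKet_residualKet hr hh hθ) hs hreceived

end OneShot

section Coding

variable {A A' S S' B E D : Type*}

/-- The purification of `σ` as a ket with `A S` on one side of the cut and `A' D` on the other. -/
def senderKet (v : (A × A' × S) × D → ℂ) : Matrix (A × S) (A' × D) ℂ :=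
  Matrix.of fun p z => v ((p.1, z.1, p.2), z.2)

variable [Fintype A'] [Fintype S]

/-- The ket `outputKet U v` with `A E D` on one side of the cut and `B` on the other. -/
def receiverKet (U : Matrix (B × E) (A' × S) ℂ) (v : (A × A' × S) × D → ℂ) :
    Matrix (A × (E × D)) B ℂ :=
  Matrix.of fun p b => outputKet U v (b, p)

theorem channelOutput_ketPow (U : Matrix (B × E) (A' × S) ℂ) (v : (A × A' × S) × D → ℂ) (n : ℕ) :
    channelOutput U (ketPow (senderKet v) n) = ketPow (receiverKet U v) n := by
  ext p b
  simp only [channelOutput, ketPow, dilationPow, tpow, senderKet, receiverKet, outputKet, of_apply,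
    submatrix_apply, ← Finset.prod_mul_distrib]
  rw [Fintype.prod_sum]
  rfl

variable [Fintype A] [Fintype D]

theorem frobenius_norm_senderKet (v : (A × A' × S) × D → ℂ) :
    ‖senderKet v‖ = ‖Matrix.of (Function.curry v)‖ :=
  frobenius_norm_eq_of_equiv
    { toFun := fun p => ((p.1.1, p.2.1, p.1.2), p.2.2)
      invFun := fun p => ((p.1.1, p.1.2.2), (p.1.2.1, p.2))
      left_inv := fun _ => rfl
      right_inv := fun _ => rfl } fun _ => rfl

theorem frobenius_norm_receiverKet [Fintype B] [Fintype E] [DecidableEq A'] [DecidableEq S]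
    {U : Matrix (B × E) (A' × S) ℂ} (hU : Uᴴ * U = 1) (v : (A × A' × S) × D → ℂ) :
    ‖receiverKet U v‖ = ‖senderKet v‖ := by
  rw [frobenius_norm_senderKet, ← frobenius_norm_pushKet hU]
  exact frobenius_norm_eq_of_equiv
    { toFun := fun p => ((p.1.1, p.2), p.1.2)
      invFun := fun p => ((p.1.1, p.2), p.1.2)
      left_inv := fun _ => rfl
      right_inv := fun _ => rfl } fun _ => rfl

theorem sideKet_ketPow_mul_conjTranspose {X Z : Type*} [Fintype Z] (w : Matrix (A × X) Z ℂ)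
    (n : ℕ) :
    sideKet (ketPow w n) * (sideKet (ketPow w n))ᴴ = tpow (sideKet w * (sideKet w)ᴴ) n := by
  rw [sideKet_ketPow, conjTranspose_submatrix, submatrix_mul_equiv, tpow_mul, tpow_conjTranspose]
  rfl

theorem nonempty_of_frobenius_norm_eq_one {X Y : Type*} [Fintype X] [Fintype Y]
    {M : Matrix X Y ℂ} (hM : ‖M‖ = 1) : Nonempty (X × Y) := by
  by_contra hempty
  rw [not_nonempty_iff] at hempty
  have hsq := frobenius_norm_sq M
  rw [hM, ← Fintype.sum_prod_type', Finset.univ_eq_empty, Finset.sum_empty, one_pow] at hsq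
  exact one_ne_zero hsq

variable [Fintype S'] [Fintype B] [Fintype E] [DecidableEq A'] [DecidableEq S] [DecidableEq S']
  [DecidableEq B]

omit [Fintype A] [Fintype D] [Fintype E] in
theorem HasCode.mono {N : Matrix (A' × S) (A' × S) ℂ →ₗ[ℂ] Matrix B B ℂ} {ψ : S × S' → ℂ}
    {n r t h : ℕ} {ε ε' : ℝ} (hcode : HasCode N ψ n r t h ε) (hε : ε ≤ ε') :
    HasCode N ψ n r t h ε' := by
  obtain ⟨hr, ht, hh, enc, dec, henc, hdec, herror⟩ := hcode
  exact ⟨hr, ht, hh, enc, dec, henc, hdec, herror.trans hε⟩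

variable [DecidableEq A] [DecidableEq E] [DecidableEq D]

theorem eventually_hasCode {N : Matrix (A' × S) (A' × S) ℂ →ₗ[ℂ] Matrix B B ℂ}
    {U : Matrix (B × E) (A' × S) ℂ} (hU : IsIsometricExtension N U) {ψ : S × S' → ℂ}
    {v : (A × A' × S) × D → ℂ} (hv : ‖senderKet v‖ = 1)
    (hψ : sideKet (senderKet v) * (sideKet (senderKet v))ᴴ = traceSnd (proj ψ))
    {δ ε : ℝ} (hδ : 0 < δ) (hε : 0 < ε) :
    ∀ᶠ n : ℕ in atTop, ∀ r t h : ℕ, 0 < r → 0 < t → 0 < h →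
      ((r * t : ℕ) : ℝ) ≤ h * 2 ^ (n * (condEntropy (senderKet v) - δ)) →
      ((r * h : ℕ) : ℝ) ≤ t * 2 ^ (n * (condEntropy (receiverKet U v) - δ)) →
      HasCode N ψ n r t h ε := by
  have hv' : ‖receiverKet U v‖ = 1 := (frobenius_norm_receiverKet hU.1 v).trans hv
  obtain ⟨⟨a, -⟩, ⟨a', d⟩⟩ := nonempty_of_frobenius_norm_eq_one hv
  obtain ⟨-, b⟩ := nonempty_of_frobenius_norm_eq_one hv'
  have : Nonempty A := ⟨a⟩
  have : Nonempty A' := ⟨a'⟩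
  have : Nonempty D := ⟨d⟩
  have : Nonempty B := ⟨b⟩
  obtain ⟨u, hu, huε⟩ : ∃ u : ℝ, 0 < u ∧ u ≤ min (ε / 6) (1 / 2) :=
    ⟨_, by positivity, le_rfl⟩
  have hu_half : u ≤ 1 / 2 := huε.trans (min_le_right _ _)
  have hu_sixth : u ≤ ε / 6 := huε.trans (min_le_left _ _)
  have hu_sq : 0 < u ^ 2 / 2 := by positivity
  filter_upwards [eventually_expect_traceNorm_codedKet_sub_refState_le hv hδ hu_sq,
    eventually_expect_traceNorm_codedKet_sub_refState_le hv' hδ hu_sq] with n hside henv r t h hr ht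
      hh hrt hrh
  have : Nonempty (Fin r) := ⟨⟨0, hr⟩⟩
  have : Nonempty (Fin t) := ⟨⟨0, ht⟩⟩
  have : Nonempty (Fin h) := ⟨⟨0, hh⟩⟩
  have hsum := add_le_add (hside _ _ _ (sideCut r t h) (by simpa using hrt))
    (henv _ _ _ (environmentCut r t h) (by simpa using hrh))
  rw [← Finset.expect_add_distrib, add_halves] at hsum
  obtain ⟨phases, -, hphases⟩ := Finset.exists_le_of_expect_le Finset.univ_nonempty hsum
  refine (hasCode_of_traceNorm_codedKet_sub_refState_le hU hr ht hh (V := phaseMatrix phases)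
    (φ := ketPow (senderKet v) n) ?_ ?_ hu.le hu.le (by linarith) ?_ ?_).mono
      (by linarith : 3 * (u + u) ≤ ε)
  · rw [sideKet_ketPow_mul_conjTranspose, hψ]
  · rw [channelOutput_ketPow, frobenius_norm_ketPow, hv', one_pow]
  · exact (le_add_of_nonneg_right (traceNorm_nonneg _)).trans hphases
  · rw [channelOutput_ketPow]
    exact (le_add_of_nonneg_left (traceNorm_nonneg _)).trans hphases

end Coding

section Rates

/-- From each `n` the sequence takes an element of `{c | P n c}` that minimises the distance to
`a` up to `1 / (n + 1)`. -/
theorem exists_seq_tendsto_of_forall_eventually_exists {X α : Type*} [PseudoMetricSpace X]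
    {P : ℕ → α → Prop} {f : ℕ → α → X} {a : X} (hP : ∀ n, ∃ c, P n c)
    (hf : ∀ ε > 0, ∀ᶠ n in atTop, ∃ c, P n c ∧ dist (f n c) a < ε) :
    ∃ c : ℕ → α, (∀ n, P n (c n)) ∧ Tendsto (fun n => f n (c n)) atTop (𝓝 a) := by
  have hbdd : ∀ n, BddBelow (Set.range fun c : {c // P n c} => dist (f n c) a) :=
    fun n => ⟨0, Set.forall_mem_range.2 fun _ => dist_nonneg⟩
  have hnear : ∀ n, ∃ c, P n c ∧ ∀ c', P n c' → dist (f n c) a < dist (f n c') a + 1 / (n + 1) := by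
    intro n
    have : Nonempty {c // P n c} := nonempty_subtype.2 (hP n)
    obtain ⟨c, hc⟩ := exists_lt_of_ciInf_lt
      (lt_add_of_pos_right (⨅ c : {c // P n c}, dist (f n c) a) (Nat.one_div_pos_of_nat (n := n)))
    exact ⟨c, c.2, fun c' hc' => hc.trans_le (by gcongr; exact ciInf_le (hbdd n) ⟨c', hc'⟩)⟩
  choose c hc hmin using hnear
  refine ⟨c, hc, Metric.tendsto_nhds.2 fun ε hε => ?_⟩
  filter_upwards [hf (ε / 2) (half_pos hε),
    tendsto_one_div_add_atTop_nhds_zero_nat.eventually_lt_const (half_pos hε)]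
    with n ⟨c', hc', hclose⟩ hsmall
  linarith [hmin n c' hc']

theorem floor_two_rpow_pos {x : ℝ} (hx : 0 ≤ x) : 0 < ⌊(2 : ℝ) ^ x⌋₊ :=
  Nat.floor_pos.2 (Real.one_le_rpow one_le_two hx)

theorem two_rpow_sub_one_le_floor {x : ℝ} (hx : 0 ≤ x) :
    (2 : ℝ) ^ (x - 1) ≤ ⌊(2 : ℝ) ^ x⌋₊ := by
  have hfloor : (1 : ℝ) ≤ ⌊(2 : ℝ) ^ x⌋₊ := Nat.one_le_cast.2 (floor_two_rpow_pos hx)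
  rw [Real.rpow_sub two_pos, Real.rpow_one]
  linarith [Nat.lt_floor_add_one ((2 : ℝ) ^ x)]

theorem tendsto_logb_floor_two_rpow_div {x : ℝ} (hx : 0 ≤ x) :
    Tendsto (fun n : ℕ => Real.logb 2 ⌊(2 : ℝ) ^ (n * x)⌋₊ / n) atTop (𝓝 x) := by
  have hlower : Tendsto (fun n : ℕ => x - 1 / (n : ℝ)) atTop (𝓝 x) := by
    simpa only [sub_zero] using tendsto_one_div_atTop_nhds_zero_nat.const_sub x
  refine tendsto_of_tendsto_of_tendsto_of_le_of_le' hlower tendsto_const_nhds ?_ ?_ <;>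
    filter_upwards [eventually_gt_atTop 0] with n hn
  all_goals
    have hn' : (0 : ℝ) < n := Nat.cast_pos.2 hn
    have hnx : 0 ≤ n * x := mul_nonneg hn'.le hx
    have hfloor : (0 : ℝ) < ⌊(2 : ℝ) ^ (n * x)⌋₊ := Nat.cast_pos.2 (floor_two_rpow_pos hnx)
  · rw [le_div_iff₀' hn', mul_sub, mul_one_div_cancel hn'.ne',
      Real.le_logb_iff_rpow_le one_lt_two hfloor]
    exact two_rpow_sub_one_le_floor hnx
  · rw [div_le_iff₀' hn', Real.logb_le_iff_le_rpow one_lt_two hfloor]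
    exact Nat.floor_le (by positivity)

theorem floor_mul_floor_le {x y z c : ℝ} (hz : 0 ≤ z) (h : x + y + 1 ≤ z + c) :
    ((⌊(2 : ℝ) ^ x⌋₊ * ⌊(2 : ℝ) ^ y⌋₊ : ℕ) : ℝ) ≤ ⌊(2 : ℝ) ^ z⌋₊ * 2 ^ c := by
  push_cast
  calc (⌊(2 : ℝ) ^ x⌋₊ : ℝ) * ⌊(2 : ℝ) ^ y⌋₊
      ≤ 2 ^ x * 2 ^ y := by gcongr <;> exact Nat.floor_le (by positivity)
    _ = 2 ^ (x + y) := (Real.rpow_add two_pos x y).symm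
    _ ≤ 2 ^ (z - 1 + c) := Real.rpow_le_rpow_of_exponent_le one_le_two (by linarith)
    _ = 2 ^ (z - 1) * 2 ^ c := Real.rpow_add two_pos _ _
    _ ≤ ⌊(2 : ℝ) ^ z⌋₊ * 2 ^ c := by gcongr; exact two_rpow_sub_one_le_floor hz

end Rates

section TrivialCode

theorem exists_isometry (a b : Type*) [Fintype a] [DecidableEq a] [Fintype b] [Nonempty b] :
    ∃ V : Matrix (b × a) a ℂ, Vᴴ * V = 1 := by
  classical
  obtain ⟨y⟩ := ‹Nonempty b›
  refine ⟨(1 : Matrix (b × a) (b × a) ℂ).submatrix id (Prod.mk y), ?_⟩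
  rw [conjTranspose_submatrix, conjTranspose_one, ← submatrix_mul _ _ _ _ _ Function.bijective_id,
    Matrix.one_mul, submatrix_one _ (Prod.mk_right_injective y)]

variable {A' S S' B E : Type*} [Fintype A'] [Fintype S] [Fintype S'] [Fintype B] [Fintype E]
  [DecidableEq A'] [DecidableEq S] [DecidableEq S'] [DecidableEq B] [Nonempty A']
  {N : Matrix (A' × S) (A' × S) ℂ →ₗ[ℂ] Matrix B B ℂ} {U : Matrix (B × E) (A' × S) ℂ}
  {ψ : S × S' → ℂ}

theorem hasCode_one_one_one (hU : IsIsometricExtension N U) (hψ : IsKet ψ) (n : ℕ) :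
    HasCode N ψ n 1 1 1 0 := by
  obtain ⟨V, hV⟩ := exists_isometry (Fin 1 × Fin 1 × (Fin n → S')) ((Fin n → A') × Fin 1)
  obtain ⟨W, hW⟩ := exists_isometry ((Fin n → B) × Fin 1) (Fin 1 × Fin 1)
  set Ω := receiveKet U W (pushKet V (inputKet ψ n 1 1)) with hΩ
  have hnorm : ‖Ω‖ = 1 := by
    rw [hΩ, frobenius_norm_receiveKet hU.1 hW, frobenius_norm_pushKet hV,
      frobenius_norm_inputKet one_pos one_pos hψ]
  have hket : IsKet (Ω default) := by
    rw [IsKet, ← Fintype.sum_subsingleton (fun p => ∑ x, ‖Ω p x‖ ^ 2), ← frobenius_norm_sq, hnorm,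
      one_pow]
  have hproduct : Ω = vecMulVec (targetKet 1 1) (Ω default) := by
    ext p x
    rw [Subsingleton.elim p default]
    simp [vecMulVec_apply, targetKet, maxEnt, eq_iff_true_of_subsingleton]
  simpa only [mul_zero] using hasCode_of_frobenius_norm_sub_le hU ψ one_pos one_pos one_pos hV hW
    hket zero_le_one (by rw [← hΩ, ← hproduct, sub_self, norm_zero])

theorem unassistedAchievable_zero (hU : IsIsometricExtension N U) (hψ : IsKet ψ) :
    UnassistedAchievable N ψ 0 :=
  ⟨fun _ => 1, fun _ => 0, hasCode_one_one_one hU hψ, tendsto_const_nhds, by simp⟩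

theorem le_unassistedCapacity (hN : IsChannel N) (hψ : IsKet ψ) {Q : ℝ}
    (hQ : 0 ≤ Q → UnassistedAchievable N ψ Q) : (Q : EReal) ≤ unassistedCapacity N ψ := by
  obtain ⟨k, U, hU⟩ := exists_isIsometricExtension hN
  rcases le_or_gt 0 Q with hQ0 | hQ0
  · exact le_biSup (fun R : ℝ => (R : EReal)) (hQ hQ0)
  · exact (EReal.coe_le_coe_iff.2 hQ0.le).trans
      (le_biSup (fun R : ℝ => (R : EReal)) (unassistedAchievable_zero hU hψ))

end TrivialCode

section Achievability

variable {A A' S S' B E D : Type*} [Fintype A] [Fintype A'] [Fintype S] [Fintype S'] [Fintype B]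
  [Fintype E] [Fintype D] [DecidableEq A] [DecidableEq A'] [DecidableEq S] [DecidableEq S']
  [DecidableEq B] [DecidableEq E] [DecidableEq D]
  {N : Matrix (A' × S) (A' × S) ℂ →ₗ[ℂ] Matrix B B ℂ} {U : Matrix (B × E) (A' × S) ℂ}
  {ψ : S × S' → ℂ} {v : (A × A' × S) × D → ℂ} {q x y : ℝ}

theorem eventually_exists_hasCode_logb_near (hU : IsIsometricExtension N U)
    (hv : ‖senderKet v‖ = 1)
    (hvψ : sideKet (senderKet v) * (sideKet (senderKet v))ᴴ = traceSnd (proj ψ))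
    (hq : 0 < q) (hx : 0 ≤ x) (hy : 0 ≤ y) (hsender : q + x - y ≤ condEntropy (senderKet v))
    (hreceiver : q + y - x ≤ condEntropy (receiverKet U v)) {ε : ℝ} (hε : 0 < ε) :
    ∀ᶠ n : ℕ in atTop, ∃ r : ℕ,
      HasCode N ψ n r ⌊(2 : ℝ) ^ (n * x)⌋₊ ⌊(2 : ℝ) ^ (n * y)⌋₊ ε ∧
        |Real.logb 2 r / n - q| < ε := by
  obtain ⟨d, hd, hdmin⟩ : ∃ d : ℝ, 0 < d ∧ d ≤ min (ε / 2) q := ⟨_, by positivity, le_rfl⟩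
  have hdq : 0 ≤ q - d := sub_nonneg.2 (hdmin.trans (min_le_right _ _))
  have hdε : d ≤ ε / 2 := hdmin.trans (min_le_left _ _)
  filter_upwards [eventually_hasCode hU hv hvψ (half_pos hd) hε,
    Metric.tendsto_nhds.1 (tendsto_logb_floor_two_rpow_div hdq) (ε / 2) (half_pos hε),
    (tendsto_natCast_atTop_atTop (R := ℝ)).eventually_ge_atTop (2 / d)] with n hcode hrate hn
  have hnd : 1 ≤ n * (d / 2) := by
    rw [div_le_iff₀ hd] at hn
    linarith
  have hn0 : (0 : ℝ) ≤ n := Nat.cast_nonneg n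
  have hnx : 0 ≤ n * x := mul_nonneg hn0 hx
  have hny : 0 ≤ n * y := mul_nonneg hn0 hy
  refine ⟨⌊(2 : ℝ) ^ (n * (q - d))⌋₊, hcode _ _ _ (floor_two_rpow_pos (mul_nonneg hn0 hdq))
    (floor_two_rpow_pos hnx) (floor_two_rpow_pos hny) (floor_mul_floor_le hny ?_)
    (floor_mul_floor_le hnx ?_), ?_⟩
  · linarith [mul_le_mul_of_nonneg_left hsender hn0]
  · linarith [mul_le_mul_of_nonneg_left hreceiver hn0]
  · rw [Real.dist_eq] at hrate
    calc |_ - q| ≤ |_ - (q - d)| + |(q - d) - q| := abs_sub_le _ _ _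
      _ < ε := by rw [sub_sub_cancel_left, abs_neg, abs_of_pos hd]; linarith

variable (hU : IsIsometricExtension N U) (hψ : IsKet ψ) (hv : ‖senderKet v‖ = 1)
  (hvψ : sideKet (senderKet v) * (sideKet (senderKet v))ᴴ = traceSnd (proj ψ))
include hU hψ hv hvψ

theorem achievableWithEntanglement_of_le_condEntropy (hq : 0 < q) (hx : 0 ≤ x) (hy : 0 ≤ y)
    (hsender : q + x - y ≤ condEntropy (senderKet v))
    (hreceiver : q + y - x ≤ condEntropy (receiverKet U v)) :
    AchievableWithEntanglement N ψ q x y := by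
  obtain ⟨-, a', -⟩ := nonempty_of_frobenius_norm_eq_one hv
  have : Nonempty A' := ⟨a'⟩
  obtain ⟨c, hc, hlim⟩ := exists_seq_tendsto_of_forall_eventually_exists
    (P := fun n (c : ℕ × ℕ × ℕ × ℝ) => HasCode N ψ n c.1 c.2.1 c.2.2.1 c.2.2.2)
    (f := fun n c => (c.2.2.2, Real.logb 2 c.1 / n, Real.logb 2 c.2.1 / n,
      Real.logb 2 c.2.2.1 / n)) (a := ((0 : ℝ), q, x, y))
    (fun n => ⟨(1, 1, 1, 0), hasCode_one_one_one hU hψ n⟩) fun ε hε => by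
      filter_upwards [eventually_exists_hasCode_logb_near hU hv hvψ hq hx hy hsender hreceiver
        (half_pos hε),
        Metric.tendsto_nhds.1 (tendsto_logb_floor_two_rpow_div hx) ε hε,
        Metric.tendsto_nhds.1 (tendsto_logb_floor_two_rpow_div hy) ε hε]
        with n ⟨r, hcode, hr⟩ ht hh
      refine ⟨(r, _, _, ε / 2), hcode, ?_⟩
      simp only [Prod.dist_eq, max_lt_iff]
      refine ⟨?_, hr.trans (half_lt_self hε), ht, hh⟩
      rw [Real.dist_0_eq_abs, abs_of_pos (half_pos hε)]
      exact half_lt_self hε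
  exact ⟨fun n => (c n).1, fun n => (c n).2.1, fun n => (c n).2.2.1, fun n => (c n).2.2.2, hc,
    hlim.fst_nhds, hlim.snd_nhds.fst_nhds, hlim.snd_nhds.snd_nhds.fst_nhds,
    hlim.snd_nhds.snd_nhds.snd_nhds⟩

theorem unassistedAchievable_of_le_condEntropy (hq : 0 ≤ q) (hy : 0 ≤ y)
    (hsender : q - y ≤ condEntropy (senderKet v))
    (hreceiver : q + y ≤ condEntropy (receiverKet U v)) :
    UnassistedAchievable N ψ q := by
  obtain ⟨-, a', -⟩ := nonempty_of_frobenius_norm_eq_one hv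
  have : Nonempty A' := ⟨a'⟩
  rcases hq.eq_or_lt with rfl | hq
  · exact unassistedAchievable_zero hU hψ
  obtain ⟨c, hc, hlim⟩ := exists_seq_tendsto_of_forall_eventually_exists
    (P := fun n (c : ℕ × ℝ) => HasCode N ψ n c.1 1 1 c.2)
    (f := fun n c => (c.2, Real.logb 2 c.1 / n)) (a := ((0 : ℝ), q))
    (fun n => ⟨(1, 0), hasCode_one_one_one hU hψ n⟩) fun ε hε => by
      filter_upwards [eventually_exists_hasCode_logb_near hU hv hvψ hq le_rfl hy
        (by rwa [add_zero]) (by rwa [sub_zero]) (half_pos hε)] with n ⟨r, hcode, hr⟩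
      rw [mul_zero, Real.rpow_zero, Nat.floor_one] at hcode
      refine ⟨(r, ε / 2), hcode.discard_entanglement, ?_⟩
      rw [Prod.dist_eq, max_lt_iff, Real.dist_0_eq_abs, abs_of_pos (half_pos hε)]
      exact ⟨half_lt_self hε, hr.trans (half_lt_self hε)⟩
  exact ⟨fun n => (c n).1, fun n => (c n).2, hc, hlim.fst_nhds, hlim.snd_nhds⟩

end Achievability

section Entropies

variable {A A' S S' B E D X Z : Type*}

theorem exists_purification [Fintype X] {ρ : Matrix X X ℂ} (hρ : IsState ρ) :
    ∃ v : X × X → ℂ, traceSnd (proj v) = ρ := by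
  obtain ⟨G, rfl⟩ := exists_eq_conjTranspose_mul_self hρ.1
  refine ⟨fun p => Gᴴ p.1 p.2, ?_⟩
  rw [traceSnd_proj]
  exact congrArg (Gᴴ * ·) (conjTranspose_conjTranspose G)

theorem IsState.nonempty [Fintype X] {ρ : Matrix X X ℂ} (hρ : IsState ρ) : Nonempty X := by
  by_contra hempty
  rw [not_nonempty_iff] at hempty
  exact zero_ne_one (Matrix.trace_eq_zero_of_isEmpty ρ ▸ hρ.2)

theorem IsIsometricExtension.trace_apply [Fintype A] [Fintype B] [Fintype E] [DecidableEq A]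
    {N : Matrix A A ℂ →ₗ[ℂ] Matrix B B ℂ} {U : Matrix (B × E) A ℂ}
    (hU : IsIsometricExtension N U) (ρ : Matrix A A ℂ) : (N ρ).trace = ρ.trace := by
  have htrace : (traceSnd (U * ρ * Uᴴ)).trace = (U * ρ * Uᴴ).trace := by
    simp only [trace, traceSnd, diag_apply, of_apply, Fintype.sum_prod_type]
  rw [hU.2, htrace, trace_mul_comm, ← Matrix.mul_assoc, hU.1, Matrix.one_mul]

theorem IsIsometricExtension.traceSnd_applySnd [Fintype A] [Fintype B] [Fintype E] [DecidableEq A]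
    {N : Matrix A A ℂ →ₗ[ℂ] Matrix B B ℂ} {U : Matrix (B × E) A ℂ}
    (hU : IsIsometricExtension N U) (ρ : Matrix (X × A) (X × A) ℂ) :
    traceSnd (applySnd N ρ) = traceSnd ρ := by
  ext i j
  exact hU.trace_apply (Matrix.of fun x y => ρ (i, x) (j, y))

theorem sideKet_mul_conjTranspose [Fintype A] [Fintype Z] (w : Matrix (A × X) Z ℂ) :
    sideKet w * (sideKet w)ᴴ = traceFst (w * wᴴ) := by
  ext x y
  exact Fintype.sum_prod_type _

theorem mutualInfo_mul_conjTranspose [Fintype A] [Fintype X] [Fintype Z] [DecidableEq A]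
    [DecidableEq X] (w : Matrix (A × X) Z ℂ) :
    mutualInfo (w * wᴴ) = entropy (traceSnd (w * wᴴ)) - condEntropy w := by
  rw [mutualInfo, condEntropy, sideKet_mul_conjTranspose]
  ring

theorem mutualInfo_eq_entropy_add_coherentInfo [Fintype A] [Fintype B] [DecidableEq A]
    [DecidableEq B] (ρ : Matrix (A × B) (A × B) ℂ) :
    mutualInfo ρ = entropy (traceSnd ρ) + coherentInfo ρ :=
  add_sub_assoc _ _ _

/-- For a pure state on `A X Z`, `I(A⟩Z) = H(Z) - H(A Z) = H(A X) - H(X) = H(A|X)`. -/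
theorem coherentInfo_transpose_sideKet [Fintype A] [Fintype X] [Fintype Z] [DecidableEq A]
    [DecidableEq X] [DecidableEq Z] (w : Matrix (A × X) Z ℂ) :
    coherentInfo ((sideKet w)ᵀ * (sideKet w)ᵀᴴ) = condEntropy w := by
  have hmarginal : traceFst ((sideKet w)ᵀ * (sideKet w)ᵀᴴ) = wᵀ * wᵀᴴ := by
    ext z z'
    simp only [traceFst, of_apply, mul_apply, transpose_apply, conjTranspose_apply, sideKet,
      Fintype.sum_prod_type]
  rw [coherentInfo, condEntropy, hmarginal, entropy_transpose_mul_conjTranspose,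
    entropy_transpose_mul_conjTranspose]

theorem traceSnd_transpose_sideKet [Fintype X] [Fintype Z] (w : Matrix (A × X) Z ℂ) :
    traceSnd ((sideKet w)ᵀ * (sideKet w)ᵀᴴ) = traceSnd (w * wᴴ) := by
  ext i j
  exact Finset.sum_comm

theorem traceSnd_traceMid [Fintype A'] [Fintype S] (σ : Matrix (A × A' × S) (A × A' × S) ℂ) :
    traceSnd (traceMid σ) = traceSnd σ := by
  ext i j
  simp only [traceSnd, traceMid, of_apply, Fintype.sum_prod_type]
  exact Finset.sum_comm

theorem traceFst_traceMid [Fintype A] [Fintype A'] (σ : Matrix (A × A' × S) (A × A' × S) ℂ) :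
    traceFst (traceMid σ) = traceFst (traceFst σ) := by
  ext i j
  exact Finset.sum_comm

theorem senderKet_mul_conjTranspose [Fintype A'] [Fintype D] (v : (A × A' × S) × D → ℂ) :
    senderKet v * (senderKet v)ᴴ = traceMid (traceSnd (proj v)) := by
  ext p q
  exact Fintype.sum_prod_type _

theorem sideKet_senderKet_mul_conjTranspose [Fintype A] [Fintype A'] [Fintype D]
    (v : (A × A' × S) × D → ℂ) :
    sideKet (senderKet v) * (sideKet (senderKet v))ᴴ = traceFst (traceFst (traceSnd (proj v))) := by
  rw [sideKet_mul_conjTranspose, senderKet_mul_conjTranspose, traceFst_traceMid]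

variable [Fintype A'] [Fintype S] [Fintype D]

theorem frobenius_norm_senderKet_eq_one [Fintype A] {v : (A × A' × S) × D → ℂ}
    (hv : IsState (traceSnd (proj v))) : ‖senderKet v‖ = 1 := by
  rw [← pow_left_inj₀ (norm_nonneg _) zero_le_one two_ne_zero, one_pow, frobenius_norm_senderKet,
    frobenius_norm_sq_eq_re_trace, ← traceSnd_proj, hv.2, Complex.one_re]

variable [Fintype B] [Fintype E] [DecidableEq A'] [DecidableEq S]
  {N : Matrix (A' × S) (A' × S) ℂ →ₗ[ℂ] Matrix B B ℂ} {U : Matrix (B × E) (A' × S) ℂ}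
  (hU : IsIsometricExtension N U) (v : (A × A' × S) × D → ℂ)
include hU

theorem applySnd_traceSnd_proj :
    applySnd N (traceSnd (proj v)) =
      (sideKet (receiverKet U v))ᵀ * (sideKet (receiverKet U v))ᵀᴴ := by
  rw [traceSnd_proj, applySnd_mul_conjTranspose hU.2]
  rfl

theorem coherentInfo_applySnd_traceSnd_proj [Fintype A] [DecidableEq A] [DecidableEq B]
    [DecidableEq E] [DecidableEq D] :
    coherentInfo (applySnd N (traceSnd (proj v))) = condEntropy (receiverKet U v) := by
  rw [applySnd_traceSnd_proj hU, coherentInfo_transpose_sideKet]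

theorem mutualInfo_applySnd_traceSnd_proj [Fintype A] [DecidableEq A] [DecidableEq B]
    [DecidableEq E] [DecidableEq D] :
    mutualInfo (applySnd N (traceSnd (proj v))) =
      entropy (traceSnd (traceSnd (proj v))) + condEntropy (receiverKet U v) := by
  rw [mutualInfo_eq_entropy_add_coherentInfo, hU.traceSnd_applySnd,
    coherentInfo_applySnd_traceSnd_proj hU]

theorem mutualInfo_traceFst_proj_outputKet [Fintype A] [DecidableEq A] [DecidableEq E]
    [DecidableEq D] :
    mutualInfo (traceFst (proj (outputKet U v))) =
      entropy (traceSnd (traceSnd (proj v))) - condEntropy (receiverKet U v) := by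
  have hgram : traceFst (proj (outputKet U v)) = receiverKet U v * (receiverKet U v)ᴴ := rfl
  rw [hgram, mutualInfo_mul_conjTranspose, ← traceSnd_transpose_sideKet,
    ← applySnd_traceSnd_proj hU, hU.traceSnd_applySnd]

omit [Fintype B] [Fintype E] [DecidableEq A'] hU in
theorem mutualInfo_traceMid_traceSnd_proj [Fintype A] [DecidableEq A] :
    mutualInfo (traceMid (traceSnd (proj v))) =
      entropy (traceSnd (traceSnd (proj v))) - condEntropy (senderKet v) := by
  rw [← senderKet_mul_conjTranspose, mutualInfo_mul_conjTranspose, senderKet_mul_conjTranspose,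
    traceSnd_traceMid]

end Entropies

section InformationRates

variable {A A' S S' B : Type*} [Fintype A] [DecidableEq A] [Fintype A'] [DecidableEq A']
  [Fintype S] [DecidableEq S] [Fintype S'] [DecidableEq S'] [Fintype B] [DecidableEq B]
  {N : Matrix (A' × S) (A' × S) ℂ →ₗ[ℂ] Matrix B B ℂ} {ψ : S × S' → ℂ}

section Purification

variable {E D : Type*} [Fintype E] [DecidableEq E] [Fintype D] [DecidableEq D]
  {U : Matrix (B × E) (A' × S) ℂ} {v : (A × A' × S) × D → ℂ}

omit [DecidableEq S'] in
theorem mutualInfo_sub_entanglementCost (hU : IsIsometricExtension N U)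
    (v : (A × A' × S) × D → ℂ) :
    (1 / 2 * mutualInfo (applySnd N (traceSnd (proj v))) -
        1 / 2 * mutualInfo (traceMid (traceSnd (proj v)))) -
      1 / 2 * (mutualInfo (traceFst (proj (outputKet U v))) -
        mutualInfo (traceMid (traceSnd (proj v)))) =
    coherentInfo (applySnd N (traceSnd (proj v))) := by
  rw [mutualInfo_applySnd_traceSnd_proj hU, mutualInfo_traceFst_proj_outputKet hU,
    coherentInfo_applySnd_traceSnd_proj hU]
  ring

variable (hU : IsIsometricExtension N U) (hψ : IsKet ψ) (hσ : IsState (traceSnd (proj v)))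
  (hσS : traceFst (traceFst (traceSnd (proj v))) = traceSnd (proj ψ))
include hU hψ hσ hσS

theorem achievableWithEntanglement_mutualInfo
    (hlt : mutualInfo (traceMid (traceSnd (proj v))) <
      mutualInfo (applySnd N (traceSnd (proj v)))) :
    AchievableWithEntanglement N ψ
      (1 / 2 * mutualInfo (applySnd N (traceSnd (proj v))) -
        1 / 2 * mutualInfo (traceMid (traceSnd (proj v))))
      (1 / 2 * mutualInfo (traceFst (proj (outputKet U v))))
      (1 / 2 * mutualInfo (traceMid (traceSnd (proj v)))) := by
  have hsenderNorm := frobenius_norm_senderKet_eq_one hσ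
  have hsender : 0 ≤ mutualInfo (traceMid (traceSnd (proj v))) := by
    rw [← senderKet_mul_conjTranspose]
    exact mutualInfo_nonneg (isState_mul_conjTranspose_self hsenderNorm)
  have hreceiver : 0 ≤ mutualInfo (traceFst (proj (outputKet U v))) :=
    mutualInfo_nonneg (isState_mul_conjTranspose_self (w := receiverKet U v)
      ((frobenius_norm_receiverKet hU.1 v).trans hsenderNorm))
  refine achievableWithEntanglement_of_le_condEntropy hU hψ hsenderNorm
    (by rw [sideKet_senderKet_mul_conjTranspose, hσS]) (by linarith) (by linarith) (by linarith)
    (le_of_eq ?_) (le_of_eq ?_) <;>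
  · rw [mutualInfo_applySnd_traceSnd_proj hU, mutualInfo_traceFst_proj_outputKet hU,
      mutualInfo_traceMid_traceSnd_proj]
    ring

omit [DecidableEq E] [DecidableEq D] in
/-- The surplus `y = I(A⟩B) - Q` is used to return entanglement, which is then discarded. -/
theorem unassistedAchievable_of_purification {Q : ℝ} (hQ₀ : 0 ≤ Q)
    (hQ : Q ≤ coherentInfo (applySnd N (traceSnd (proj v))))
    (hQ' : Q ≤ 1 / 2 * mutualInfo (applySnd N (traceSnd (proj v))) -
      1 / 2 * mutualInfo (traceMid (traceSnd (proj v)))) :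
    UnassistedAchievable N ψ Q := by
  classical
  rw [coherentInfo_applySnd_traceSnd_proj hU] at hQ
  rw [mutualInfo_applySnd_traceSnd_proj hU, mutualInfo_traceMid_traceSnd_proj] at hQ'
  exact unassistedAchievable_of_le_condEntropy hU hψ (frobenius_norm_senderKet_eq_one hσ)
    (by rw [sideKet_senderKet_mul_conjTranspose, hσS]) hQ₀ (sub_nonneg.2 hQ)
    (by linarith) (by linarith)

end Purification

theorem unassistedAchievable_of_le_coherentInfo (hN : IsChannel N) (hψ : IsKet ψ)
    {σ : Matrix (A × A' × S) (A × A' × S) ℂ} (hσ : IsState σ)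
    (hσS : traceFst (traceFst σ) = traceSnd (proj ψ)) {Q : ℝ} (hQ₀ : 0 ≤ Q)
    (hQ : Q ≤ min (coherentInfo (applySnd N σ))
      (1 / 2 * mutualInfo (applySnd N σ) - 1 / 2 * mutualInfo (traceMid σ))) :
    UnassistedAchievable N ψ Q := by
  obtain ⟨k, U, hU⟩ := exists_isIsometricExtension hN
  obtain ⟨v, rfl⟩ := exists_purification hσ
  exact unassistedAchievable_of_purification hU hψ hσ hσS hQ₀ (hQ.trans (min_le_left _ _))
    (hQ.trans (min_le_right _ _))

end InformationRates

end QSideInfo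

end

theorem mainTheorem2
    {A A' S S' B : Type*}
    [Fintype A] [DecidableEq A] [Fintype A'] [DecidableEq A']
    [Fintype S] [DecidableEq S] [Fintype S'] [DecidableEq S']
    [Fintype B] [DecidableEq B]
    (N : Matrix (A' × S) (A' × S) ℂ →ₗ[ℂ] Matrix B B ℂ) (hN : QSideInfo.IsChannel N)
    (ψ : S × S' → ℂ) (hψ : QSideInfo.IsKet ψ)
    (σ : Matrix (A × A' × S) (A × A' × S) ℂ) (hσ : QSideInfo.IsState σ)
    (hσS : QSideInfo.traceFst (QSideInfo.traceFst σ) =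
      QSideInfo.traceSnd (QSideInfo.proj ψ))
    (IAB IAS Icoh : ℝ)
    (hIAB : IAB = QSideInfo.mutualInfo (QSideInfo.applySnd N σ))
    (hIAS : IAS = QSideInfo.mutualInfo (QSideInfo.traceMid σ))
    (hIcoh : Icoh = QSideInfo.coherentInfo (QSideInfo.applySnd N σ)) :
    (∀ (E D : Type*) [Fintype E] [DecidableEq E] [Fintype D] [DecidableEq D]
        (U : Matrix (B × E) (A' × S) ℂ) (v : (A × A' × S) × D → ℂ) (IAED : ℝ),
        QSideInfo.IsIsometricExtension N U →
        QSideInfo.traceSnd (QSideInfo.proj v) = σ →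
        IAED = QSideInfo.mutualInfo
          (QSideInfo.traceFst (QSideInfo.proj (QSideInfo.outputKet U v))) →
        (IAS < IAB → QSideInfo.AchievableWithEntanglement N ψ
          (1 / 2 * IAB - 1 / 2 * IAS) (1 / 2 * IAED) (1 / 2 * IAS)) ∧
        (1 / 2 * IAB - 1 / 2 * IAS) - 1 / 2 * (IAED - IAS) = Icoh ∧
        (0 ≤ 1 / 2 * (IAED - IAS) →
          (∀ Q : ℝ, 0 ≤ Q → Q ≤ Icoh → QSideInfo.UnassistedAchievable N ψ Q) ∧
          (Icoh : EReal) ≤ QSideInfo.unassistedCapacity N ψ)) ∧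
    (∀ Q : ℝ, 0 ≤ Q → Q ≤ min Icoh (1 / 2 * IAB - 1 / 2 * IAS) →
      QSideInfo.UnassistedAchievable N ψ Q) ∧
    ((min Icoh (1 / 2 * IAB - 1 / 2 * IAS) : ℝ) : EReal) ≤
      QSideInfo.unassistedCapacity N ψ := by
  open QSideInfo in
  subst hIAB hIAS hIcoh
  have hunassisted : ∀ Q : ℝ, 0 ≤ Q →
      Q ≤ min (coherentInfo (applySnd N σ))
        (1 / 2 * mutualInfo (applySnd N σ) - 1 / 2 * mutualInfo (traceMid σ)) →
      UnassistedAchievable N ψ Q :=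
    fun _ => unassistedAchievable_of_le_coherentInfo hN hψ hσ hσS
  have : Nonempty A' := hσ.nonempty.map fun p => p.2.1
  refine ⟨?_, hunassisted, le_unassistedCapacity hN hψ fun hmin => hunassisted _ hmin le_rfl⟩
  rintro E D _ _ _ _ U v _ hU rfl rfl
  have hrates := mutualInfo_sub_entanglementCost hU v
  refine ⟨achievableWithEntanglement_mutualInfo hU hψ hσ hσS, hrates, fun hcost => ?_⟩
  have hachievable : ∀ Q : ℝ, 0 ≤ Q → Q ≤ coherentInfo (applySnd N (traceSnd (proj v))) →
      UnassistedAchievable N ψ Q :=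
    fun Q hQ₀ hQ => hunassisted Q hQ₀ (le_min hQ (by linarith))
  exact ⟨hachievable, le_unassistedCapacity hN hψ fun hcoh => hachievable _ hcoh le_rfl⟩
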